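/- **Setting.** There are $M$ clients. Client $m$ has local data $\mathcal D_m$ (either a stream of i.i.d. samples, "online scenario", $n=\infty$, or a finite training set; in all cases of the same size $n\in\{1,2,\dots\}\cup\{\infty\}$) and a per-sample loss; $f_m(x,\mathcal B)$ is the average loss on a batch $\mathcal B$ (i.i.d. samples from a stream, distinct uniformly chosen samples from a finite set), $F_m(x)=\mathbb E_{\mathcal B\sim\mathcal D_m} f_m(x,\mathcal B)$, $F=\frac1M\sum_m F_m$ on $\mathbb R^d$, and $F_*=\inf F>-\infty$. **Algorithm (FedAMD, constant probability $p$).** Start from $x_0\in\mathbb R^d$ and $v_0^{(m)}=\nabla f_m(x_0,\mathcal B_{m,0})$ with batches of size $b$. In round $t=0,1,\dots$, choose $A$ of the $M$ clients uniformly without replacement and let $g_t=\frac1M\sum_m v_t^{(m)}$. Each chosen client is independently an *anchor* with probability $p$, else a *miner*. An anchor $i$ sets $v_{t+1}^{(i)}=\nabla f_i(x_t,\mathcal B_{i,t})$ with a fresh batch of size $b$; for every other client $v_{t+1}^{(m)}=v_t^{(m)}$. A miner $i$ puts $x^{(i)}_{t,-1}=x^{(i)}_{t,0}=x_t$, $g^{(i)}_{t,0}=g_t$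 and for $k=0,\dots,K-1$, with a fresh batch $\mathcal B'_{i,k}$ of size $b'$, $g^{(i)}_{t,k+1}=g^{(i)}_{t,k}-\nabla f_i(x^{(i)}_{t,k-1},\mathcal B'_{i,k})+\nabla f_i(x^{(i)}_{t,k},\mathcal B'_{i,k})$, $x^{(i)}_{t,k+1}=x^{(i)}_{t,k}-\eta_l\, g^{(i)}_{t,k+1}$. Then $x_{t+1}=x_t-\eta_s\cdot$ (the average of $x_t-x^{(i)}_{t,K}$ over the miners), and $x_{t+1}=x_t$ if there is no miner. **Assumptions.** For all clients $i$, all $v,\bar v\in\mathbb R^d$ and all batch sizes, with constants $L>0$, $\sigma,L_\sigma\ge0$, $\mu>0$: (1) $\|\nabla F_i(v)-\nabla F_i(\bar v)\|\le L\|v-\bar v\|$; (2) $\mathbb E_{\mathcal B\sim\mathcal D_i}\|\nabla f_i(v,\mathcal B)-\nabla F_i(v)\|^2\le\sigma^2/|\mathcal B|$; (3) $\mathbb E_{\mathcal B\sim\mathcal D_i}\|(\nabla f_i(v,\mathcal B)-\nabla f_i(\bar v,\mathcal B))-(\nabla F_i(v)-\nabla F_i(\bar v))\|^2\le\frac{L_\sigma^2}{|\mathcal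 B|}\|v-\bar v\|^2$; (4) (PL) $\|\nabla F(v)\|^2\ge2\mu(F(v)-F_*)$. **Claim.** Let $1\le A\le M$, let $c\ge1$ be a constant, and let $$p=\frac1c\left(\Big(1+\frac{A+1}{2\mu^2}\Big)-\sqrt{\Big(\frac{A+1}{2\mu^2}\Big)^2+\frac{A}{\mu^2}}\right)^{1/A},\quad K\ge\max\Big(1,\frac{2L_\sigma^2}{L^2}\Big),\quad b=\min\Big(\frac{\sigma^2}{M\mu\epsilon},\,n\Big),\quad b'=1,$$ $$\eta_l=\frac1{2\sqrt6\,KL},\qquad \eta_s=\min\left(\frac{\sqrt6\,AL}{M\mu c},\;2\sqrt6\Big(1+\frac{32MLc}{\mu A}\Big)^{-1}\right),$$ where $\sigma^2/(M\mu\epsilon)$ is rounded up to a positive integer. Treat $L$, $c$ and (a bound on) $F(x_0)-F_*$ as constants: the constants in the $O$'s below depend on nothing else. Then, for all $0<\epsilon\le\frac12$, there is $$T=O\left(\Big(\frac1\mu+\frac{M}{\mu^2A}+\frac MA\Big)\log\frac1\epsilon\right)$$ such that $\mathbb E F(x_{T'})-F_*\le\epsilon$ for all $T'\ge T$, and the number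 of samples called by all clients in the initialization and the first $T$ rounds (cumulative gradient complexity) is, in every realization and in particular in the online scenario $n=\infty$, $$O\left(\Big(\frac A\mu+\frac M{\mu^2}+M\Big)\Big(\frac{\sigma^2}{M\mu\epsilon}+K\Big)\log\frac1\epsilon\right).$$ -/

import Mathlib

open MeasureTheory ProbabilityTheory
open scoped ENNReal

namespace FedAMD

/-- The model space `ℝ^d` with its Euclidean norm. -/
abbrev Model (d : ℕ) := EuclideanSpace ℝ (Fin d)

/-- The local data of a client: a stream following a probability distribution (the online
scenario), or a nonempty finite training set of `n` samples. -/
inductive Dataset (Ξ : Type*) [MeasurableSpace Ξ] where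
  | stream (P : ProbabilityMeasure Ξ) : Dataset Ξ
  | finite (n : ℕ) (hn : 0 < n) (data : Fin n → Ξ) : Dataset Ξ

namespace Dataset

variable {Ξ : Type*} [MeasurableSpace Ξ]

/-- The number of samples; infinite for a stream. -/
def size : Dataset Ξ → ℕ∞
  | stream _ => ⊤
  | finite n _ _ => n

/-- The distribution of one sample drawn from the dataset. -/
noncomputable def law : Dataset Ξ → Measure Ξ
  | stream P => P
  | finite n _ data => (uniformOn (Set.univ : Set (Fin n))).map data

/-- The distribution of a batch of `s` samples: independent samples from a stream, `s` distinct
entries chosen uniformly (without replacement) from a finite training set. In the finite case it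
is meaningful for `s ≤ n`, and the batch with `s = n` is the whole training set. -/
noncomputable def batchLaw (s : ℕ) : Dataset Ξ → Measure (Fin s → Ξ)
  | stream P => Measure.pi fun _ => (P : Measure Ξ)
  | finite n _ data =>
      (uniformOn {e : Fin s → Fin n | Function.Injective e}).map fun e j => data (e j)

end Dataset

section Objective

variable {d M : ℕ} {Ξ : Type*}

/-- Empirical loss `x ↦ f(x, B)` of a batch `B`, where `f x ξ` is the loss of a single sample. -/
noncomputable def batchLoss (f : Model d → Ξ → ℝ) {s : ℕ} (B : Fin s → Ξ) (x : Model d) : ℝ :=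
  (s : ℝ)⁻¹ * ∑ j, f x (B j)

/-- Batch gradient `∇ f(x, B)`. -/
noncomputable def batchGrad (f : Model d → Ξ → ℝ) {s : ℕ} (B : Fin s → Ξ) (x : Model d) :
    Model d :=
  gradient (batchLoss f B) x

variable [MeasurableSpace Ξ]

/-- Expected loss `F_m` of a client with per-sample loss `f` and dataset `D`. -/
noncomputable def localLoss (f : Model d → Ξ → ℝ) (D : Dataset Ξ) (x : Model d) : ℝ :=
  ∫ ξ, f x ξ ∂D.law

/-- Global objective `F = (1/M) ∑ F_m`. -/
noncomputable def globalLoss (f : Fin M → Model d → Ξ → ℝ) (D : Fin M → Dataset Ξ)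
    (x : Model d) : ℝ :=
  (M : ℝ)⁻¹ * ∑ i, localLoss (f i) (D i) x

/-- Regularity that makes the problem well posed: losses of samples are differentiable in the
model, measurable in the sample, and have finite expectation. -/
def Regular (f : Fin M → Model d → Ξ → ℝ) (D : Fin M → Dataset Ξ) : Prop :=
  (∀ i ξ, Differentiable ℝ fun x => f i x ξ) ∧ (∀ i x, Measurable (f i x)) ∧
    ∀ i x, Integrable (f i x) (D i).law

/-- Every local objective is differentiable with `L`-Lipschitz gradient. -/
def LSmooth (f : Fin M → Model d → Ξ → ℝ) (D : Fin M → Dataset Ξ) (L : ℝ) : Prop :=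
  ∀ i, Differentiable ℝ (localLoss (f i) (D i)) ∧
    ∀ v w, ‖gradient (localLoss (f i) (D i)) v - gradient (localLoss (f i) (D i)) w‖
      ≤ L * ‖v - w‖

/-- Bounded noise: `E ‖∇f_i(v,B) - ∇F_i(v)‖² ≤ σ² / |B|`. -/
def BoundedNoise (f : Fin M → Model d → Ξ → ℝ) (D : Fin M → Dataset Ξ) (σ : ℝ) : Prop :=
  ∀ (i : Fin M) (s : ℕ), 1 ≤ s → (s : ℕ∞) ≤ (D i).size → ∀ v : Model d,
    ∫⁻ B, ‖batchGrad (f i) B v - gradient (localLoss (f i) (D i)) v‖ₑ ^ 2 ∂(D i).batchLaw s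
      ≤ ENNReal.ofReal (σ ^ 2 / s)

/-- Average smoothness:
`E ‖(∇f_i(v,B) - ∇f_i(w,B)) - (∇F_i(v) - ∇F_i(w))‖² ≤ (Lσ² / |B|) ‖v - w‖²`. -/
def AverageSmooth (f : Fin M → Model d → Ξ → ℝ) (D : Fin M → Dataset Ξ) (Lσ : ℝ) : Prop :=
  ∀ (i : Fin M) (s : ℕ), 1 ≤ s → (s : ℕ∞) ≤ (D i).size → ∀ v w : Model d,
    ∫⁻ B, ‖(batchGrad (f i) B v - batchGrad (f i) B w)
        - (gradient (localLoss (f i) (D i)) v - gradient (localLoss (f i) (D i)) w)‖ₑ ^ 2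
          ∂(D i).batchLaw s
      ≤ ENNReal.ofReal (Lσ ^ 2 / s * ‖v - w‖ ^ 2)

/-- Polyak–Łojasiewicz condition with constant `μ` for a function with minimal value `Fstar`. -/
def PL (F : Model d → ℝ) (Fstar μ : ℝ) : Prop :=
  ∀ v, 2 * μ * (F v - Fstar) ≤ ‖gradient F v‖ ^ 2

end Objective

section Algorithm

variable {d M b b' K : ℕ} {Ξ : Type*}

/-- Local iteration of a miner: the triple `(x_{k-1}, x_k, g_k)`, started from `(x, x, g)`. With
the minibatch `B_k` it is updated by
`g_{k+1} = g_k - ∇f(x_{k-1}, B_k) + ∇f(x_k, B_k)` and `x_{k+1} = x_k - ηl g_{k+1}`. -/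
noncomputable def localStep (f : Model d → Ξ → ℝ) (ηl : ℝ) (B : Fin b' → Ξ)
    (z : Model d × Model d × Model d) : Model d × Model d × Model d :=
  let g' := z.2.2 - batchGrad f B z.1 + batchGrad f B z.2.1
  (z.2.1, z.2.1 - ηl • g', g')

/-- The local triple after `k` local updates with minibatches `B_0, …, B_{K-1}` (constant for
`k ≥ K`). -/
noncomputable def localState (f : Model d → Ξ → ℝ) (ηl : ℝ) (B : Fin K → Fin b' → Ξ)
    (x g : Model d) : ℕ → Model d × Model d × Model d
  | 0 => (x, x, g)
  | k + 1 =>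
      if h : k < K then localStep f ηl (B ⟨k, h⟩) (localState f ηl B x g k)
      else localState f ηl B x g k

/-- Model change `x - x_K` of a miner after its `K` local updates. -/
noncomputable def localChange (f : Model d → Ξ → ℝ) (ηl : ℝ) (B : Fin K → Fin b' → Ξ)
    (x g : Model d) : Model d :=
  x - (localState f ηl B x g K).2.1

/-- The randomness of one communication round: sampled set of participants, anchor coin of each
client, large batch of each client, and minibatches of each client. Only those of the clients that
need them are used. -/
abbrev RoundSeed (M b b' K : ℕ) (Ξ : Type*) :=
  Finset (Fin M) × (Fin M → Bool) × (Fin M → Fin b → Ξ) × (Fin M → Fin K → Fin b' → Ξ)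

/-- The randomness of a whole run: large batches for the initial caching gradients, then the seed
of each round. -/
abbrev Seed (M b b' K : ℕ) (Ξ : Type*) :=
  (Fin M → Fin b → Ξ) × (ℕ → RoundSeed M b b' K Ξ)

/-- Participants acting as anchors. -/
def anchors (r : RoundSeed M b b' K Ξ) : Finset (Fin M) := r.1.filter fun i => r.2.1 i = true

/-- Participants acting as miners. -/
def miners (r : RoundSeed M b b' K Ξ) : Finset (Fin M) := r.1.filter fun i => r.2.1 i = false

/-- Server state: global model and caching gradients. -/
abbrev State (d M : ℕ) := Model d × (Fin M → Model d)

/-- One communication round of the algorithm. Anchors refresh their caching gradients with a large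
batch at the current model; the model moves by `ηs` times the averaged change of the miners, who
are guided by the average of the current caching gradients. -/
noncomputable def roundStep (f : Fin M → Model d → Ξ → ℝ) (ηl ηs : ℝ) (z : State d M)
    (r : RoundSeed M b b' K Ξ) : State d M :=
  let x := z.1
  let v := z.2
  let g : Model d := (M : ℝ)⁻¹ • ∑ i, v i
  (if (miners r).Nonempty then
      x - ηs • (((miners r).card : ℝ)⁻¹ •
        ∑ i ∈ miners r, localChange (f i) ηl (r.2.2.2 i) x g)
    else x,
   fun i => if i ∈ anchors r then batchGrad (f i) (r.2.2.1 i) x else v i)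

/-- Server state at the beginning of round `t`, from the initial model `x₀`. -/
noncomputable def run (f : Fin M → Model d → Ξ → ℝ) (ηl ηs : ℝ) (x₀ : Model d)
    (ω : Seed M b b' K Ξ) : ℕ → State d M
  | 0 => (x₀, fun i => batchGrad (f i) (ω.1 i) x₀)
  | t + 1 => roundStep f ηl ηs (run f ηl ηs x₀ ω t) (ω.2 t)

/-- Cumulative gradient complexity of the first `T` rounds: the number of samples called by all
clients, including those for the initial caching gradients. An anchor calls `b` samples, a miner
calls `b'` samples in each of its `K` local updates. -/
def samplesCalled (ω : Seed M b b' K Ξ) (T : ℕ) : ℕ :=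
  M * b + ∑ t ∈ Finset.range T, ((anchors (ω.2 t)).card * b + (miners (ω.2 t)).card * (K * b'))

variable [MeasurableSpace Ξ]

/-- The law of an anchor coin, `true` with probability `p`. -/
noncomputable def coinLaw (p : ℝ) : Measure Bool :=
  ENNReal.ofReal p • Measure.dirac true + ENNReal.ofReal (1 - p) • Measure.dirac false

/-- The law of the randomness of a round: `A` participants chosen uniformly without replacement,
independent coins with success probability `p`, and independent batches from the clients' data. -/
noncomputable def roundLaw (D : Fin M → Dataset Ξ) (A : ℕ) (p : ℝ) (b b' K : ℕ) :
    Measure (RoundSeed M b b' K Ξ) :=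
  (uniformOn {S : Finset (Fin M) | S.card = A}).prod
    ((Measure.pi fun _ : Fin M => coinLaw p).prod
      ((Measure.pi fun i : Fin M => (D i).batchLaw b).prod
        (Measure.pi fun i : Fin M => Measure.pi fun _ : Fin K => (D i).batchLaw b')))

/-- The law of the randomness of a run: independent initial batches, and independent identically
distributed rounds. -/
noncomputable def seedLaw (D : Fin M → Dataset Ξ) (A : ℕ) (p : ℝ) (b b' K : ℕ) :
    Measure (Seed M b b' K Ξ) :=
  (Measure.pi fun i : Fin M => (D i).batchLaw b).prod
    (Measure.infinitePi fun _ : ℕ => roundLaw D A p b b' K)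

end Algorithm

section Parameters

/-- Constant anchor probability
`p = (1/c) ((1 + (A+1)/(2μ²)) - √(((A+1)/(2μ²))² + A/μ²))^{1/A}`. -/
noncomputable def anchorProb (A : ℕ) (μ c : ℝ) : ℝ :=
  1 / c * ((1 + (A + 1) / (2 * μ ^ 2))
    - Real.sqrt (((A + 1) / (2 * μ ^ 2)) ^ 2 + A / μ ^ 2)) ^ (1 / (A : ℝ))

/-- Large batch size `b = min(σ²/(Mμε), n)`, where `σ²/(Mμε)` is rounded up to a positive
integer. -/
noncomputable def largeBatch (M : ℕ) (n : ℕ∞) (μ σ ε : ℝ) : ℕ :=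
  (min ((max 1 ⌈σ ^ 2 / (M * μ * ε)⌉₊ : ℕ) : ℕ∞) n).toNat

/-- Local learning rate `1 / (2√6 K L)`. -/
noncomputable def localRate (K : ℕ) (L : ℝ) : ℝ := 1 / (2 * Real.sqrt 6 * K * L)

/-- Global learning rate `min(√6 A L / (M μ c), 2√6 (1 + 32 M L c / (μ A))⁻¹)`. -/
noncomputable def globalRate (M A : ℕ) (L μ c : ℝ) : ℝ :=
  min (Real.sqrt 6 * A * L / (M * μ * c))
    (2 * Real.sqrt 6 * (1 + 32 * M * L * c / (μ * A))⁻¹)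

end Parameters

end FedAMD

/-! The proof follows a Lyapunov function that couples suboptimality with the age of the cached
gradients. To each cached gradient `v_m` attach the point `y_m` at which it was computed, and set Φ
= F(x) - F_* + λ · mean‖y_m - x‖². Write η = η_s K η_l for the effective step, ρ = pA/M for the
chance that a given client is an anchor, and q = 1 - p^A for the chance that some miner exists. With
λ = 6ηqL²/ρ, one round gives E Φ' ≤ (1 - ¾ηqμ) Φ + ⅝ηq‖n‖², where n is the mean sampling error of
the cache (`lintegral_lyapunov_step_le`).

Three facts feed this contraction. A miner's expected total change differs from Kη_l g by at most a
third of its length, and its second moment is at most 8/3 of (Kη_l‖g‖)² (`localChange_moments`).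
Descent and the PL inequality apply to the guide g = ∇F(x) + n + D, where smoothness bounds the
drift D by ‖D‖² ≤ L² · mean‖y_m - x‖². Finally, each staleness is reset with probability ρ and
otherwise grows by a factor 1 + ρ/2 plus a multiple of the squared move (`lyapunov_contraction`).

The error n does not accumulate: E‖Σ_{i∈S} error_i‖² ≤ |S| V for every set S of clients and every
round (`lintegral_cacheNoise_le`), where V bounds the variance of a large batch. Refreshed errors
are centred given the past, and which clients are refreshed is independent of the past. The choice
of b gives V ≤ Mμε, or V = 0 when the batch is the whole training set. Hence the noise floor is
(5/8)/(3/4) · V/(Mμ) ≤ 5ε/6, and enough rounds bring the contracted initial gap below ε/6.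

Unbiasedness of batch gradients is not a hypothesis; it is derived (`integral_gradient_eq`). The
noise bound makes the sample gradients integrable, average smoothness makes their mean continuous,
and integrating along lines identifies that mean with ∇F_i.

For the rate, p ≥ 1/(2c) and q ≥ 1/(2 + μ²). If μ ≤ L, these and the step sizes give 1/(¾ηqμ) =
O(1/μ + M/(μ²A)), and the extra M/A ≥ 1 pays for rounding up. If μ > L, the PL inequality and
smoothness force F to be constant, so zero rounds suffice. -/

namespace FedAMD

/-! ### Consequences of a Lipschitz gradient. -/

section Smooth

variable {E : Type*} [NormedAddCommGroup E] [InnerProductSpace ℝ E] [CompleteSpace E]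

/-- A differentiable function with `L`-Lipschitz gradient lies below its quadratic upper bound. -/
theorem le_quadratic_of_lipschitz_gradient {F : E → ℝ} {L : ℝ} (hF : Differentiable ℝ F)
    (hL : ∀ v w, ‖gradient F v - gradient F w‖ ≤ L * ‖v - w‖) (v w : E) :
    F w ≤ F v + inner ℝ (gradient F v) (w - v) + L / 2 * ‖w - v‖ ^ 2 := by
  -- The gap between F along the segment and its quadratic model is nonincreasing on [0,1]: the
  -- Lipschitz bound makes its derivative nonpositive. No integral of the gradient is needed.
  let φ : ℝ → ℝ := fun t => F (v + t • (w - v)) - t * inner ℝ (gradient F v) (w - v)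
    - t ^ 2 * (L / 2 * ‖w - v‖ ^ 2)
  have hd : ∀ t, HasDerivAt φ (inner ℝ (gradient F (v + t • (w - v))) (w - v)
      - inner ℝ (gradient F v) (w - v) - 2 * t * (L / 2 * ‖w - v‖ ^ 2)) t := by
    intro t
    have h1 : HasDerivAt (fun t : ℝ => v + t • (w - v)) (w - v) t := by
      simpa using ((hasDerivAt_id t).smul_const (w - v)).const_add v
    have h2 := ((hF (v + t • (w - v))).hasGradientAt.hasFDerivAt).comp_hasDerivAt t h1
    have h3 : HasDerivAt (fun t : ℝ => t * inner ℝ (gradient F v) (w - v))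
        (inner ℝ (gradient F v) (w - v)) t := by
      simpa using (hasDerivAt_id t).mul_const (inner ℝ (gradient F v) (w - v))
    have h4 : HasDerivAt (fun t : ℝ => t ^ 2 * (L / 2 * ‖w - v‖ ^ 2))
        (2 * t * (L / 2 * ‖w - v‖ ^ 2)) t := by
      simpa using (hasDerivAt_pow 2 t).mul_const (L / 2 * ‖w - v‖ ^ 2)
    have h5 := (h2.sub h3).sub h4
    rw [InnerProductSpace.toDual_apply_apply] at h5
    exact h5
  have hanti : AntitoneOn φ (Set.Icc 0 1) := by
    apply antitoneOn_of_deriv_nonpos (convex_Icc 0 1)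
    · exact fun t _ => (hd t).continuousAt.continuousWithinAt
    · exact fun t _ => (hd t).differentiableAt.differentiableWithinAt
    · intro t ht
      rw [interior_Icc] at ht
      rw [(hd t).deriv, ← inner_sub_left]
      have h1 : inner ℝ (gradient F (v + t • (w - v)) - gradient F v) (w - v)
          ≤ L * (t * ‖w - v‖) * ‖w - v‖ := by
        refine (real_inner_le_norm _ _).trans ?_
        refine mul_le_mul_of_nonneg_right ((hL _ _).trans_eq ?_) (norm_nonneg _)
        rw [add_sub_cancel_left, norm_smul, Real.norm_of_nonneg ht.1.le]
      nlinarith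
  have h := hanti (Set.left_mem_Icc.2 zero_le_one) (Set.right_mem_Icc.2 zero_le_one) zero_le_one
  simp only [φ, one_smul, zero_smul, add_zero, zero_mul, one_mul, sub_zero, one_pow,
    add_sub_cancel, ne_eq, OfNat.ofNat_ne_zero, not_false_eq_true, zero_pow] at h
  linarith

/-- The squared gradient of a smooth function is controlled by the suboptimality. -/
theorem norm_gradient_sq_le {F : E → ℝ} {L m : ℝ} (hL0 : 0 < L) (hF : Differentiable ℝ F)
    (hL : ∀ v w, ‖gradient F v - gradient F w‖ ≤ L * ‖v - w‖) (hm : ∀ v, m ≤ F v) (v : E) :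
    ‖gradient F v‖ ^ 2 ≤ 2 * L * (F v - m) := by
  -- A gradient step of length 1/L minimises the quadratic bound, and the value reached is still at
  -- least m.
  have h := le_quadratic_of_lipschitz_gradient hF hL v (v - L⁻¹ • gradient F v)
  have h1 := hm (v - L⁻¹ • gradient F v)
  have e : v - L⁻¹ • gradient F v - v = -(L⁻¹ • gradient F v) := by abel
  rw [e, inner_neg_right, inner_smul_right, real_inner_self_eq_norm_sq, norm_neg, norm_smul,
    Real.norm_of_nonneg (inv_nonneg.2 hL0.le)] at h
  have h2 : m ≤ F v - L⁻¹ / 2 * ‖gradient F v‖ ^ 2 := by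
    refine h1.trans (h.trans_eq ?_)
    field_simp
    ring
  have h3 : L⁻¹ / 2 * ‖gradient F v‖ ^ 2 ≤ F v - m := by linarith
  calc ‖gradient F v‖ ^ 2 = 2 * L * (L⁻¹ / 2 * ‖gradient F v‖ ^ 2) := by field_simp
    _ ≤ _ := by gcongr

end Smooth

/-! ### Resampling one coordinate of a product measure. -/

section Resample

variable {ι : Type*} {X : ι → Type*} [∀ i, MeasurableSpace (X i)]

/-- Resampling one coordinate preserves a product probability measure. -/
theorem map_update_infinitePi [DecidableEq ι] (μ : ∀ i, Measure (X i))
    [∀ i, IsProbabilityMeasure (μ i)] (k : ι) :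
    ((Measure.infinitePi μ).prod (μ k)).map
      (fun q : (∀ i, X i) × X k => Function.update q.1 k q.2) = Measure.infinitePi μ := by
  refine Measure.eq_infinitePi μ fun s t ht => ?_
  rw [Measure.map_apply measurable_update' (MeasurableSet.pi s.countable_toSet fun i _ => ht i)]
  by_cases hk : k ∈ s
  · have e : (fun q : (∀ i, X i) × X k => Function.update q.1 k q.2) ⁻¹' ((s : Set ι).pi t)
        = ((s.erase k : Finset ι) : Set ι).pi t ×ˢ t k := by
      ext ⟨ω, b⟩
      simp only [Set.mem_preimage, Set.mem_pi, Set.mem_prod, Finset.mem_coe, Finset.mem_erase]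
      constructor
      · intro h
        refine ⟨fun i hi => ?_, by simpa using h k hk⟩
        simpa [Function.update_of_ne hi.1] using h i hi.2
      · rintro ⟨h1, h2⟩ i hi
        by_cases hik : i = k
        · subst hik; simpa using h2
        · simpa [Function.update_of_ne hik] using h1 i ⟨hik, hi⟩
    rw [e, Measure.prod_prod, Measure.infinitePi_pi μ (fun i _ => ht i),
      Finset.prod_erase_mul _ _ hk]
  · have e : (fun q : (∀ i, X i) × X k => Function.update q.1 k q.2) ⁻¹' ((s : Set ι).pi t)
        = (s : Set ι).pi t ×ˢ Set.univ := by
      ext ⟨ω, b⟩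
      simp only [Set.mem_preimage, Set.mem_pi, Set.mem_prod, Finset.mem_coe, Set.mem_univ, and_true]
      refine forall₂_congr fun i hi => ?_
      rw [Function.update_of_ne (ne_of_mem_of_not_mem hi hk)]
    rw [e, Measure.prod_prod, Measure.infinitePi_pi μ (fun i _ => ht i), measure_univ, mul_one]

/-- This takes the place of conditional expectation: one coordinate is integrated first with the
others frozen. Quantities that ignore coordinate k become constants in the inner integral. -/
theorem lintegral_infinitePi_resample [DecidableEq ι] (μ : ∀ i, Measure (X i))
    [∀ i, IsProbabilityMeasure (μ i)] (k : ι) {φ : (∀ i, X i) → ℝ≥0∞} (hφ : Measurable φ) :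
    ∫⁻ ω, φ ω ∂Measure.infinitePi μ
      = ∫⁻ ω, ∫⁻ b, φ (Function.update ω k b) ∂μ k ∂Measure.infinitePi μ := by
  conv_lhs => rw [← map_update_infinitePi μ k]
  rw [lintegral_map hφ measurable_update',
    lintegral_prod (fun q : (∀ i, X i) × X k => φ (Function.update q.1 k q.2))
      (hφ.comp measurable_update').aemeasurable]

theorem lintegral_pi_resample [Fintype ι] [DecidableEq ι] (μ : ∀ i, Measure (X i))
    [∀ i, IsProbabilityMeasure (μ i)] (k : ι) {φ : (∀ i, X i) → ℝ≥0∞} (hφ : Measurable φ) :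
    ∫⁻ ω, φ ω ∂Measure.pi μ = ∫⁻ ω, ∫⁻ b, φ (Function.update ω k b) ∂μ k ∂Measure.pi μ := by
  rw [← Measure.infinitePi_eq_pi]
  exact lintegral_infinitePi_resample μ k hφ

theorem lintegral_pi_eval [Fintype ι] (μ : ∀ i, Measure (X i))
    [∀ i, IsProbabilityMeasure (μ i)] (k : ι) {φ : X k → ℝ≥0∞} (hφ : Measurable φ) :
    ∫⁻ ω, φ (ω k) ∂Measure.pi μ = ∫⁻ b, φ b ∂μ k := by
  classical
  rw [lintegral_pi_resample μ k (φ := fun ω => φ (ω k)) (hφ.comp (measurable_pi_apply k))]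
  simp

end Resample

/-! ### Second moments of centred random vectors. -/

section SecondMoment

variable {E : Type*} [NormedAddCommGroup E]

theorem enorm_sq_eq_ofReal (x : E) : ‖x‖ₑ ^ 2 = ENNReal.ofReal (‖x‖ ^ 2) := by
  rw [← ofReal_norm, ENNReal.ofReal_pow (norm_nonneg _)]

variable {Ω : Type*} [MeasurableSpace Ω] {μ : Measure Ω}

theorem memLp_two_of_lintegral_lt_top {X : Ω → E} (hX : AEStronglyMeasurable X μ)
    (h : ∫⁻ ω, ENNReal.ofReal (‖X ω‖ ^ 2) ∂μ < ∞) : MemLp X 2 μ := by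
  rw [memLp_two_iff_integrable_sq_norm hX]
  refine ⟨(hX.norm.pow 2), ?_⟩
  rw [hasFiniteIntegral_iff_ofReal (Filter.Eventually.of_forall fun ω => by positivity)]
  exact h

variable [InnerProductSpace ℝ E]

theorem integral_norm_const_add_sq [CompleteSpace E] [IsProbabilityMeasure μ] {X : Ω → E}
    (hX : MemLp X 2 μ) (c : E) :
    Integrable (fun ω => ‖c + X ω‖ ^ 2) μ ∧ ∫ ω, ‖c + X ω‖ ^ 2 ∂μ
      = ‖c‖ ^ 2 + 2 * inner ℝ c (∫ ω, X ω ∂μ) + ∫ ω, ‖X ω‖ ^ 2 ∂μ := by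
  have hi : Integrable X μ := hX.integrable one_le_two
  have hsq := (memLp_two_iff_integrable_sq_norm hX.1).1 hX
  have hin : Integrable (fun ω => 2 * inner ℝ c (X ω)) μ := (hi.const_inner c).const_mul 2
  have hc : Integrable (fun ω => ‖c‖ ^ 2 + 2 * inner ℝ c (X ω)) μ := (integrable_const _).add hin
  simp only [norm_add_sq_real]
  refine ⟨hc.add hsq, ?_⟩
  rw [integral_add hc hsq, integral_add (integrable_const _) hin, integral_const_mul,
    integral_inner hi]
  simp

/-- Adding a centred random vector to a constant adds at most its second moment. -/
theorem lintegral_norm_const_add_sq_le [CompleteSpace E] [IsProbabilityMeasure μ] {X : Ω → E}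
    (hX : Integrable X μ) (h0 : ∫ ω, X ω ∂μ = 0) (c : E) :
    ∫⁻ ω, ENNReal.ofReal (‖c + X ω‖ ^ 2) ∂μ
      ≤ ENNReal.ofReal (‖c‖ ^ 2) + ∫⁻ ω, ENNReal.ofReal (‖X ω‖ ^ 2) ∂μ := by
  by_cases hfin : ∫⁻ ω, ENNReal.ofReal (‖X ω‖ ^ 2) ∂μ < ∞
  · have hm := memLp_two_of_lintegral_lt_top hX.1 hfin
    have hsq := (memLp_two_iff_integrable_sq_norm hX.1).1 hm
    obtain ⟨hi, hval⟩ := integral_norm_const_add_sq hm c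
    rw [← ofReal_integral_eq_lintegral_ofReal hi
        (Filter.Eventually.of_forall fun ω => by positivity),
      ← ofReal_integral_eq_lintegral_ofReal hsq
        (Filter.Eventually.of_forall fun ω => by positivity),
      hval, h0, inner_zero_right, mul_zero, add_zero,
      ENNReal.ofReal_add (by positivity) (integral_nonneg fun ω => by positivity)]
  · rw [not_lt, top_le_iff] at hfin
    rw [hfin, add_top]
    exact le_top

/-- A random vector whose second moment around every constant exceeds the squared norm of the
constant by a bounded amount only is centred. -/
theorem integral_eq_zero_of_lintegral_norm_add_sq_le [CompleteSpace E] [IsProbabilityMeasure μ]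
    {X : Ω → E} (hX : AEStronglyMeasurable X μ) {V : ℝ} (hV : 0 ≤ V)
    (h : ∀ u : E, ∫⁻ ω, ENNReal.ofReal (‖u + X ω‖ ^ 2) ∂μ ≤ ENNReal.ofReal (‖u‖ ^ 2 + V)) :
    ∫ ω, X ω ∂μ = 0 := by
  have hfin : ∫⁻ ω, ENNReal.ofReal (‖X ω‖ ^ 2) ∂μ < ∞ := by
    have := h 0
    simp only [zero_add] at this
    exact this.trans_lt ENNReal.ofReal_lt_top
  have hm := memLp_two_of_lintegral_lt_top hX hfin
  set a := ∫ ω, X ω ∂μ with ha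
  -- Testing with the multiples s • a of the mean makes the cross term 2s‖a‖² grow without bound in
  -- s, while the hypothesis caps it by V.
  have key : ∀ s : ℝ, 2 * s * ‖a‖ ^ 2 ≤ V := by
    intro s
    obtain ⟨hi, hval⟩ := integral_norm_const_add_sq hm (s • a)
    have hs := h (s • a)
    rw [← ofReal_integral_eq_lintegral_ofReal hi
      (Filter.Eventually.of_forall fun ω => by positivity),
      ENNReal.ofReal_le_ofReal_iff (by positivity), hval, ← ha, inner_smul_left,
      real_inner_self_eq_norm_sq, conj_trivial] at hs
    have := integral_nonneg (μ := μ) (f := fun ω => ‖X ω‖ ^ 2) fun ω => by positivity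
    linarith
  by_contra hne
  have hpos : 0 < ‖a‖ ^ 2 := by positivity
  have := key ((V + 1) / (2 * ‖a‖ ^ 2))
  have e : 2 * ((V + 1) / (2 * ‖a‖ ^ 2)) * ‖a‖ ^ 2 = V + 1 := by field_simp
  linarith

/-- The variance of a sum of independent centred vectors is at most the sum of the second
moments. -/
theorem lintegral_pi_norm_add_sum_sq_le [CompleteSpace E] [MeasurableSpace E] [BorelSpace E]
    [SecondCountableTopology E] {ι : Type*} [Fintype ι] {Y : ι → Type*}
    [∀ i, MeasurableSpace (Y i)] (ν : ∀ i, Measure (Y i)) [∀ i, IsProbabilityMeasure (ν i)]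
    {ξ : ∀ i, Y i → E} (hξm : ∀ i, Measurable (ξ i)) (hξ : ∀ i, Integrable (ξ i) (ν i))
    (h0 : ∀ i, ∫ b, ξ i b ∂ν i = 0) {V : ι → ℝ≥0∞}
    (hV : ∀ i, ∫⁻ b, ENNReal.ofReal (‖ξ i b‖ ^ 2) ∂ν i ≤ V i) (c : E) (s : Finset ι) :
    ∫⁻ ω, ENNReal.ofReal (‖c + ∑ i ∈ s, ξ i (ω i)‖ ^ 2) ∂Measure.pi ν
      ≤ ENNReal.ofReal (‖c‖ ^ 2) + ∑ i ∈ s, V i := by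
  classical
  have hmeas : ∀ s : Finset ι, Measurable fun ω : ∀ i, Y i => c + ∑ i ∈ s, ξ i (ω i) := fun s =>
    measurable_const.add (Finset.measurable_sum _ fun i _ => (hξm i).comp (measurable_pi_apply i))
  induction s using Finset.induction_on with
  | empty => simp
  | insert k s hk ih =>
    -- Integrating coordinate k first turns the other summands into a constant shift of a centred
    -- vector.
    rw [lintegral_pi_resample ν k ((hmeas _).norm.pow_const 2).ennreal_ofReal]
    calc ∫⁻ ω, ∫⁻ b, ENNReal.ofReal
          (‖c + ∑ i ∈ insert k s, ξ i (Function.update ω k b i)‖ ^ 2) ∂ν k ∂Measure.pi ν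
        ≤ ∫⁻ ω, (ENNReal.ofReal (‖c + ∑ i ∈ s, ξ i (ω i)‖ ^ 2) + V k) ∂Measure.pi ν := by
          refine lintegral_mono fun ω => ?_
          have e : ∀ b, c + ∑ i ∈ insert k s, ξ i (Function.update ω k b i)
              = (c + ∑ i ∈ s, ξ i (ω i)) + ξ k b := by
            intro b
            rw [Finset.sum_insert hk, Function.update_self]
            have : ∑ i ∈ s, ξ i (Function.update ω k b i) = ∑ i ∈ s, ξ i (ω i) :=
              Finset.sum_congr rfl fun i hi => by
                rw [Function.update_of_ne (ne_of_mem_of_not_mem hi hk)]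
            rw [this]; abel
          simp only [e]
          exact (lintegral_norm_const_add_sq_le (hξ k) (h0 k) _).trans (by gcongr; exact hV k)
      _ ≤ _ := by
          rw [lintegral_add_right _ measurable_const, lintegral_const, measure_univ, mul_one,
            Finset.sum_insert hk, add_comm (V k), ← add_assoc]
          gcongr

end SecondMoment


/-! ### Symmetry of uniform sampling without replacement. -/

section UniformOn

variable {Ω : Type*} [MeasurableSpace Ω] [DiscreteMeasurableSpace Ω]

theorem uniformOn_preimage_equiv {s : Set Ω} (e : Ω ≃ Ω) (hs : e ⁻¹' s = s) (t : Set Ω) :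
    uniformOn s (e ⁻¹' t) = uniformOn s t := by
  rw [uniformOn, cond_apply (MeasurableSet.of_discrete), cond_apply (MeasurableSet.of_discrete)]
  congr 1
  have h : s ∩ e ⁻¹' t = e ⁻¹' (s ∩ t) := by rw [Set.preimage_inter, hs]
  rw [h, Measure.count_apply (MeasurableSet.of_discrete),
    Measure.count_apply (MeasurableSet.of_discrete), Set.encard_preimage_of_bijective e.bijective]

/-- Composing injections with a transposition of values permutes them, so all values of one entry
are equally likely, and their probabilities sum to 1. -/
theorem map_injective_uniformOn_eval {s n : ℕ} (hsn : s ≤ n) (j : Fin s) :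
    (uniformOn {e : Fin s → Fin n | Function.Injective e}).map (fun e => e j)
      = uniformOn (Set.univ : Set (Fin n)) := by
  have hne : {e : Fin s → Fin n | Function.Injective e}.Nonempty :=
    ⟨Fin.castLE hsn, Fin.castLE_injective hsn⟩
  have hn : 0 < n := (Nat.pos_of_ne_zero fun h => by subst h; exact j.elim0).trans_le hsn
  have : NeZero n := ⟨hn.ne'⟩
  have := isProbabilityMeasure_uniformOn (Set.toFinite _) hne
  have hj : Measurable fun e : Fin s → Fin n => e j := measurable_pi_apply j
  set ν := (uniformOn {e : Fin s → Fin n | Function.Injective e}).map (fun e => e j) with hν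
  have : IsProbabilityMeasure ν := Measure.isProbabilityMeasure_map hj.aemeasurable
  have hswap : ∀ a a' : Fin n, ν {a} = ν {a'} := by
    intro a a'
    rw [hν, Measure.map_apply hj (measurableSet_singleton _),
      Measure.map_apply hj (measurableSet_singleton _)]
    rw [← uniformOn_preimage_equiv (Equiv.arrowCongr (Equiv.refl (Fin s)) (Equiv.swap a a'))]
    · congr 1
      ext e
      change Equiv.swap a a' (e j) = a ↔ e j = a'
      rw [Equiv.swap_apply_eq_iff, Equiv.swap_apply_left]
    · ext e
      exact (Equiv.swap a a').injective.of_comp_iff e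
  have hconst : ∀ a : Fin n, ν {a} = (n : ℝ≥0∞)⁻¹ := by
    intro a
    have h1 : ∑ a' : Fin n, ν {a'} = 1 := by
      rw [sum_measure_singleton, Finset.coe_univ, measure_univ]
    rw [Finset.sum_congr rfl fun a' _ => hswap a' a, Finset.sum_const, Finset.card_univ,
      Fintype.card_fin, nsmul_eq_mul] at h1
    exact ENNReal.eq_inv_of_mul_eq_one_left (by rwa [mul_comm])
  refine Measure.ext_of_singleton fun a => ?_
  rw [hconst, uniformOn_univ]
  simp

end UniformOn

/-! ### Batches as probability laws with the right marginals. -/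

namespace Dataset

variable {Ξ : Type*} [MeasurableSpace Ξ] (D : Dataset Ξ)

instance isProbabilityMeasure_law : IsProbabilityMeasure D.law := by
  cases D with
  | stream P => exact P.2
  | finite n hn data =>
    have : NeZero n := ⟨hn.ne'⟩
    have := isProbabilityMeasure_uniformOn (Set.toFinite (Set.univ : Set (Fin n)))
      Set.univ_nonempty
    exact Measure.isProbabilityMeasure_map (measurable_of_finite data).aemeasurable

theorem isProbabilityMeasure_batchLaw {s : ℕ} (hs : (s : ℕ∞) ≤ D.size) :
    IsProbabilityMeasure (D.batchLaw s) := by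
  cases D with
  | stream P => exact inferInstanceAs (IsProbabilityMeasure (Measure.pi fun _ => (P : Measure Ξ)))
  | finite n hn data =>
    have hsn : s ≤ n := by simpa [size] using hs
    have hne : {e : Fin s → Fin n | Function.Injective e}.Nonempty :=
      ⟨Fin.castLE hsn, Fin.castLE_injective hsn⟩
    have := isProbabilityMeasure_uniformOn (Set.toFinite _) hne
    exact Measure.isProbabilityMeasure_map
      (measurable_of_finite fun (e : Fin s → Fin n) j => data (e j)).aemeasurable

/-- Every entry of a batch is distributed as a single sample. -/
theorem map_eval_batchLaw {s : ℕ} (hs : (s : ℕ∞) ≤ D.size) (j : Fin s) :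
    (D.batchLaw s).map (fun B => B j) = D.law := by
  cases D with
  | stream P =>
    have := (measurePreserving_eval (fun _ : Fin s => (P : Measure Ξ)) j).map_eq
    exact this
  | finite n hn data =>
    have hsn : s ≤ n := by simpa [size] using hs
    have h1 : Measurable fun (e : Fin s → Fin n) j => data (e j) := measurable_of_finite _
    simp only [batchLaw, law]
    rw [Measure.map_map (measurable_pi_apply j) h1, ← map_injective_uniformOn_eval hsn j,
      Measure.map_map (measurable_of_finite data) (measurable_pi_apply j)]
    rfl

end Dataset

/-! ### Batch gradients: measurability, unbiasedness, exactness of the full batch. -/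

section Gradients

variable {d : ℕ} {Ξ : Type*} [MeasurableSpace Ξ] {f : Model d → Ξ → ℝ}

theorem measurable_uncurry_loss (hd : ∀ ξ, Differentiable ℝ fun x => f x ξ)
    (hm : ∀ x, Measurable (f x)) : Measurable fun q : Model d × Ξ => f q.1 q.2 :=
  measurable_uncurry_of_continuous_of_measurable (u := f) (fun ξ => (hd ξ).continuous) hm

/-- The gradient of a differentiable random function is jointly measurable. -/
theorem measurable_gradient_loss (hd : ∀ ξ, Differentiable ℝ fun x => f x ξ)
    (hm : ∀ x, Measurable (f x)) :
    Measurable fun q : Model d × Ξ => gradient (fun x => f x q.2) q.1 := by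
  have hf := measurable_uncurry_loss hd hm
  -- Each directional derivative is a pointwise limit of measurable difference quotients; the
  -- gradient is then reassembled in an orthonormal basis.
  have hdir : ∀ e : Model d, Measurable fun q : Model d × Ξ =>
      inner ℝ e (gradient (fun x => f x q.2) q.1) := by
    intro e
    have hu : Filter.Tendsto (fun n : ℕ => 1 / ((n : ℝ) + 1)) Filter.atTop (nhdsWithin 0 {0}ᶜ) :=
      tendsto_nhdsWithin_iff.2 ⟨tendsto_one_div_add_atTop_nhds_zero_nat,
        Filter.Eventually.of_forall fun n => by
          simp only [Set.mem_compl_iff, Set.mem_singleton_iff]; positivity⟩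
    refine measurable_of_tendsto_metrizable (f := fun (n : ℕ) (q : Model d × Ξ) =>
      (1 / ((n : ℝ) + 1))⁻¹ • (f (q.1 + (1 / ((n : ℝ) + 1)) • e) q.2 - f q.1 q.2)) ?_ ?_
    · intro n
      have h1 : Measurable fun q : Model d × Ξ => f (q.1 + (1 / ((n : ℝ) + 1)) • e) q.2 :=
        hf.comp ((measurable_fst.add_const _).prodMk measurable_snd)
      simp only [smul_eq_mul]
      exact (h1.sub hf).const_mul _
    · rw [tendsto_pi_nhds]
      rintro ⟨x, ξ⟩
      have h1 : HasDerivAt (fun t : ℝ => x + t • e) e 0 := by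
        simpa using ((hasDerivAt_id (0 : ℝ)).smul_const e).const_add x
      have h0 : HasFDerivAt (fun x => f x ξ)
          (InnerProductSpace.toDual ℝ _ (gradient (fun x => f x ξ) x)) (x + (0 : ℝ) • e) := by
        simpa only [zero_smul, add_zero] using (hd ξ x).hasGradientAt.hasFDerivAt
      have h2 := h0.comp_hasDerivAt (0 : ℝ) h1
      rw [InnerProductSpace.toDual_apply_apply, real_inner_comm] at h2
      have h3 := (hasDerivAt_iff_tendsto_slope_zero.1 h2).comp hu
      simpa [Function.comp_def] using h3
  let bs := EuclideanSpace.basisFun (Fin d) ℝ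
  have e : (fun q : Model d × Ξ => gradient (fun x => f x q.2) q.1)
      = fun q => ∑ i, inner ℝ (bs i) (gradient (fun x => f x q.2) q.1) • bs i := by
    ext1 q; rw [bs.sum_repr']
  rw [e]
  exact Finset.measurable_sum _ fun i _ => (hdir _).smul_const _

omit [MeasurableSpace Ξ] in
theorem hasGradientAt_batchLoss (hd : ∀ ξ, Differentiable ℝ fun x => f x ξ) {s : ℕ}
    (B : Fin s → Ξ) (x : Model d) :
    HasGradientAt (batchLoss f B) ((s : ℝ)⁻¹ • ∑ j, gradient (fun x => f x (B j)) x) x := by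
  rw [hasGradientAt_iff_hasFDerivAt, map_smul, map_sum]
  exact (HasFDerivAt.fun_sum fun j _ => (hd (B j) x).hasGradientAt.hasFDerivAt).const_mul _

omit [MeasurableSpace Ξ] in
theorem batchGrad_eq (hd : ∀ ξ, Differentiable ℝ fun x => f x ξ) {s : ℕ} (B : Fin s → Ξ)
    (x : Model d) :
    batchGrad f B x = (s : ℝ)⁻¹ • ∑ j, gradient (fun x => f x (B j)) x :=
  (hasGradientAt_batchLoss hd B x).gradient

theorem measurable_batchGrad (hd : ∀ ξ, Differentiable ℝ fun x => f x ξ)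
    (hm : ∀ x, Measurable (f x)) (s : ℕ) :
    Measurable fun q : (Fin s → Ξ) × Model d => batchGrad f q.1 q.2 := by
  simp only [batchGrad_eq hd]
  have h : ∀ j : Fin s, Measurable fun q : (Fin s → Ξ) × Model d =>
      gradient (fun x => f x (q.1 j)) q.2 := fun j =>
    (measurable_gradient_loss hd hm).comp
      (measurable_snd.prodMk ((measurable_pi_apply j).comp measurable_fst))
  exact (Finset.measurable_sum _ fun j _ => h j).const_smul ((s : ℝ)⁻¹)

/-- Nonnegativity of the variance. -/
theorem norm_integral_sq_le {E Ω : Type*} [NormedAddCommGroup E] [InnerProductSpace ℝ E]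
    [CompleteSpace E] [MeasurableSpace Ω] {P : Measure Ω} [IsProbabilityMeasure P] {Z : Ω → E}
    (hZ : MemLp Z 2 P) : ‖∫ ω, Z ω ∂P‖ ^ 2 ≤ ∫ ω, ‖Z ω‖ ^ 2 ∂P := by
  obtain ⟨-, h⟩ := integral_norm_const_add_sq hZ (-∫ ω, Z ω ∂P)
  have h0 : 0 ≤ ∫ ω, ‖-(∫ ω, Z ω ∂P) + Z ω‖ ^ 2 ∂P := integral_nonneg fun _ => by positivity
  rw [h, inner_neg_left, real_inner_self_eq_norm_sq, norm_neg] at h0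
  linarith

/-- Differentiation under the expectation at `0`, when the derivatives have continuous mean and
locally bounded first absolute moments. -/
theorem hasDerivAt_integral_of_continuous_integral {P : Measure Ξ} [SFinite P]
    {ψ ψ' : ℝ → Ξ → ℝ} (hψ : ∀ s ξ, HasDerivAt (fun s => ψ s ξ) (ψ' s ξ) s)
    (hint : ∀ s, Integrable (ψ s) P) (hm : Measurable fun q : ℝ × Ξ => ψ' q.1 q.2)
    (hint' : ∀ s, Integrable (ψ' s) P) {b : ℝ → ℝ} (hb : Continuous b)
    (hle : ∀ s, ∫ ξ, ‖ψ' s ξ‖ ∂P ≤ b s) (hc : Continuous fun s => ∫ ξ, ψ' s ξ ∂P) :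
    HasDerivAt (fun s => ∫ ξ, ψ s ξ ∂P) (∫ ξ, ψ' 0 ξ ∂P) 0 := by
  -- The fundamental theorem for almost every sample and Fubini give the expectation as an integral
  -- of the mean derivative; continuity of that mean permits differentiation at 0. No dominating
  -- function uniform in s is required.
  have hFTC : ∀ t : ℝ, ∫ ξ, ψ t ξ ∂P
      = (∫ s in (0 : ℝ)..t, ∫ ξ, ψ' s ξ ∂P) + ∫ ξ, ψ 0 ξ ∂P := by
    intro t
    have hprod : Integrable (fun q : ℝ × Ξ => ψ' q.1 q.2)
        ((volume.restrict (Set.uIoc 0 t)).prod P) := by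
      rw [integrable_prod_iff hm.aestronglyMeasurable]
      refine ⟨Filter.Eventually.of_forall fun s => hint' s, ?_⟩
      refine Integrable.mono' (g := b) ((hb.integrableOn_uIcc (a := 0) (b := t)).mono_set
        Set.uIoc_subset_uIcc) ?_ (Filter.Eventually.of_forall fun s => ?_)
      · exact (hm.norm.aestronglyMeasurable).integral_prod_right'
      · rw [Real.norm_of_nonneg (integral_nonneg fun _ => norm_nonneg _)]
        exact hle s
    have hae := ((integrable_prod_iff' hm.aestronglyMeasurable).1 hprod).1
    have hpt : ∀ᵐ ξ ∂P, ψ t ξ - ψ 0 ξ = ∫ s in (0 : ℝ)..t, ψ' s ξ := by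
      filter_upwards [hae] with ξ hξ
      rw [intervalIntegral.integral_eq_sub_of_hasDerivAt (f := fun s => ψ s ξ)
        (fun s _ => hψ s ξ) (intervalIntegrable_iff.2 hξ)]
    rw [← sub_eq_iff_eq_add, ← integral_sub (hint _) (hint _), integral_congr_ae hpt]
    simp only [intervalIntegral.intervalIntegral_eq_integral_uIoc, integral_smul]
    rw [integral_integral_swap (f := ψ') hprod]
  have := intervalIntegral.integral_hasDerivAt_right (hc.intervalIntegrable 0 0)
    (hc.stronglyMeasurableAtFilter _ _) hc.continuousAt
  simpa only [← hFTC] using this.add_const (∫ ξ, ψ 0 ξ ∂P)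

theorem integral_norm_sq_le_of_lintegral {Ω E : Type*} [MeasurableSpace Ω] [NormedAddCommGroup E]
    {P : Measure Ω} {Z : Ω → E} (hZ : AEStronglyMeasurable Z P) {c : ℝ} (hc : 0 ≤ c)
    (h : ∫⁻ ω, ENNReal.ofReal (‖Z ω‖ ^ 2) ∂P ≤ ENNReal.ofReal c) :
    MemLp Z 2 P ∧ ∫ ω, ‖Z ω‖ ^ 2 ∂P ≤ c := by
  have hm := memLp_two_of_lintegral_lt_top hZ (h.trans_lt ENNReal.ofReal_lt_top)
  refine ⟨hm, ?_⟩
  rwa [← ENNReal.ofReal_le_ofReal_iff hc,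
    ofReal_integral_eq_lintegral_ofReal ((memLp_two_iff_integrable_sq_norm hm.1).1 hm)
      (Filter.Eventually.of_forall fun _ => by positivity)]

/-- Differentiation under the expectation for a random function whose gradient has bounded variance
and is Lipschitz in mean square up to its mean. -/
theorem integral_gradient_eq {P : Measure Ξ} [IsProbabilityMeasure P]
    (hd : ∀ ξ, Differentiable ℝ fun x => f x ξ) (hm : ∀ x, Measurable (f x))
    (hi : ∀ x, Integrable (f x) P) {F : Model d → ℝ} (hF : ∀ x, F x = ∫ ξ, f x ξ ∂P)
    (hFd : Differentiable ℝ F) {L σ Lσ : ℝ}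
    (hL : ∀ v w, ‖gradient F v - gradient F w‖ ≤ L * ‖v - w‖) (hLσ : 0 ≤ Lσ)
    (hnoise : ∀ v, ∫⁻ ξ, ENNReal.ofReal
      (‖gradient (fun x => f x ξ) v - gradient F v‖ ^ 2) ∂P ≤ ENNReal.ofReal (σ ^ 2))
    (hsmooth : ∀ v w, ∫⁻ ξ, ENNReal.ofReal
      (‖(gradient (fun x => f x ξ) v - gradient (fun x => f x ξ) w)
        - (gradient F v - gradient F w)‖ ^ 2) ∂P ≤ ENNReal.ofReal (Lσ ^ 2 * ‖v - w‖ ^ 2))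
    (v : Model d) :
    Integrable (fun ξ => gradient (fun x => f x ξ) v) P ∧
      ∫ ξ, gradient (fun x => f x ξ) v ∂P = gradient F v := by
  have hgrm := measurable_gradient_loss hd hm
  have hgrd : ∀ v ξ, HasGradientAt (fun x => f x ξ) (gradient (fun x => f x ξ) v) v :=
    fun v ξ => (hd ξ v).hasGradientAt
  generalize hgr : (fun (v : Model d) ξ => gradient (fun x => f x ξ) v) = gr at *
  have hgr' : ∀ v ξ, gradient (fun x => f x ξ) v = gr v ξ := fun v ξ => by rw [← hgr]
  simp only [hgr'] at *
  have hgrv : ∀ v, Measurable (gr v) := fun v => hgrm.comp measurable_prodMk_left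
  have hsub := fun v => integral_norm_sq_le_of_lintegral
    ((hgrv v).sub_const (gradient F v)).aestronglyMeasurable (sq_nonneg σ) (hnoise v)
  have hint : ∀ v, Integrable (gr v) P := fun v => by
    have := ((hsub v).1.integrable one_le_two).add (integrable_const (gradient F v))
    refine this.congr (Filter.Eventually.of_forall fun ξ => ?_)
    simp
  refine ⟨hint v, ?_⟩
  -- The bias E∇f - ∇F is `Lσ`-Lipschitz by Jensen and average smoothness. With continuity of ∇F
  -- this makes E∇f continuous.
  have hGlip : ∀ v w, ‖(∫ ξ, gr v ξ ∂P - gradient F v) - (∫ ξ, gr w ξ ∂P - gradient F w)‖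
      ≤ Lσ * ‖v - w‖ := by
    intro v w
    obtain ⟨hZ, h2⟩ := integral_norm_sq_le_of_lintegral
      (((hgrv v).sub (hgrv w)).sub_const (gradient F v - gradient F w)).aestronglyMeasurable
      (by positivity) (hsmooth v w)
    have h1 := norm_integral_sq_le hZ
    have h4 : Integrable (fun ξ => gr v ξ - gr w ξ) P := (hint v).sub (hint w)
    have h3 : ∫ ξ, ((gr v ξ - gr w ξ) - (gradient F v - gradient F w)) ∂P
        = (∫ ξ, gr v ξ ∂P - gradient F v) - (∫ ξ, gr w ξ ∂P - gradient F w) := by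
      rw [integral_sub h4 (integrable_const _), integral_sub (hint v) (hint w)]
      simp only [integral_const, probReal_univ, one_smul]
      abel
    simp only [Pi.sub_apply] at h1 h2
    rw [h3] at h1
    exact abs_le_of_sq_le_sq' (by rw [mul_pow]; exact h1.trans h2) (by positivity) |>.2
  have hL0 : ∀ v w, ‖gradient F v - gradient F w‖ ≤ |L| * ‖v - w‖ := fun v w =>
    (hL v w).trans (by gcongr; exact le_abs_self L)
  have hFc : Continuous (gradient F) :=
    (LipschitzWith.of_dist_le_mul (K := ⟨|L|, abs_nonneg L⟩) fun v w => by
      rw [dist_eq_norm, dist_eq_norm]; exact hL0 v w).continuous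
  have hGc : Continuous fun v => ∫ ξ, gr v ξ ∂P := by
    have : Continuous fun v => ∫ ξ, gr v ξ ∂P - gradient F v :=
      (LipschitzWith.of_dist_le_mul (K := ⟨Lσ, hLσ⟩) fun v w => by
        rw [dist_eq_norm, dist_eq_norm]; exact hGlip v w).continuous
    have h := this.add hFc
    refine h.congr fun v => ?_
    simp
  refine ext_inner_left ℝ fun h => ?_
  have hline : Continuous fun s : ℝ => v + s • h := by fun_prop
  have hlineD : ∀ s : ℝ, HasDerivAt (fun t : ℝ => v + t • h) h s := fun s => by
    simpa using ((hasDerivAt_id s).smul_const h).const_add v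
  -- From t ≤ 1 + t² the noise bound controls the first absolute moment by a continuous function of
  -- w, as Fubini along the line needs.
  have habs : ∀ w, ∫ ξ, ‖inner ℝ h (gr w ξ)‖ ∂P
      ≤ ‖h‖ * (1 + σ ^ 2 + ‖gradient F w‖) := by
    intro w
    have hsq := (memLp_two_iff_integrable_sq_norm (hsub w).1.1).1 (hsub w).1
    have hc : Integrable (fun ξ => 1 + ‖gr w ξ - gradient F w‖ ^ 2) P :=
      (integrable_const _).add hsq
    calc ∫ ξ, ‖inner ℝ h (gr w ξ)‖ ∂P
        ≤ ∫ ξ, ‖h‖ * (1 + ‖gr w ξ - gradient F w‖ ^ 2 + ‖gradient F w‖) ∂P := by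
          refine integral_mono ((hint w).const_inner h).norm
            ((hc.add (integrable_const _)).const_mul _) fun ξ => (norm_inner_le_norm _ _).trans ?_
          refine mul_le_mul_of_nonneg_left ?_ (norm_nonneg _)
          have h1 : ‖gr w ξ‖ ≤ ‖gr w ξ - gradient F w‖ + ‖gradient F w‖ := by
            simpa using norm_add_le (gr w ξ - gradient F w) (gradient F w)
          nlinarith [sq_nonneg (‖gr w ξ - gradient F w‖ - 1)]
      _ ≤ _ := by
          rw [integral_const_mul, integral_add hc (integrable_const _),
            integral_add (integrable_const _) hsq]
          simp only [integral_const, probReal_univ, smul_eq_mul, one_mul]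
          gcongr
          exact (hsub w).2
  have hR := hasDerivAt_integral_of_continuous_integral (P := P)
    (ψ := fun s ξ => f (v + s • h) ξ) (ψ' := fun s ξ => inner ℝ h (gr (v + s • h) ξ))
    (fun s ξ => by
      have h2 := (hgrd (v + s • h) ξ).hasFDerivAt.comp_hasDerivAt s (hlineD s)
      rw [InnerProductSpace.toDual_apply_apply, real_inner_comm] at h2
      exact h2)
    (fun s => hi _)
    ((hgrm.comp ((hline.measurable.comp measurable_fst).prodMk measurable_snd)).const_inner)
    (fun s => (hint _).const_inner h)
    (b := fun s => ‖h‖ * (1 + σ ^ 2 + ‖gradient F (v + s • h)‖))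
    (by fun_prop) (fun s => habs _)
    (by
      simp only [integral_inner (hint _)]
      exact continuous_const.inner (hGc.comp hline))
  simp only [← hF, zero_smul, add_zero, integral_inner (hint _)] at hR
  have h0 : HasFDerivAt F (InnerProductSpace.toDual ℝ _ (gradient F v)) (v + (0 : ℝ) • h) := by
    simpa only [zero_smul, add_zero] using (hFd v).hasGradientAt.hasFDerivAt
  have h2 := h0.comp_hasDerivAt (0 : ℝ) (hlineD 0)
  rw [InnerProductSpace.toDual_apply_apply, real_inner_comm] at h2
  exact hR.unique h2

/-- A random vector field `G` that is jointly measurable and has mean `g` at every point. -/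
structure IsUnbiased {Ω : Type*} [MeasurableSpace Ω] (Q : Measure Ω)
    (G : Ω → Model d → Model d) (g : Model d → Model d) : Prop where
  measurable : Measurable fun q : Ω × Model d => G q.1 q.2
  integrable : ∀ v, Integrable (fun ω => G ω v) Q
  integral_eq : ∀ v, ∫ ω, G ω v ∂Q = g v

/-- Batch gradients are unbiased estimates of the gradient of the expected loss. -/
theorem isUnbiased_batchGrad (D : Dataset Ξ) (hd : ∀ ξ, Differentiable ℝ fun x => f x ξ)
    (hm : ∀ x, Measurable (f x)) (hi : ∀ x, Integrable (f x) D.law)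
    (hFd : Differentiable ℝ (localLoss f D)) {L σ Lσ : ℝ}
    (hL : ∀ v w, ‖gradient (localLoss f D) v - gradient (localLoss f D) w‖ ≤ L * ‖v - w‖)
    (hLσ : 0 ≤ Lσ)
    (hnoise : ∀ v, ∫⁻ B, ‖batchGrad f B v - gradient (localLoss f D) v‖ₑ ^ 2 ∂D.batchLaw 1
      ≤ ENNReal.ofReal (σ ^ 2))
    (hsmooth : ∀ v w, ∫⁻ B, ‖(batchGrad f B v - batchGrad f B w)
        - (gradient (localLoss f D) v - gradient (localLoss f D) w)‖ₑ ^ 2 ∂D.batchLaw 1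
      ≤ ENNReal.ofReal (Lσ ^ 2 * ‖v - w‖ ^ 2))
    {s : ℕ} (hs : 1 ≤ s) (hsn : (s : ℕ∞) ≤ D.size) :
    IsUnbiased (D.batchLaw s) (fun B => batchGrad f B) (gradient (localLoss f D)) := by
  have h1n : ((1 : ℕ) : ℕ∞) ≤ D.size := le_trans (by exact_mod_cast hs) hsn
  have hgrm := measurable_gradient_loss hd hm
  have hgrv : ∀ v, Measurable fun ξ => gradient (fun x => f x ξ) v :=
    fun v => hgrm.comp measurable_prodMk_left
  have hone : ∀ (B : Fin 1 → Ξ) (v : Model d),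
      batchGrad f B v = gradient (fun x => f x (B 0)) v := fun B v => by
    simp [batchGrad_eq hd]
  -- Only single-sample bounds enter. Larger batches then follow from their marginals by linearity,
  -- so the dependence created by sampling without replacement is harmless.
  have key := fun v => integral_gradient_eq (P := D.law) hd hm hi (F := localLoss f D)
    (fun _ => rfl) hFd hL hLσ (σ := σ)
    (fun v => by
      rw [← D.map_eval_batchLaw h1n 0, lintegral_map
        ((((hgrv v).sub_const _).norm.pow_const 2).ennreal_ofReal) (measurable_pi_apply 0)]
      simpa only [hone, enorm_sq_eq_ofReal] using hnoise v)
    (fun v w => by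
      have hmeas : Measurable fun ξ => ENNReal.ofReal (‖(gradient (fun x => f x ξ) v
          - gradient (fun x => f x ξ) w)
          - (gradient (localLoss f D) v - gradient (localLoss f D) w)‖ ^ 2) :=
        (((((hgrv v).sub (hgrv w)).sub_const _).norm.pow_const 2).ennreal_ofReal)
      rw [← D.map_eval_batchLaw h1n 0, lintegral_map hmeas (measurable_pi_apply 0)]
      simpa only [hone, enorm_sq_eq_ofReal] using hsmooth v w) v
  have hint : ∀ v (j : Fin s),
      Integrable (fun B : Fin s → Ξ => gradient (fun x => f x (B j)) v) (D.batchLaw s) := by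
    intro v j
    have h := (key v).1
    rw [← D.map_eval_batchLaw hsn j] at h
    exact h.comp_measurable (measurable_pi_apply j)
  refine ⟨measurable_batchGrad hd hm s, fun v => ?_, fun v => ?_⟩
  · simp only [batchGrad_eq hd]
    exact (integrable_finsetSum _ fun j _ => hint v j).smul ((s : ℝ)⁻¹)
  · simp only [batchGrad_eq hd]
    rw [integral_smul, integral_finsetSum _ fun j _ => hint v j]
    have hj : ∀ j : Fin s, ∫ B, gradient (fun x => f x (B j)) v ∂D.batchLaw s
        = gradient (localLoss f D) v := by
      intro j
      rw [← (key v).2]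
      conv_rhs => rw [← D.map_eval_batchLaw hsn j]
      rw [integral_map (measurable_pi_apply j).aemeasurable (hgrv v).aestronglyMeasurable]
    simp only [hj, Finset.sum_const, Finset.card_univ, Fintype.card_fin]
    rw [← Nat.cast_smul_eq_nsmul ℝ, smul_smul, inv_mul_cancel₀ (by positivity), one_smul]

/-- The batch that exhausts a finite training set gives the exact gradient. -/
theorem lintegral_noise_batchLaw_size (D : Dataset Ξ)
    (hd : ∀ ξ, Differentiable ℝ fun x => f x ξ) (hm : ∀ x, Measurable (f x))
    {s : ℕ} (hs : (s : ℕ∞) = D.size) (v : Model d) :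
    ∫⁻ B, ENNReal.ofReal (‖batchGrad f B v - gradient (localLoss f D) v‖ ^ 2) ∂D.batchLaw s
      = 0 := by
  cases D with
  | stream P => simp [Dataset.size] at hs
  | finite n hn data =>
    obtain rfl : s = n := by simpa [Dataset.size] using hs
    have : NeZero s := ⟨hn.ne'⟩
    have := isProbabilityMeasure_uniformOn (Set.toFinite (Set.univ : Set (Fin s)))
      Set.univ_nonempty
    have hloss : localLoss f (.finite s hn data) = fun x => (s : ℝ)⁻¹ * ∑ i, f x (data i) := by
      ext x
      rw [localLoss, Dataset.law, integral_map (measurable_of_finite data).aemeasurable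
        (hm x).aestronglyMeasurable, integral_fintype (Integrable.of_finite)]
      simp only [Measure.real, uniformOn_univ, Measure.count_singleton, Fintype.card_fin,
        smul_eq_mul, Finset.mul_sum]
      simp
    have hmeas : Measurable fun B : Fin s → Ξ => ENNReal.ofReal
        (‖batchGrad f B v - gradient (localLoss f (.finite s hn data)) v‖ ^ 2) :=
      ((((measurable_batchGrad hd hm s).comp measurable_prodMk_right).sub_const _).norm.pow_const
        2).ennreal_ofReal
    rw [Dataset.batchLaw, lintegral_map hmeas (measurable_of_finite _)]
    rw [lintegral_congr_ae (g := fun _ => 0), lintegral_zero]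
    have hae : ∀ᵐ e ∂uniformOn {e : Fin s → Fin s | Function.Injective e},
        Function.Injective e := ae_cond_mem (MeasurableSet.of_discrete)
    filter_upwards [hae] with e he
    -- An injection of a finite set into itself is a permutation, so the batch loss is the full
    -- average.
    have : batchLoss f (fun j => data (e j)) = localLoss f (.finite s hn data) := by
      rw [hloss]
      ext x
      rw [batchLoss]
      congr 1
      exact (Equiv.ofBijective e (Finite.injective_iff_bijective.1 he)).sum_comp
        fun i => f x (data i)
    simp [batchGrad, this]

end Gradients


/-! ### Bounding expectations by weighted combinations. -/

section Combination

variable {Ω : Type*} [MeasurableSpace Ω] {μ : Measure Ω}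

/-- It carries pointwise inequalities to expectations without integrability side conditions. A
single-term bound is the case `w₂ = 0`. -/
theorem lintegral_ofReal_le_combination {φ ψ₁ ψ₂ : Ω → ℝ} {w₁ w₂ c₁ c₂ : ℝ} (hw₁ : 0 ≤ w₁)
    (hw₂ : 0 ≤ w₂) (h : ∀ ω, φ ω ≤ w₁ * ψ₁ ω + w₂ * ψ₂ ω) (hψ₁ : Measurable ψ₁)
    (hc₁ : 0 ≤ c₁) (hc₂ : 0 ≤ c₂)
    (h₁ : ∫⁻ ω, ENNReal.ofReal (ψ₁ ω) ∂μ ≤ ENNReal.ofReal c₁)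
    (h₂ : ∫⁻ ω, ENNReal.ofReal (ψ₂ ω) ∂μ ≤ ENNReal.ofReal c₂) :
    ∫⁻ ω, ENNReal.ofReal (φ ω) ∂μ ≤ ENNReal.ofReal (w₁ * c₁ + w₂ * c₂) := by
  calc ∫⁻ ω, ENNReal.ofReal (φ ω) ∂μ
      ≤ ∫⁻ ω, (ENNReal.ofReal w₁ * ENNReal.ofReal (ψ₁ ω)
          + ENNReal.ofReal w₂ * ENNReal.ofReal (ψ₂ ω)) ∂μ := by
        refine lintegral_mono fun ω => (ENNReal.ofReal_le_ofReal (h ω)).trans ?_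
        refine ENNReal.ofReal_add_le.trans ?_
        rw [ENNReal.ofReal_mul hw₁, ENNReal.ofReal_mul hw₂]
    _ ≤ _ := by
        rw [lintegral_add_left (hψ₁.ennreal_ofReal.const_mul _),
          lintegral_const_mul' _ _ ENNReal.ofReal_ne_top,
          lintegral_const_mul' _ _ ENNReal.ofReal_ne_top,
          ENNReal.ofReal_add (by positivity) (by positivity), ENNReal.ofReal_mul hw₁,
          ENNReal.ofReal_mul hw₂]
        gcongr

/-- Young's inequality. The free weight is tuned to each use: 1 and 1/k in the local updates, 1/4
for noise against drift, ρ/2 for staleness. -/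
theorem norm_add_sq_le_weighted {E : Type*} [NormedAddCommGroup E] {s : ℝ} (hs : 0 < s) (a b : E) :
    ‖a + b‖ ^ 2 ≤ (1 + s) * ‖a‖ ^ 2 + (1 + s⁻¹) * ‖b‖ ^ 2 := by
  have h1 : ‖a + b‖ ^ 2 ≤ (‖a‖ + ‖b‖) ^ 2 := by gcongr; exact norm_add_le a b
  have h2 : 2 * (‖a‖ * ‖b‖) ≤ s * ‖a‖ ^ 2 + s⁻¹ * ‖b‖ ^ 2 := by
    have e : s * ‖a‖ ^ 2 + s⁻¹ * ‖b‖ ^ 2 - 2 * (‖a‖ * ‖b‖) = s⁻¹ * (s * ‖a‖ - ‖b‖) ^ 2 := by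
      field_simp; ring
    have : 0 ≤ s⁻¹ * (s * ‖a‖ - ‖b‖) ^ 2 := by positivity
    linarith
  nlinarith

end Combination

/-! ### The local updates of a miner. -/

section Local

variable {d b' K : ℕ} {Ξ : Type*} {f : Model d → Ξ → ℝ} {ηl : ℝ}

theorem localState_succ (B : Fin K → Fin b' → Ξ) (x g : Model d) {k : ℕ} (hk : k < K) :
    localState f ηl B x g (k + 1) = localStep f ηl (B ⟨k, hk⟩) (localState f ηl B x g k) := by
  simp [localState, hk]

/-- The local state after `k` updates depends on the first `k` minibatches only. -/
theorem localState_update (B : Fin K → Fin b' → Ξ) (x g : Model d) (j : Fin K) (c : Fin b' → Ξ)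
    {k : ℕ} (hk : k ≤ j) :
    localState f ηl (Function.update B j c) x g k = localState f ηl B x g k := by
  induction k with
  | zero => rfl
  | succ k ih =>
    have hkK : k < K := (Nat.lt_of_succ_le hk).trans j.2
    rw [localState_succ _ _ _ hkK, localState_succ _ _ _ hkK, ih (Nat.le_of_succ_le hk),
      Function.update_of_ne]
    intro h
    have := congrArg Fin.val h
    simp only at this
    omega

/-- The last move is `ηl` times the current estimate. Only at k = 0, where the triple starts at (x,
x, g), is it zero, hence an inequality. -/
theorem norm_local_move_sq_le (hη : 0 ≤ ηl) (B : Fin K → Fin b' → Ξ) (x g : Model d) {k : ℕ}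
    (hk : k ≤ K) :
    ‖(localState f ηl B x g k).2.1 - (localState f ηl B x g k).1‖ ^ 2
      ≤ ηl ^ 2 * ‖(localState f ηl B x g k).2.2‖ ^ 2 := by
  cases k with
  | zero =>
    simp only [localState, sub_self, norm_zero]
    have : 0 ≤ ηl ^ 2 * ‖g‖ ^ 2 := by positivity
    simpa using this
  | succ k =>
    rw [localState_succ _ _ _ (Nat.lt_of_succ_le hk)]
    simp only [localStep]
    rw [sub_sub_cancel_left, norm_neg, norm_smul, Real.norm_of_nonneg hη, mul_pow]

variable [MeasurableSpace Ξ]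

theorem measurable_localState
    (hG : Measurable fun q : (Fin b' → Ξ) × Model d => batchGrad f q.1 q.2) (k : ℕ) :
    Measurable fun q : (Fin K → Fin b' → Ξ) × Model d × Model d =>
      localState f ηl q.1 q.2.1 q.2.2 k := by
  induction k with
  | zero =>
    simp only [localState]
    fun_prop
  | succ k ih =>
    by_cases hk : k < K
    · simp only [localState_succ _ _ _ hk, localStep]
      have hB : Measurable fun q : (Fin K → Fin b' → Ξ) × Model d × Model d => q.1 ⟨k, hk⟩ :=
        (measurable_pi_apply _).comp measurable_fst
      have h1 := hG.comp (hB.prodMk ih.fst)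
      have h2 := hG.comp (hB.prodMk ih.snd.fst)
      have h3 := (ih.snd.snd.sub h1).add h2
      exact ih.snd.fst.prodMk ((ih.snd.fst.sub (h3.const_smul ηl)).prodMk h3)
    · simpa [localState, hk] using ih

theorem measurable_localChange
    (hG : Measurable fun q : (Fin b' → Ξ) × Model d => batchGrad f q.1 q.2) :
    Measurable fun q : (Fin K → Fin b' → Ξ) × Model d × Model d =>
      localChange f ηl q.1 q.2.1 q.2.2 :=
  measurable_snd.fst.sub (measurable_localState hG K).snd.fst

variable {Q : Measure (Fin b' → Ξ)} [IsProbabilityMeasure Q] {G : Model d → Model d}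
  {L Lσ : ℝ}

/-- One local update adds at most `Lσ²` times the squared last move to the fluctuation of the local
gradient estimate around its drift. -/
theorem lintegral_local_noise_succ_le (hQ : IsUnbiased Q (fun B => batchGrad f B) G)
    (hGc : Continuous G)
    (hsmooth : ∀ v w, ∫⁻ B, ENNReal.ofReal
      (‖(batchGrad f B v - batchGrad f B w) - (G v - G w)‖ ^ 2) ∂Q
        ≤ ENNReal.ofReal (Lσ ^ 2 * ‖v - w‖ ^ 2)) (x g u : Model d) {k : ℕ} (hk : k < K) :
    ∫⁻ B, ENNReal.ofReal (‖u + ((localState f ηl B x g (k + 1)).2.2 - g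
        - (G (localState f ηl B x g (k + 1)).1 - G x))‖ ^ 2) ∂Measure.pi (fun _ : Fin K => Q)
      ≤ ∫⁻ B, ENNReal.ofReal (‖u + ((localState f ηl B x g k).2.2 - g
        - (G (localState f ηl B x g k).1 - G x))‖ ^ 2) ∂Measure.pi (fun _ : Fin K => Q)
      + ∫⁻ B, ENNReal.ofReal (Lσ ^ 2 * ‖(localState f ηl B x g k).2.1
        - (localState f ηl B x g k).1‖ ^ 2) ∂Measure.pi (fun _ : Fin K => Q) := by
  have hS : ∀ k, Measurable fun B : Fin K → Fin b' → Ξ => localState f ηl B x g k := fun k =>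
    (measurable_localState hQ.measurable k).comp (measurable_prodMk_right (y := (x, g)))
  have hm : ∀ k, Measurable fun B : Fin K → Fin b' → Ξ => ENNReal.ofReal
      (‖u + ((localState f ηl B x g k).2.2 - g - (G (localState f ηl B x g k).1 - G x))‖ ^ 2) :=
    fun k => ((measurable_const.add (((hS k).snd.snd.sub_const g).sub
      ((hGc.measurable.comp (hS k).fst).sub_const _))).norm.pow_const 2).ennreal_ofReal
  -- State k ignores minibatch k, so integrating that minibatch first leaves a constant plus a
  -- centred increment, whose second moment average smoothness bounds.
  rw [lintegral_pi_resample (fun _ : Fin K => Q) ⟨k, hk⟩ (hm (k + 1)), ← lintegral_add_left (hm k)]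
  refine lintegral_mono fun B => ?_
  have hmG : ∀ v, Integrable (fun B => batchGrad f B v) Q := hQ.integrable
  simp only [localState_succ _ _ _ hk, Function.update_self,
    localState_update B x g ⟨k, hk⟩ _ le_rfl, localStep]
  set z := localState f ηl B x g k
  have e : ∀ c : Fin b' → Ξ, u + (z.2.2 - batchGrad f c z.1 + batchGrad f c z.2.1 - g
      - (G z.2.1 - G x)) = (u + (z.2.2 - g - (G z.1 - G x)))
        + ((batchGrad f c z.2.1 - batchGrad f c z.1) - (G z.2.1 - G z.1)) := fun c => by abel
  simp only [e]
  have hi : Integrable (fun c => batchGrad f c z.2.1 - batchGrad f c z.1) Q :=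
    (hmG _).sub (hmG _)
  refine (lintegral_norm_const_add_sq_le (hi.sub (integrable_const (G z.2.1 - G z.1))) ?_ _).trans
    (by gcongr; exact hsmooth _ _)
  simp only [Pi.sub_apply]
  rw [integral_sub hi (integrable_const _), integral_sub (hmG _) (hmG _), hQ.integral_eq,
    hQ.integral_eq]
  simp

/-- Second moments along the local updates of a miner. -/
theorem local_moments (hQ : IsUnbiased Q (fun B => batchGrad f B) G) (hL : 0 < L)
    (hGL : ∀ v w, ‖G v - G w‖ ≤ L * ‖v - w‖) (hGc : Continuous G)
    (hsmooth : ∀ v w, ∫⁻ B, ENNReal.ofReal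
      (‖(batchGrad f B v - batchGrad f B w) - (G v - G w)‖ ^ 2) ∂Q
        ≤ ENNReal.ofReal (Lσ ^ 2 * ‖v - w‖ ^ 2))
    (hη : 0 < ηl) (hK : 24 * (K * L * ηl) ^ 2 = 1) (hKσ : 2 * Lσ ^ 2 ≤ K * L ^ 2)
    (x g : Model d) {k : ℕ} (hk : k ≤ K) :
    ∫⁻ B, ENNReal.ofReal (‖(localState f ηl B x g k).2.2‖ ^ 2) ∂Measure.pi (fun _ : Fin K => Q)
        ≤ ENNReal.ofReal (8 / 3 * ‖g‖ ^ 2) ∧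
    ∫⁻ B, ENNReal.ofReal (‖(localState f ηl B x g k).2.1 - x‖ ^ 2)
        ∂Measure.pi (fun _ : Fin K => Q)
        ≤ ENNReal.ofReal (k ^ 2 * (ηl ^ 2 * (8 / 3 * ‖g‖ ^ 2))) ∧
    ∀ u, ∫⁻ B, ENNReal.ofReal (‖u + ((localState f ηl B x g k).2.2 - g
        - (G (localState f ηl B x g k).1 - G x))‖ ^ 2) ∂Measure.pi (fun _ : Fin K => Q)
        ≤ ENNReal.ofReal (‖u‖ ^ 2 + k * (Lσ ^ 2 * (ηl ^ 2 * (8 / 3 * ‖g‖ ^ 2)))) := by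
  have hS : ∀ k, Measurable fun B : Fin K → Fin b' → Ξ => localState f ηl B x g k := fun k =>
    (measurable_localState hQ.measurable k).comp (measurable_prodMk_right (y := (x, g)))
  induction k with
  | zero =>
    simp only [localState, sub_self, norm_zero, lintegral_const, measure_univ, mul_one, add_zero]
    refine ⟨ENNReal.ofReal_le_ofReal (by nlinarith [sq_nonneg ‖g‖]), by simp, fun u => ?_⟩
    exact ENNReal.ofReal_le_ofReal (by simp)
  | succ k ih =>
    have hkK : k < K := hk
    obtain ⟨ihg, ihx, ihm⟩ := ih hkK.le
    have hkK' : (k : ℝ) + 1 ≤ K := by exact_mod_cast hkK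
    have hk0 : (0 : ℝ) ≤ k := k.cast_nonneg
    have hm : ∀ u, ∫⁻ B, ENNReal.ofReal (‖u + ((localState f ηl B x g (k + 1)).2.2 - g
        - (G (localState f ηl B x g (k + 1)).1 - G x))‖ ^ 2) ∂Measure.pi (fun _ : Fin K => Q)
        ≤ ENNReal.ofReal (‖u‖ ^ 2 + (k + 1 : ℕ) * (Lσ ^ 2 * (ηl ^ 2 * (8 / 3 * ‖g‖ ^ 2)))) := by
      intro u
      refine (lintegral_local_noise_succ_le hQ hGc hsmooth x g u hkK).trans ?_
      have h2 : ∫⁻ B, ENNReal.ofReal (Lσ ^ 2 * ‖(localState f ηl B x g k).2.1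
          - (localState f ηl B x g k).1‖ ^ 2) ∂Measure.pi (fun _ : Fin K => Q)
          ≤ ENNReal.ofReal (Lσ ^ 2 * (ηl ^ 2 * (8 / 3 * ‖g‖ ^ 2))) := by
        have h := lintegral_ofReal_le_combination (w₁ := Lσ ^ 2 * ηl ^ 2) (w₂ := 0) (c₂ := 0)
          (φ := fun B => Lσ ^ 2 * ‖(localState f ηl B x g k).2.1
            - (localState f ηl B x g k).1‖ ^ 2) (ψ₂ := fun _ => 0)
          (by positivity) le_rfl (fun B => ?_) ((hS k).snd.snd.norm.pow_const 2) (by positivity)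
          le_rfl ihg (by simp)
        · refine h.trans_eq ?_
          congr 1; ring
        · have := norm_local_move_sq_le (f := f) hη.le B x g hkK.le
          nlinarith [sq_nonneg Lσ]
      refine (add_le_add (ihm u) h2).trans ?_
      rw [← ENNReal.ofReal_add (by positivity) (by positivity)]
      refine ENNReal.ofReal_le_ofReal (le_of_eq ?_)
      push_cast; ring
    have hg : ∫⁻ B, ENNReal.ofReal (‖(localState f ηl B x g (k + 1)).2.2‖ ^ 2)
        ∂Measure.pi (fun _ : Fin K => Q) ≤ ENNReal.ofReal (8 / 3 * ‖g‖ ^ 2) := by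
      have hm0 := hm 0
      simp only [zero_add] at hm0
      have hmeasm : Measurable fun B : Fin K → Fin b' → Ξ =>
          ‖(localState f ηl B x g (k + 1)).2.2 - g - (G (localState f ηl B x g (k + 1)).1 - G x)‖
            ^ 2 := (((hS (k + 1)).snd.snd.sub_const g).sub
              ((hGc.measurable.comp (hS (k + 1)).fst).sub_const _)).norm.pow_const 2
      have h1 := lintegral_ofReal_le_combination (w₁ := 1) (w₂ := L ^ 2)
          (φ := fun B => ‖(localState f ηl B x g (k + 1)).2.2 - g
            - (G (localState f ηl B x g (k + 1)).1 - G x)‖ ^ 2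
              + L ^ 2 * ‖(localState f ηl B x g k).2.1 - x‖ ^ 2)
          zero_le_one (by positivity) (fun B => (by rw [one_mul])) hmeasm (by positivity)
          (by positivity) hm0 ihx
      have h2 := lintegral_ofReal_le_combination (μ := Measure.pi (fun _ : Fin K => Q))
          (w₁ := 2) (w₂ := 4) (ψ₁ := fun _ => ‖g‖ ^ 2) (c₁ := ‖g‖ ^ 2)
          (φ := fun B => ‖(localState f ηl B x g (k + 1)).2.2‖ ^ 2)
          zero_le_two zero_le_four (fun B => ?_) measurable_const (by positivity)
          (by positivity) (by simp) h1
      -- The constant 8/3 reproduces itself: 2 + 4 · (1/48 + 1/24) · 8/3 = 8/3. The 1/48 comes from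
      -- the lower bound on K, the 1/24 from the choice of `ηl`.
      · refine h2.trans (ENNReal.ofReal_le_ofReal ?_)
        have e1 : ((k + 1 : ℕ) : ℝ) * (Lσ ^ 2 * ηl ^ 2) ≤ 1 / 48 := by
          push_cast
          calc ((k : ℝ) + 1) * (Lσ ^ 2 * ηl ^ 2) ≤ K * ((K * L ^ 2 / 2) * ηl ^ 2) := by
                gcongr; linarith
            _ = 1 / 48 := by linarith
        have e2 : L ^ 2 * ((k : ℝ) ^ 2 * ηl ^ 2) ≤ 1 / 24 := by
          calc L ^ 2 * ((k : ℝ) ^ 2 * ηl ^ 2) ≤ L ^ 2 * ((K : ℝ) ^ 2 * ηl ^ 2) := by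
                gcongr
            _ = 1 / 24 := by linarith
        have h0 := sq_nonneg ‖g‖
        have e3 := mul_le_mul_of_nonneg_right e1 h0
        have e4 := mul_le_mul_of_nonneg_right e2 h0
        norm_num
        push_cast at e3
        nlinarith
      -- The first component lags by one, so the estimate after k + 1 updates involves only the
      -- displacement after k. This keeps the joint induction free of circularity.
      · have hfst : (localState f ηl B x g (k + 1)).1 = (localState f ηl B x g k).2.1 := by
          rw [localState_succ _ _ _ hkK]; rfl
        rw [hfst]
        set a := (localState f ηl B x g (k + 1)).2.2
        set y := (localState f ηl B x g k).2.1
        have e : a = g + ((a - g - (G y - G x)) + (G y - G x)) := by abel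
        have t1 := norm_add_sq_le_weighted one_pos g ((a - g - (G y - G x)) + (G y - G x))
        have t2 := norm_add_sq_le_weighted one_pos (a - g - (G y - G x)) (G y - G x)
        rw [← e] at t1
        have t3 : ‖G y - G x‖ ^ 2 ≤ L ^ 2 * ‖y - x‖ ^ 2 := by
          rw [← mul_pow]; gcongr; exact hGL y x
        norm_num at t1 t2
        linarith
    refine ⟨hg, ?_, hm⟩
    have hmx : Measurable fun B : Fin K → Fin b' → Ξ => ‖(localState f ηl B x g k).2.1 - x‖ ^ 2 :=
      ((hS k).snd.fst.sub_const x).norm.pow_const 2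
    have hstep : ∀ B : Fin K → Fin b' → Ξ, (localState f ηl B x g (k + 1)).2.1 - x
        = ((localState f ηl B x g k).2.1 - x) + -(ηl • (localState f ηl B x g (k + 1)).2.2) := by
      intro B
      rw [localState_succ _ _ _ hkK]
      simp only [localStep]
      abel
    have hnorm : ∀ B : Fin K → Fin b' → Ξ, ‖-(ηl • (localState f ηl B x g (k + 1)).2.2)‖ ^ 2
        = ηl ^ 2 * ‖(localState f ηl B x g (k + 1)).2.2‖ ^ 2 := fun B => by
      rw [norm_neg, norm_smul, Real.norm_of_nonneg hη.le, mul_pow]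
    rcases Nat.eq_zero_or_pos k with rfl | hkpos
    -- The first update is separate, since the weight 1/k used below is meaningless at k = 0.
    · have h := lintegral_ofReal_le_combination (w₁ := ηl ^ 2) (w₂ := 0) (c₂ := 0)
          (φ := fun B => ‖(localState f ηl B x g (0 + 1)).2.1 - x‖ ^ 2) (ψ₂ := fun _ => 0)
          (by positivity) le_rfl (fun B => ?_) ((hS (0 + 1)).snd.snd.norm.pow_const 2)
          (by positivity) le_rfl hg (by simp)
      · refine h.trans_eq ?_
        congr 1; push_cast; ring
      · rw [hstep, ← hnorm]
        simp [localState]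
    · have hkp : (0 : ℝ) < k := by exact_mod_cast hkpos
      -- The weight 1/k makes the quadratic growth exact: (1 + 1/k)k² + (1 + k) = (k + 1)².
      have h := lintegral_ofReal_le_combination (w₁ := 1 + (k : ℝ)⁻¹) (w₂ := (1 + k) * ηl ^ 2)
          (φ := fun B => ‖(localState f ηl B x g (k + 1)).2.1 - x‖ ^ 2)
          (by positivity) (by positivity) (fun B => ?_) hmx (by positivity) (by positivity) ihx hg
      · refine h.trans_eq ?_
        congr 1; push_cast; field_simp; ring
      · rw [hstep, mul_assoc, ← hnorm]
        have := norm_add_sq_le_weighted (inv_pos.2 hkp) ((localState f ηl B x g k).2.1 - x)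
          (-(ηl • (localState f ηl B x g (k + 1)).2.2))
        rwa [inv_inv] at this

/-- Mean and second moment of the model change of a miner. -/
theorem localChange_moments (hQ : IsUnbiased Q (fun B => batchGrad f B) G) (hL : 0 < L)
    (hGL : ∀ v w, ‖G v - G w‖ ≤ L * ‖v - w‖) (hGc : Continuous G)
    (hsmooth : ∀ v w, ∫⁻ B, ENNReal.ofReal
      (‖(batchGrad f B v - batchGrad f B w) - (G v - G w)‖ ^ 2) ∂Q
        ≤ ENNReal.ofReal (Lσ ^ 2 * ‖v - w‖ ^ 2))
    (hη : 0 < ηl) (hK : 24 * (K * L * ηl) ^ 2 = 1) (hKσ : 2 * Lσ ^ 2 ≤ K * L ^ 2)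
    (x g : Model d) :
    MemLp (fun B => localChange f ηl B x g) 2 (Measure.pi (fun _ : Fin K => Q)) ∧
    ∫ B, ‖localChange f ηl B x g‖ ^ 2 ∂Measure.pi (fun _ : Fin K => Q)
      ≤ (K * ηl) ^ 2 * (8 / 3 * ‖g‖ ^ 2) ∧
    ‖∫ B, localChange f ηl B x g ∂Measure.pi (fun _ : Fin K => Q) - (K * ηl) • g‖
      ≤ K * ηl * (‖g‖ / 3) := by
  have hS : ∀ k, Measurable fun B : Fin K → Fin b' → Ξ => localState f ηl B x g k := fun k =>
    (measurable_localState hQ.measurable k).comp (measurable_prodMk_right (y := (x, g)))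
  have hmom := fun k (hk : k ≤ K) =>
    local_moments hQ hL hGL hGc hsmooth hη hK hKσ x g (k := k) hk
  set P := Measure.pi (fun _ : Fin K => Q)
  have hx := fun k (hk : k ≤ K) => integral_norm_sq_le_of_lintegral
    (((hS k).snd.fst.sub_const x).aestronglyMeasurable) (by positivity) (hmom k hk).2.1
  have hg := fun k (hk : k ≤ K) => integral_norm_sq_le_of_lintegral
    ((hS k).snd.snd.aestronglyMeasurable) (by positivity) (hmom k hk).1
  have hmean : ∀ k, k < K → ‖∫ B, (localState f ηl B x g (k + 1)).2.2 ∂P - g‖ ≤ ‖g‖ / 3 := by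
    intro k hk
    have hgi := (hg (k + 1) hk).1.integrable one_le_two
    have hmm : Measurable fun B : Fin K → Fin b' → Ξ =>
        (localState f ηl B x g (k + 1)).2.2 - g - (G (localState f ηl B x g (k + 1)).1 - G x) :=
      ((hS (k + 1)).snd.snd.sub_const g).sub
        ((hGc.measurable.comp (hS (k + 1)).fst).sub_const _)
    -- Having the fluctuation bound around every u, not only u = 0, yields a zero mean without a
    -- separate martingale argument.
    have h0 := integral_eq_zero_of_lintegral_norm_add_sq_le hmm.aestronglyMeasurable
      (by positivity) (hmom (k + 1) hk).2.2
    have hfst : ∀ B : Fin K → Fin b' → Ξ,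
        (localState f ηl B x g (k + 1)).1 = (localState f ηl B x g k).2.1 := fun B => by
      rw [localState_succ _ _ _ hk]; rfl
    simp only [hfst] at h0
    have hGm : Measurable fun B : Fin K → Fin b' → Ξ => G (localState f ηl B x g k).2.1 - G x :=
      (hGc.measurable.comp (hS k).snd.fst).sub_const _
    -- The factor 1/3 arises here: L²k²`ηl`² · 8/3 ≤ (1/24)(8/3) = 1/9.
    have hGint : ∫⁻ B, ENNReal.ofReal (‖G (localState f ηl B x g k).2.1 - G x‖ ^ 2) ∂P
        ≤ ENNReal.ofReal ((‖g‖ / 3) ^ 2) := by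
      have h := lintegral_ofReal_le_combination (w₁ := L ^ 2) (w₂ := 0) (c₂ := 0)
          (φ := fun B => ‖G (localState f ηl B x g k).2.1 - G x‖ ^ 2) (ψ₂ := fun _ => 0)
          (by positivity) le_rfl (fun B => ?_) (((hS k).snd.fst.sub_const x).norm.pow_const 2)
          (by positivity) le_rfl (hmom k hk.le).2.1 (by simp)
      · refine h.trans (ENNReal.ofReal_le_ofReal ?_)
        have e2 : L ^ 2 * ((k : ℝ) ^ 2 * ηl ^ 2) ≤ 1 / 24 := by
          calc L ^ 2 * ((k : ℝ) ^ 2 * ηl ^ 2) ≤ L ^ 2 * ((K : ℝ) ^ 2 * ηl ^ 2) := by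
                gcongr
            _ = 1 / 24 := by linarith
        have e4 := mul_le_mul_of_nonneg_right e2 (sq_nonneg ‖g‖)
        nlinarith
      · simp only [mul_zero, add_zero]
        rw [← mul_pow]; gcongr; exact hGL _ _
    obtain ⟨hGL2, hGle⟩ := integral_norm_sq_le_of_lintegral hGm.aestronglyMeasurable
      (by positivity) hGint
    have hGi := hGL2.integrable one_le_two
    have hgi' : Integrable (fun B => (localState f ηl B x g (k + 1)).2.2 - g) P :=
      hgi.sub (integrable_const _)
    rw [integral_sub hgi' hGi, integral_sub hgi (integrable_const _), sub_eq_zero] at h0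
    simp only [integral_const, probReal_univ, one_smul] at h0
    rw [h0]
    have := (norm_integral_sq_le hGL2).trans hGle
    exact abs_le_of_sq_le_sq' this (by positivity) |>.2
  have hdrift : ∀ k, k ≤ K → ‖∫ B, (x - (localState f ηl B x g k).2.1) ∂P - (k * ηl) • g‖
      ≤ k * ηl * (‖g‖ / 3) := by
    intro k
    induction k with
    | zero => simp [localState]
    | succ k ih =>
      intro hk
      have hgi := (hg (k + 1) hk).1.integrable one_le_two
      have hxi : Integrable (fun B => x - (localState f ηl B x g k).2.1) P := by
        have := ((hx k (Nat.le_of_succ_le hk)).1.integrable one_le_two).neg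
        refine this.congr (Filter.Eventually.of_forall fun B => ?_)
        simp
      have e : (fun B : Fin K → Fin b' → Ξ => x - (localState f ηl B x g (k + 1)).2.1)
          = fun B => (x - (localState f ηl B x g k).2.1)
            + ηl • (localState f ηl B x g (k + 1)).2.2 := by
        ext1 B
        rw [localState_succ _ _ _ hk]
        simp only [localStep]
        abel
      have hgs : Integrable (fun B => ηl • (localState f ηl B x g (k + 1)).2.2) P := hgi.smul ηl
      rw [e, integral_add hxi hgs, integral_smul]
      have e2 : ∫ B, (x - (localState f ηl B x g k).2.1) ∂P
          + ηl • ∫ B, (localState f ηl B x g (k + 1)).2.2 ∂P - (((k + 1 : ℕ) : ℝ) * ηl) • g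
          = (∫ B, (x - (localState f ηl B x g k).2.1) ∂P - (k * ηl) • g)
            + ηl • (∫ B, (localState f ηl B x g (k + 1)).2.2 ∂P - g) := by
        rw [smul_sub]; push_cast; rw [add_mul, one_mul, add_smul]; abel
      rw [e2]
      refine (norm_add_le _ _).trans ?_
      rw [norm_smul, Real.norm_of_nonneg hη.le]
      have := mul_le_mul_of_nonneg_left (hmean k hk) hη.le
      have := ih (Nat.le_of_succ_le hk)
      push_cast
      linarith
  have hx' := hx K le_rfl
  have hneg : ∀ B : Fin K → Fin b' → Ξ,
      -((localState f ηl B x g K).2.1 - x) = localChange f ηl B x g := fun B => by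
    simp [localChange]
  refine ⟨?_, ?_, hdrift K le_rfl⟩
  · have := hx'.1.neg
    refine (memLp_congr_ae (Filter.Eventually.of_forall fun B => ?_)).1 this
    exact hneg B
  · refine le_trans (le_of_eq ?_) (hx'.2.trans_eq (by ring))
    congr 1; ext1 B
    rw [← hneg, norm_neg]

end Local


/-! ### Random participants, anchors and miners. -/

section Selection

variable {M A : ℕ} {p : ℝ}

theorem isProbabilityMeasure_coinLaw (h0 : 0 ≤ p) (h1 : p ≤ 1) :
    IsProbabilityMeasure (coinLaw p) := by
  refine ⟨?_⟩
  simp only [coinLaw, Measure.coe_add, Measure.coe_smul, Pi.add_apply, Pi.smul_apply,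
    measure_univ, smul_eq_mul, mul_one]
  rw [← ENNReal.ofReal_add h0 (by linarith)]
  simp

theorem coinLaw_true : coinLaw p {true} = ENNReal.ofReal p := by
  simp [coinLaw]

theorem card_eq_nonempty (hA : A ≤ M) : {S : Finset (Fin M) | S.card = A}.Nonempty := by
  obtain ⟨S, -, hS⟩ := Finset.exists_subset_card_eq (s := (Finset.univ : Finset (Fin M)))
    (n := A) (by simpa using hA)
  exact ⟨S, hS⟩

theorem isProbabilityMeasure_participants (hA : A ≤ M) :
    IsProbabilityMeasure (uniformOn {S : Finset (Fin M) | S.card = A}) :=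
  isProbabilityMeasure_uniformOn (Set.toFinite _) (card_eq_nonempty hA)

theorem ae_card_participants :
    ∀ᵐ S ∂uniformOn {S : Finset (Fin M) | S.card = A}, S.card = A :=
  ae_cond_mem MeasurableSet.of_discrete

/-- A given client participates with probability `A / M`. -/
theorem uniformOn_mem_participants (hA : A ≤ M) (m : Fin M) :
    uniformOn {S : Finset (Fin M) | S.card = A} {S | m ∈ S} = ENNReal.ofReal (A / M) := by
  have hM : (0 : ℝ) < M := by exact_mod_cast m.pos
  have := isProbabilityMeasure_participants hA
  set ν := uniformOn {S : Finset (Fin M) | S.card = A} with hν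
  -- By symmetry under transpositions all clients participate with equal probability; the expected
  -- number of participants is A.
  have hswap : ∀ a, ν {S | a ∈ S} = ν {S | m ∈ S} := by
    intro a
    rw [hν, ← uniformOn_preimage_equiv (Equiv.swap a m).finsetCongr _ {S | a ∈ S}]
    · congr 1
      ext S
      change a ∈ S.map (Equiv.swap a m).toEmbedding ↔ m ∈ S
      rw [Finset.mem_map_equiv, Equiv.symm_swap, Equiv.swap_apply_left]
    · ext S
      change (S.map (Equiv.swap a m).toEmbedding).card = A ↔ S.card = A
      rw [Finset.card_map]
  have hsum : ∑ a : Fin M, ν {S | a ∈ S} = A := by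
    calc ∑ a : Fin M, ν {S | a ∈ S}
        = ∑ a : Fin M, ∫⁻ S, Set.indicator {S : Finset (Fin M) | a ∈ S} 1 S ∂ν := by
          refine Finset.sum_congr rfl fun a _ => ?_
          rw [lintegral_indicator_one MeasurableSet.of_discrete]
      _ = ∫⁻ S, ∑ a : Fin M, Set.indicator {S : Finset (Fin M) | a ∈ S} 1 S ∂ν :=
          (lintegral_finsetSum _ fun a _ => Measurable.of_discrete).symm
      _ = ∫⁻ _, (A : ℝ≥0∞) ∂ν := by
          refine lintegral_congr_ae ?_
          filter_upwards [ae_card_participants] with S hS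
          simp only [Set.indicator_apply, Set.mem_ofPred_eq, Pi.one_apply]
          rw [Finset.sum_ite_mem, Finset.univ_inter]
          simp [hS]
      _ = A := by simp
  rw [Finset.sum_congr rfl fun a _ => hswap a, Finset.sum_const, Finset.card_univ,
    Fintype.card_fin, nsmul_eq_mul] at hsum
  rw [ENNReal.ofReal_div_of_pos hM, ENNReal.ofReal_natCast, ENNReal.ofReal_natCast,
    ENNReal.eq_div_iff (by exact_mod_cast m.pos.ne') (ENNReal.natCast_ne_top M)]
  exact hsum

theorem pi_coinLaw_all_true (h0 : 0 ≤ p) (h1 : p ≤ 1) (S : Finset (Fin M)) :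
    Measure.pi (fun _ : Fin M => coinLaw p) {c | ∀ i ∈ S, c i = true}
      = ENNReal.ofReal (p ^ S.card) := by
  classical
  have := isProbabilityMeasure_coinLaw h0 h1
  have e : {c : Fin M → Bool | ∀ i ∈ S, c i = true}
      = Set.univ.pi fun i => if i ∈ S then {true} else Set.univ := by
    ext c
    simp only [Set.mem_ofPred_eq, Set.mem_pi, Set.mem_univ, true_implies]
    refine forall_congr' fun i => ?_
    by_cases hi : i ∈ S <;> simp [hi]
  rw [e, Measure.pi_pi]
  have e2 : ∀ i : Fin M, coinLaw p (if i ∈ S then {true} else Set.univ)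
      = if i ∈ S then ENNReal.ofReal p else 1 := by
    intro i
    by_cases hi : i ∈ S
    · rw [if_pos hi, if_pos hi, coinLaw_true]
    · rw [if_neg hi, if_neg hi, measure_univ]
  simp only [e2]
  rw [Finset.prod_ite_mem, Finset.univ_inter, Finset.prod_const, ENNReal.ofReal_pow h0]

/-- The probability that no participant is a miner. -/
theorem selection_no_miner (h0 : 0 ≤ p) (h1 : p ≤ 1) (hA : A ≤ M) :
    ((uniformOn {S : Finset (Fin M) | S.card = A}).prod (Measure.pi fun _ : Fin M => coinLaw p))
      {q | ∀ i ∈ q.1, q.2 i = true} = ENNReal.ofReal (p ^ A) := by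
  have := isProbabilityMeasure_coinLaw h0 h1
  have := isProbabilityMeasure_participants hA
  rw [Measure.prod_apply MeasurableSet.of_discrete]
  have : ∀ᵐ S ∂uniformOn {S : Finset (Fin M) | S.card = A},
      Measure.pi (fun _ : Fin M => coinLaw p)
        (Prod.mk S ⁻¹' {q | ∀ i ∈ q.1, q.2 i = true}) = ENNReal.ofReal (p ^ A) := by
    filter_upwards [ae_card_participants] with S hS
    rw [← hS]
    exact pi_coinLaw_all_true h0 h1 S
  rw [lintegral_congr_ae this]
  simp

/-- A given client is an anchor with probability `p A / M`. -/
theorem selection_anchor (h0 : 0 ≤ p) (h1 : p ≤ 1) (hA : A ≤ M) (m : Fin M) :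
    ((uniformOn {S : Finset (Fin M) | S.card = A}).prod (Measure.pi fun _ : Fin M => coinLaw p))
      {q | m ∈ q.1 ∧ q.2 m = true} = ENNReal.ofReal (p * A / M) := by
  have := isProbabilityMeasure_coinLaw h0 h1
  have := isProbabilityMeasure_participants hA
  have e : {q : Finset (Fin M) × (Fin M → Bool) | m ∈ q.1 ∧ q.2 m = true}
      = {S | m ∈ S} ×ˢ {c | ∀ i ∈ ({m} : Finset (Fin M)), c i = true} := by
    ext q; simp
  rw [e, Measure.prod_prod, uniformOn_mem_participants hA, pi_coinLaw_all_true h0 h1,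
    ← ENNReal.ofReal_mul (by positivity)]
  congr 1
  simp; ring

end Selection

/-! ### The scalar inequality behind the contraction. -/

section Algebra

/-- The contraction of the Lyapunov function in one round, after averaging. -/
theorem lyapunov_contraction {E : Type*} [NormedAddCommGroup E] [InnerProductSpace ℝ E]
    {L μ η ρ q a Y : ℝ} {u g n D : E} (hL : 0 < L) (hμ : 0 < μ) (hη : 0 < η) (hρ : 0 < ρ)
    (hρ1 : ρ ≤ 1) (hq : 0 ≤ q) (hq1 : q ≤ 1) (hLη : L * η ≤ 1 / 33) (hLρ : L * η ≤ ρ / 16)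
    (hμρ : μ * η ≤ ρ / 16) (hPL : 2 * μ * a ≤ ‖u‖ ^ 2) (hY : 0 ≤ Y)
    (hg : g = u + (n + D)) (hD : ‖D‖ ^ 2 ≤ L ^ 2 * Y) :
    q * (a - η * inner ℝ u g + η * (‖u‖ * (‖g‖ / 3))
          + (L / 2 + 6 * η * q * L ^ 2 / ρ * (1 + (ρ / 2)⁻¹)) * (η ^ 2 * (8 / 3 * ‖g‖ ^ 2)))
        + (1 - q) * a + 6 * η * q * L ^ 2 / ρ * (1 + ρ / 2) * (1 - ρ) * Y
      ≤ (1 - 3 / 4 * η * q * μ) * (a + 6 * η * q * L ^ 2 / ρ * Y) + 5 / 8 * η * q * ‖n‖ ^ 2 := by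
  have hin : inner ℝ u g = (‖u‖ ^ 2 + ‖g‖ ^ 2 - ‖n + D‖ ^ 2) / 2 := by
    have h := norm_sub_sq_real g u
    have e : g - u = n + D := by rw [hg]; abel
    rw [e, real_inner_comm] at h
    linarith
  have he := norm_add_sq_le_weighted (s := 1 / 4) (by norm_num) n D
  have hcross : ‖u‖ * (‖g‖ / 3) ≤ ‖u‖ ^ 2 / 8 + 2 / 9 * ‖g‖ ^ 2 := by
    nlinarith [sq_nonneg (‖u‖ / 2 - 2 / 3 * ‖g‖)]
  have hr : L * η / ρ ≤ 1 / 16 := by rw [div_le_iff₀ hρ]; linarith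
  have hr0 : 0 ≤ L * η / ρ := by positivity
  -- The bound 5/18 is exactly what remains of the ‖g‖² budget: -1/2 + 2/9 + 5/18 = 0.
  have hcoef : (L / 2 + 6 * η * q * L ^ 2 / ρ * (1 + (ρ / 2)⁻¹)) * (η * (8 / 3)) ≤ 5 / 18 := by
    have h1 : 1 + (ρ / 2)⁻¹ ≤ 3 / ρ := by
      have : (ρ / 2)⁻¹ = 2 / ρ := by field_simp
      rw [this, le_div_iff₀ hρ]; field_simp; linarith
    calc (L / 2 + 6 * η * q * L ^ 2 / ρ * (1 + (ρ / 2)⁻¹)) * (η * (8 / 3))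
        ≤ (L / 2 + 6 * η * 1 * L ^ 2 / ρ * (3 / ρ)) * (η * (8 / 3)) := by gcongr
      _ = 4 / 3 * (L * η) + 48 * (L * η / ρ) ^ 2 := by field_simp; ring
      _ ≤ 4 / 3 * (1 / 33) + 48 * (1 / 16) ^ 2 := by gcongr
      _ ≤ 5 / 18 := by norm_num
  -- The coefficient of ‖u‖² is -1/2 + 1/8 = -3/8, which PL turns into -¾μa. Half of ‖n + D‖²
  -- contributes 5/8 for the noise and 5/2 for the drift.
  have hmain : -inner ℝ u g + ‖u‖ * (‖g‖ / 3)
      + (L / 2 + 6 * η * q * L ^ 2 / ρ * (1 + (ρ / 2)⁻¹)) * (η * (8 / 3)) * ‖g‖ ^ 2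
      ≤ -(3 / 4 * μ * a) + 5 / 8 * ‖n‖ ^ 2 + 5 / 2 * (L ^ 2 * Y) := by
    have h1 := mul_le_mul_of_nonneg_right hcoef (sq_nonneg ‖g‖)
    rw [hin]
    norm_num at he
    linarith
  have h2 := mul_le_mul_of_nonneg_left hmain (mul_nonneg hη.le hq)
  -- By the choice of λ, the drift costs (5/12)ρ of the staleness term, while resetting gains at
  -- least ρ/2. The leftover ρ/12 covers the contraction rate, which is at most 3ρ/64.
  have hlam : 6 * η * q * L ^ 2 / ρ * (1 + ρ / 2) * (1 - ρ) * Y + η * q * (5 / 2 * (L ^ 2 * Y))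
      ≤ (1 - 3 / 4 * η * q * μ) * (6 * η * q * L ^ 2 / ρ * Y) := by
    have hl0 : 0 ≤ 6 * η * q * L ^ 2 / ρ * Y := by positivity
    have e1 : η * q * (5 / 2 * (L ^ 2 * Y)) = 5 / 12 * ρ * (6 * η * q * L ^ 2 / ρ * Y) := by
      field_simp; ring
    have e2 : 3 / 4 * η * q * μ ≤ ρ / 12 := by
      have : q * (μ * η) ≤ 1 * (ρ / 16) := by gcongr
      nlinarith
    have e3 : 0 ≤ (1 - 3 / 4 * η * q * μ) - (1 + ρ / 2) * (1 - ρ) - 5 / 12 * ρ := by nlinarith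
    have := mul_nonneg e3 hl0
    rw [e1]
    linarith
  linarith

end Algebra


/-! ### The abstract problem and smoothness of the global loss. -/

section Problem

variable {d M : ℕ} {Ξ : Type*} [MeasurableSpace Ξ]

/-- What the analysis uses of a problem: batches of the two sizes give unbiased gradients, with
variance at most `V` for the large size, and satisfying average smoothness for the small size. -/
structure BatchModel (f : Fin M → Model d → Ξ → ℝ) (D : Fin M → Dataset Ξ) (L Lσ V : ℝ)
    (b b' : ℕ) : Prop where
  prob_large : ∀ i, IsProbabilityMeasure ((D i).batchLaw b)
  prob_small : ∀ i, IsProbabilityMeasure ((D i).batchLaw b')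
  unbiased_large : ∀ i, IsUnbiased ((D i).batchLaw b) (fun B => batchGrad (f i) B)
    (gradient (localLoss (f i) (D i)))
  unbiased_small : ∀ i, IsUnbiased ((D i).batchLaw b') (fun B => batchGrad (f i) B)
    (gradient (localLoss (f i) (D i)))
  noise : ∀ i v, ∫⁻ B, ENNReal.ofReal
    (‖batchGrad (f i) B v - gradient (localLoss (f i) (D i)) v‖ ^ 2) ∂(D i).batchLaw b
      ≤ ENNReal.ofReal V
  smooth : ∀ i v w, ∫⁻ B, ENNReal.ofReal (‖(batchGrad (f i) B v - batchGrad (f i) B w)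
    - (gradient (localLoss (f i) (D i)) v - gradient (localLoss (f i) (D i)) w)‖ ^ 2)
      ∂(D i).batchLaw b' ≤ ENNReal.ofReal (Lσ ^ 2 * ‖v - w‖ ^ 2)
  lsmooth : LSmooth f D L

variable {f : Fin M → Model d → Ξ → ℝ} {D : Fin M → Dataset Ξ} {L Lσ V : ℝ} {b b' : ℕ}

theorem hasGradientAt_globalLoss (hf : ∀ i, Differentiable ℝ (localLoss (f i) (D i)))
    (x : Model d) :
    HasGradientAt (globalLoss f D) ((M : ℝ)⁻¹ • ∑ i, gradient (localLoss (f i) (D i)) x) x := by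
  rw [hasGradientAt_iff_hasFDerivAt, map_smul, map_sum]
  exact (HasFDerivAt.fun_sum fun i _ => (hf i x).hasGradientAt.hasFDerivAt).const_mul _

theorem gradient_globalLoss (h : LSmooth f D L) (x : Model d) :
    gradient (globalLoss f D) x = (M : ℝ)⁻¹ • ∑ i, gradient (localLoss (f i) (D i)) x :=
  (hasGradientAt_globalLoss (fun i => (h i).1) x).gradient

theorem differentiable_globalLoss (h : LSmooth f D L) : Differentiable ℝ (globalLoss f D) :=
  fun x => (hasGradientAt_globalLoss (fun i => (h i).1) x).differentiableAt

theorem norm_avg_sq_le {E ι : Type*} [NormedAddCommGroup E] [NormedSpace ℝ E] (s : Finset ι)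
    (w : ι → E) :
    ‖(s.card : ℝ)⁻¹ • ∑ i ∈ s, w i‖ ^ 2 ≤ (s.card : ℝ)⁻¹ * ∑ i ∈ s, ‖w i‖ ^ 2 := by
  rcases s.eq_empty_or_nonempty with rfl | hs
  · simp
  have hc : (0 : ℝ) < s.card := by exact_mod_cast hs.card_pos
  rw [norm_smul, mul_pow, Real.norm_of_nonneg (by positivity)]
  have h1 : ‖∑ i ∈ s, w i‖ ^ 2 ≤ s.card * ∑ i ∈ s, ‖w i‖ ^ 2 :=
    (pow_le_pow_left₀ (norm_nonneg _) (norm_sum_le _ _) 2).trans sq_sum_le_card_mul_sum_sq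
  calc (s.card : ℝ)⁻¹ ^ 2 * ‖∑ i ∈ s, w i‖ ^ 2
      ≤ (s.card : ℝ)⁻¹ ^ 2 * (s.card * ∑ i ∈ s, ‖w i‖ ^ 2) := by gcongr
    _ = _ := by field_simp

theorem globalLoss_lipschitz (hM : 0 < M) (h : LSmooth f D L) (v w : Model d) :
    ‖gradient (globalLoss f D) v - gradient (globalLoss f D) w‖ ≤ L * ‖v - w‖ := by
  have hM' : (0 : ℝ) < M := by exact_mod_cast hM
  rw [gradient_globalLoss h, gradient_globalLoss h, ← smul_sub, ← Finset.sum_sub_distrib,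
    norm_smul, Real.norm_of_nonneg (by positivity)]
  have h1 : ‖∑ i, (gradient (localLoss (f i) (D i)) v - gradient (localLoss (f i) (D i)) w)‖
      ≤ ∑ _i : Fin M, L * ‖v - w‖ := norm_sum_le_of_le _ fun i _ => (h i).2 v w
  rw [Finset.sum_const, Finset.card_univ, Fintype.card_fin, nsmul_eq_mul] at h1
  calc (M : ℝ)⁻¹ * _ ≤ (M : ℝ)⁻¹ * (M * (L * ‖v - w‖)) := by gcongr
    _ = _ := by field_simp

theorem continuous_gradient_localLoss (h : LSmooth f D L) (hL : 0 < L) (i : Fin M) :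
    Continuous (gradient (localLoss (f i) (D i))) :=
  (LipschitzWith.of_dist_le_mul (K := ⟨L, hL.le⟩) fun v w => by
    rw [dist_eq_norm, dist_eq_norm]; exact (h i).2 v w).continuous

end Problem

/-! ### The run with anchoring points, and its measurability. -/

section Tracked

variable {d M b b' K : ℕ} {Ξ : Type*}

/-- Server state together with the point at which each caching gradient was taken. -/
abbrev Tracked (d M : ℕ) := State d M × (Fin M → Model d)

/-- One communication round, keeping track of the anchoring points. -/
noncomputable def trackedStep (f : Fin M → Model d → Ξ → ℝ) (ηl ηs : ℝ) (z : Tracked d M)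
    (r : RoundSeed M b b' K Ξ) : Tracked d M :=
  (roundStep f ηl ηs z.1 r, fun i => if i ∈ anchors r then z.1.1 else z.2 i)

/-- The run of the algorithm from a given tracked state. -/
noncomputable def trackedRun (f : Fin M → Model d → Ξ → ℝ) (ηl ηs : ℝ) (z : Tracked d M)
    (ρ : ℕ → RoundSeed M b b' K Ξ) : ℕ → Tracked d M
  | 0 => z
  | t + 1 => trackedStep f ηl ηs (trackedRun f ηl ηs z ρ t) (ρ t)

/-- The tracked state after the initial caching gradients have been computed. -/
noncomputable def trackedInit (f : Fin M → Model d → Ξ → ℝ) (x₀ : Model d)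
    (B : Fin M → Fin b → Ξ) : Tracked d M :=
  ((x₀, fun i => batchGrad (f i) (B i) x₀), fun _ => x₀)

theorem trackedRun_fst (f : Fin M → Model d → Ξ → ℝ) (ηl ηs : ℝ) (x₀ : Model d)
    (ω : Seed M b b' K Ξ) (t : ℕ) :
    (trackedRun f ηl ηs (trackedInit f x₀ ω.1) ω.2 t).1 = run f ηl ηs x₀ ω t := by
  induction t with
  | zero => rfl
  | succ t ih => rw [trackedRun, trackedStep, ih, run]

/-- Causality: a state does not see the seeds of its own or later rounds. This gives the Markov
property. -/
theorem trackedRun_update (f : Fin M → Model d → Ξ → ℝ) (ηl ηs : ℝ) (z : Tracked d M)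
    (ρ : ℕ → RoundSeed M b b' K Ξ) {t s : ℕ} (h : t ≤ s) (r : RoundSeed M b b' K Ξ) :
    trackedRun f ηl ηs z (Function.update ρ s r) t = trackedRun f ηl ηs z ρ t := by
  induction t with
  | zero => rfl
  | succ t ih =>
    rw [trackedRun, trackedRun, ih (Nat.le_of_succ_le h),
      Function.update_of_ne (Nat.ne_of_lt h)]

variable [MeasurableSpace Ξ] {f : Fin M → Model d → Ξ → ℝ}

/-- Participants and coins live in a finite discrete space, so every branch condition of the
algorithm is measurable. -/
theorem measurable_selection {β : Type*} [MeasurableSpace β]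
    (φ : Finset (Fin M) × (Fin M → Bool) → β) :
    Measurable fun r : RoundSeed M b b' K Ξ => φ (r.1, r.2.1) :=
  Measurable.of_discrete.comp (measurable_fst.prodMk measurable_snd.fst)

section

variable {α β : Type*} [MeasurableSpace α] [MeasurableSpace β] {r : α → RoundSeed M b b' K Ξ}

theorem measurable_ite_anchor (hr : Measurable r) (i : Fin M) {u v : α → β} (hu : Measurable u)
    (hv : Measurable v) : Measurable fun a => if i ∈ anchors (r a) then u a else v a :=
  Measurable.ite (measurableSet_setOfPred.2 ((measurable_selection (β := Prop)
    fun s => i ∈ s.1.filter fun i => s.2 i = true).comp hr)) hu hv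

theorem measurable_ite_miner (hr : Measurable r) (i : Fin M) {u v : α → β} (hu : Measurable u)
    (hv : Measurable v) : Measurable fun a => if i ∈ miners (r a) then u a else v a :=
  Measurable.ite (measurableSet_setOfPred.2 ((measurable_selection (β := Prop)
    fun s => i ∈ s.1.filter fun i => s.2 i = false).comp hr)) hu hv

theorem measurable_ite_miners_nonempty (hr : Measurable r) {u v : α → β} (hu : Measurable u)
    (hv : Measurable v) : Measurable fun a => if (miners (r a)).Nonempty then u a else v a :=
  Measurable.ite (measurableSet_setOfPred.2 ((measurable_selection (β := Prop)
    fun s => (s.1.filter fun i => s.2 i = false).Nonempty).comp hr)) hu hv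

theorem measurable_avg_miners (hr : Measurable r) {w : Fin M → α → Model d}
    (hw : ∀ i, Measurable (w i)) :
    Measurable fun a => ((miners (r a)).card : ℝ)⁻¹ • ∑ i ∈ miners (r a), w i a := by
  have hcard : Measurable fun a => ((miners (r a)).card : ℝ)⁻¹ := by
    have h : Measurable fun r : RoundSeed M b b' K Ξ => (miners r).card :=
      measurable_selection (β := ℕ) fun s => (s.1.filter fun i => s.2 i = false).card
    exact ((measurable_from_nat (f := fun n : ℕ => (n : ℝ)⁻¹)).comp h).comp hr
  have e : ∀ a, ∑ i ∈ miners (r a), w i a = ∑ i, if i ∈ miners (r a) then w i a else 0 := by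
    intro a
    rw [Finset.sum_ite_mem, Finset.univ_inter]
  simp only [e]
  have hs : Measurable fun a => ∑ i, if i ∈ miners (r a) then w i a else 0 :=
    Finset.measurable_sum _ fun i _ => measurable_ite_miner hr i (hw i) measurable_const
  exact hcard.smul hs

theorem measurable_trackedStep_comp
    (hb : ∀ i, Measurable fun q : (Fin b → Ξ) × Model d => batchGrad (f i) q.1 q.2)
    (hb' : ∀ i, Measurable fun q : (Fin b' → Ξ) × Model d => batchGrad (f i) q.1 q.2)
    (ηl ηs : ℝ) {x : α → Model d} {v y : α → Fin M → Model d} (hx : Measurable x)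
    (hv : Measurable v) (hy : Measurable y) (hr : Measurable r) :
    Measurable fun a => trackedStep f ηl ηs ((x a, v a), y a) (r a) := by
  have hvi : ∀ i, Measurable fun a => v a i := fun i => (measurable_pi_apply i).comp hv
  have hyi : ∀ i, Measurable fun a => y a i := fun i => (measurable_pi_apply i).comp hy
  have hg : Measurable fun a => (M : ℝ)⁻¹ • ∑ i, v a i :=
    (Finset.measurable_sum _ fun i _ => hvi i).const_smul ((M : ℝ)⁻¹)
  have hbi : ∀ i, Measurable fun a => (r a).2.2.1 i := fun i =>
    (measurable_pi_apply i).comp hr.snd.snd.fst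
  have hbi' : ∀ i, Measurable fun a => (r a).2.2.2 i := fun i =>
    (measurable_pi_apply i).comp hr.snd.snd.snd
  have hch : ∀ i, Measurable fun a =>
      localChange (f i) ηl ((r a).2.2.2 i) (x a) ((M : ℝ)⁻¹ • ∑ i, v a i) := fun i =>
    (measurable_localChange (hb' i)).comp ((hbi' i).prodMk (hx.prodMk hg))
  have hbig : ∀ i, Measurable fun a => batchGrad (f i) ((r a).2.2.1 i) (x a) := fun i =>
    Measurable.comp (g := fun q : (Fin b → Ξ) × Model d => batchGrad (f i) q.1 q.2)
      (f := fun a => ((r a).2.2.1 i, x a)) (hb i) ((hbi i).prodMk hx)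
  have h1 := measurable_ite_miners_nonempty hr
    (hx.sub ((measurable_avg_miners hr hch).const_smul ηs)) hx
  have h2 := measurable_pi_lambda _ fun i => measurable_ite_anchor hr i (hbig i) (hvi i)
  have h3 := measurable_pi_lambda _ fun i => measurable_ite_anchor hr i hx (hyi i)
  unfold trackedStep roundStep
  exact (h1.prodMk h2).prodMk h3

end

theorem measurable_trackedStep
    (hb : ∀ i, Measurable fun q : (Fin b → Ξ) × Model d => batchGrad (f i) q.1 q.2)
    (hb' : ∀ i, Measurable fun q : (Fin b' → Ξ) × Model d => batchGrad (f i) q.1 q.2)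
    (ηl ηs : ℝ) :
    Measurable fun q : Tracked d M × RoundSeed M b b' K Ξ =>
      trackedStep f ηl ηs q.1 q.2 :=
  measurable_trackedStep_comp hb hb' ηl ηs measurable_fst.fst.fst measurable_fst.fst.snd
    measurable_fst.snd measurable_snd

theorem measurable_trackedRun
    (hb : ∀ i, Measurable fun q : (Fin b → Ξ) × Model d => batchGrad (f i) q.1 q.2)
    (hb' : ∀ i, Measurable fun q : (Fin b' → Ξ) × Model d => batchGrad (f i) q.1 q.2)
    (ηl ηs : ℝ) (t : ℕ) :
    Measurable fun q : Tracked d M × (ℕ → RoundSeed M b b' K Ξ) =>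
      trackedRun f ηl ηs q.1 q.2 t := by
  induction t with
  | zero => exact measurable_fst
  | succ t ih =>
    exact (measurable_trackedStep hb hb' ηl ηs).comp
      (ih.prodMk ((measurable_pi_apply t).comp measurable_snd))

end Tracked


/-! ### The Lyapunov function across one round. -/

variable {d M A b b' K : ℕ} {Ξ : Type*} [MeasurableSpace Ξ] {f : Fin M → Model d → Ξ → ℝ}
  {D : Fin M → Dataset Ξ} {L Lσ V : ℝ}

/-- Suboptimality plus a multiple of the mean squared staleness of the caching gradients. -/
noncomputable def lyapunov (f : Fin M → Model d → Ξ → ℝ) (D : Fin M → Dataset Ξ) (Fstar lam : ℝ)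
    (z : Tracked d M) : ℝ :=
  globalLoss f D z.1.1 - Fstar + lam * ((M : ℝ)⁻¹ * ∑ i, ‖z.2 i - z.1.1‖ ^ 2)

/-- Sampling error of one caching gradient. -/
noncomputable def cacheNoise (f : Fin M → Model d → Ξ → ℝ) (D : Fin M → Dataset Ξ)
    (z : Tracked d M) (i : Fin M) : Model d :=
  z.1.2 i - gradient (localLoss (f i) (D i)) (z.2 i)

/-- Expected decrease along the averaged local change of a single miner. -/
theorem lintegral_miner_le (hP : BatchModel f D L Lσ V b b') (hL : 0 < L) {ηl ηs : ℝ}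
    (hη : 0 < ηl) (hηs : 0 ≤ ηs) (hK : 24 * (K * L * ηl) ^ 2 = 1) (hKσ : 2 * Lσ ^ 2 ≤ K * L ^ 2)
    (i : Fin M) (x g u : Model d) (a κ : ℝ) (hκ : 0 ≤ κ)
    (hnn : ∀ y : Model d, 0 ≤ a - ηs * inner ℝ u y + κ * (ηs ^ 2 * ‖y‖ ^ 2)) :
    0 ≤ a - ηs * (K * ηl) * inner ℝ u g + ηs * (K * ηl) * (‖u‖ * (‖g‖ / 3))
        + κ * ((ηs * (K * ηl)) ^ 2 * (8 / 3 * ‖g‖ ^ 2)) ∧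
    ∫⁻ B, ENNReal.ofReal (a - ηs * inner ℝ u (localChange (f i) ηl B x g)
        + κ * (ηs ^ 2 * ‖localChange (f i) ηl B x g‖ ^ 2))
          ∂Measure.pi (fun _ : Fin K => (D i).batchLaw b')
      ≤ ENNReal.ofReal (a - ηs * (K * ηl) * inner ℝ u g + ηs * (K * ηl) * (‖u‖ * (‖g‖ / 3))
        + κ * ((ηs * (K * ηl)) ^ 2 * (8 / 3 * ‖g‖ ^ 2))) := by
  have := hP.prob_small i
  obtain ⟨hm, h2, h1⟩ := localChange_moments (hP.unbiased_small i) hL (hP.lsmooth i).2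
    (continuous_gradient_localLoss hP.lsmooth hL i) (hP.smooth i) hη hK hKσ x g
  set P := Measure.pi (fun _ : Fin K => (D i).batchLaw b')
  have hi := hm.integrable one_le_two
  have hsq := (memLp_two_iff_integrable_sq_norm hm.1).1 hm
  have hin : Integrable (fun B => ηs * inner ℝ u (localChange (f i) ηl B x g)) P :=
    (hi.const_inner u).const_mul ηs
  have hs : Integrable (fun B => κ * (ηs ^ 2 * ‖localChange (f i) ηl B x g‖ ^ 2)) P :=
    (hsq.const_mul _).const_mul _
  have hai : Integrable (fun B => a - ηs * inner ℝ u (localChange (f i) ηl B x g)) P :=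
    (integrable_const a).sub hin
  have hval : ∫ B, (a - ηs * inner ℝ u (localChange (f i) ηl B x g)
        + κ * (ηs ^ 2 * ‖localChange (f i) ηl B x g‖ ^ 2)) ∂P
      ≤ a - ηs * (K * ηl) * inner ℝ u g + ηs * (K * ηl) * (‖u‖ * (‖g‖ / 3))
        + κ * ((ηs * (K * ηl)) ^ 2 * (8 / 3 * ‖g‖ ^ 2)) := by
    rw [integral_add hai hs, integral_sub (integrable_const a) hin, integral_const_mul,
      integral_const_mul, integral_const_mul, integral_inner hi]
    simp only [integral_const, probReal_univ, smul_eq_mul, one_mul]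
    -- The mean change is its ideal value plus a deviation, which Cauchy–Schwarz charges at
    -- ‖u‖‖g‖/3.
    have e1 : -inner ℝ u (∫ B, localChange (f i) ηl B x g ∂P)
        ≤ -((K * ηl) * inner ℝ u g) + ‖u‖ * (K * ηl * (‖g‖ / 3)) := by
      have h3 : inner ℝ u (∫ B, localChange (f i) ηl B x g ∂P) = (K * ηl) * inner ℝ u g
          + inner ℝ u (∫ B, localChange (f i) ηl B x g ∂P - (K * ηl) • g) := by
        rw [inner_sub_right, inner_smul_right]; ring
      have h4 := (abs_le.1 (abs_real_inner_le_norm u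
        (∫ B, localChange (f i) ηl B x g ∂P - (K * ηl) • g))).1
      have h5 := mul_le_mul_of_nonneg_left h1 (norm_nonneg u)
      rw [h3]; linarith
    have e2 := mul_le_mul_of_nonneg_left e1 hηs
    have e3 := mul_le_mul_of_nonneg_left (mul_le_mul_of_nonneg_left h2 (sq_nonneg ηs)) hκ
    linarith
  refine ⟨(integral_nonneg fun B => hnn _).trans hval, ?_⟩
  have hall : Integrable (fun B => a - ηs * inner ℝ u (localChange (f i) ηl B x g)
      + κ * (ηs ^ 2 * ‖localChange (f i) ηl B x g‖ ^ 2)) P := hai.add hs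
  rw [← ofReal_integral_eq_lintegral_ofReal hall (Filter.Eventually.of_forall fun B => hnn _)]
  exact ENNReal.ofReal_le_ofReal hval

theorem avg_affine {ι : Type*} (s : Finset ι) (hs : s.Nonempty) (a k : ℝ) (w t : ι → ℝ) :
    (s.card : ℝ)⁻¹ * ∑ i ∈ s, (a - w i + k * t i)
      = a - (s.card : ℝ)⁻¹ * ∑ i ∈ s, w i + k * ((s.card : ℝ)⁻¹ * ∑ i ∈ s, t i) := by
  have : (s.card : ℝ) ≠ 0 := by exact_mod_cast hs.card_pos.ne'
  rw [Finset.sum_add_distrib, Finset.sum_sub_distrib, Finset.sum_const, nsmul_eq_mul,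
    ← Finset.mul_sum]
  field_simp

/-- Staleness of a caching gradient after a round in which the model moves by `w`. -/
theorem staleness_le {E : Type*} [NormedAddCommGroup E] {β : ℝ} (hβ : 0 < β) (P : Prop)
    [Decidable P] (x y w : E) :
    ‖(if P then x else y) - (x - w)‖ ^ 2
      ≤ (if P then 0 else (1 + β) * ‖y - x‖ ^ 2) + (1 + β⁻¹) * ‖w‖ ^ 2 := by
  split_ifs
  · have : 0 ≤ β⁻¹ * ‖w‖ ^ 2 := by positivity
    rw [sub_sub_cancel]; linarith
  · have := norm_add_sq_le_weighted hβ (y - x) w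
    rwa [sub_add] at this

/-- Lyapunov function after a round with at least one miner, bounded by an average over miners. -/
theorem lyapunov_step_le (hM : 0 < M) (hL : 0 ≤ L) (hs : LSmooth f D L) {ηl ηs Fstar lam β : ℝ}
    (hlam : 0 ≤ lam) (hβ : 0 < β) (z : Tracked d M) (r : RoundSeed M b b' K Ξ)
    (hr : (miners r).Nonempty) :
    lyapunov f D Fstar lam (trackedStep f ηl ηs z r)
      ≤ ((miners r).card : ℝ)⁻¹ * ∑ i ∈ miners r,
          (globalLoss f D z.1.1 - Fstar - ηs * inner ℝ (gradient (globalLoss f D) z.1.1)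
            (localChange (f i) ηl (r.2.2.2 i) z.1.1 ((M : ℝ)⁻¹ • ∑ i, z.1.2 i))
          + (L / 2 + lam * (1 + β⁻¹)) * (ηs ^ 2 *
            ‖localChange (f i) ηl (r.2.2.2 i) z.1.1 ((M : ℝ)⁻¹ • ∑ i, z.1.2 i)‖ ^ 2))
        + ∑ m, if m ∈ anchors r then 0 else lam * (1 + β) * (M : ℝ)⁻¹ * ‖z.2 m - z.1.1‖ ^ 2 := by
  have hM' : (0 : ℝ) < M := by exact_mod_cast hM
  set x := z.1.1
  set Δ : Fin M → Model d := fun i =>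
    localChange (f i) ηl (r.2.2.2 i) x ((M : ℝ)⁻¹ • ∑ i, z.1.2 i) with hΔ
  set w : Model d := ηs • (((miners r).card : ℝ)⁻¹ • ∑ i ∈ miners r, Δ i) with hw
  set u := gradient (globalLoss f D) x with hu
  have hstep : (trackedStep f ηl ηs z r).1.1 = x - w := by
    simp only [trackedStep, roundStep, if_pos hr]
    rfl
  have hdesc := le_quadratic_of_lipschitz_gradient (differentiable_globalLoss hs)
    (globalLoss_lipschitz hM hs) x (x - w)
  rw [sub_sub_cancel_left, inner_neg_right, norm_neg, ← hu] at hdesc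
  -- Convexity replaces the averaged move by an average of squared moves, so each miner can later be
  -- integrated alone, for any number of miners.
  have hwsq : ‖w‖ ^ 2 ≤ ((miners r).card : ℝ)⁻¹ * ∑ i ∈ miners r, ηs ^ 2 * ‖Δ i‖ ^ 2 := by
    rw [hw, norm_smul, mul_pow, Real.norm_eq_abs, sq_abs, ← Finset.mul_sum, mul_left_comm]
    exact mul_le_mul_of_nonneg_left (norm_avg_sq_le _ _) (sq_nonneg _)
  have hwin : inner ℝ u w = ((miners r).card : ℝ)⁻¹ * ∑ i ∈ miners r, ηs * inner ℝ u (Δ i) := by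
    rw [hw, inner_smul_right, inner_smul_right, inner_sum, ← Finset.mul_sum]; ring
  have hY : (M : ℝ)⁻¹ * ∑ i, ‖(trackedStep f ηl ηs z r).2 i - (x - w)‖ ^ 2
      ≤ (∑ m, if m ∈ anchors r then 0 else (1 + β) * (M : ℝ)⁻¹ * ‖z.2 m - x‖ ^ 2)
        + (1 + β⁻¹) * ‖w‖ ^ 2 := by
    calc (M : ℝ)⁻¹ * ∑ i, ‖(trackedStep f ηl ηs z r).2 i - (x - w)‖ ^ 2
        ≤ (M : ℝ)⁻¹ * ∑ i, ((if i ∈ anchors r then 0 else (1 + β) * ‖z.2 i - x‖ ^ 2)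
            + (1 + β⁻¹) * ‖w‖ ^ 2) := by
          gcongr with i
          exact staleness_le hβ (i ∈ anchors r) x (z.2 i) w
      _ = _ := by
          rw [Finset.sum_add_distrib, Finset.sum_const, Finset.card_univ, Fintype.card_fin,
            nsmul_eq_mul, mul_add, inv_mul_cancel_left₀ hM'.ne', Finset.mul_sum]
          congr 1
          refine Finset.sum_congr rfl fun i _ => ?_
          split_ifs <;> ring
  have hY' := mul_le_mul_of_nonneg_left hY hlam
  have hκ : 0 ≤ L / 2 + lam * (1 + β⁻¹) := by positivity
  have hw' := mul_le_mul_of_nonneg_left hwsq hκ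
  rw [lyapunov, hstep]
  have e : ((miners r).card : ℝ)⁻¹ * ∑ i ∈ miners r,
      (globalLoss f D x - Fstar - ηs * inner ℝ u (Δ i)
        + (L / 2 + lam * (1 + β⁻¹)) * (ηs ^ 2 * ‖Δ i‖ ^ 2))
      = globalLoss f D x - Fstar - inner ℝ u w + (L / 2 + lam * (1 + β⁻¹)) *
        (((miners r).card : ℝ)⁻¹ * ∑ i ∈ miners r, ηs ^ 2 * ‖Δ i‖ ^ 2) := by
    rw [hwin]
    exact avg_affine _ hr _ _ _ _
  rw [e]
  have e2 : lam * ∑ m, (if m ∈ anchors r then 0 else (1 + β) * (M : ℝ)⁻¹ * ‖z.2 m - x‖ ^ 2)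
      = ∑ m, if m ∈ anchors r then 0 else lam * (1 + β) * (M : ℝ)⁻¹ * ‖z.2 m - x‖ ^ 2 := by
    rw [Finset.mul_sum]
    refine Finset.sum_congr rfl fun m _ => ?_
    split_ifs <;> ring
  rw [mul_add, e2] at hY'
  linarith

/-- With no miner the model stands still, so the loss is unchanged and staleness can only be erased.
-/
theorem lyapunov_step_eq_of_no_miner {ηl ηs Fstar lam : ℝ} (z : Tracked d M)
    (r : RoundSeed M b b' K Ξ) (hr : ¬(miners r).Nonempty) :
    lyapunov f D Fstar lam (trackedStep f ηl ηs z r) = globalLoss f D z.1.1 - Fstar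
      + ∑ m, if m ∈ anchors r then 0 else lam * (M : ℝ)⁻¹ * ‖z.2 m - z.1.1‖ ^ 2 := by
  have hstep : (trackedStep f ηl ηs z r).1.1 = z.1.1 := by
    simp only [trackedStep, roundStep, if_neg hr]
  rw [lyapunov, hstep, Finset.mul_sum, Finset.mul_sum]
  congr 1
  refine Finset.sum_congr rfl fun m _ => ?_
  simp only [trackedStep]
  split_ifs
  · simp
  · ring

/-- Expectation over the seed of a round, one source of randomness at a time. -/
theorem lintegral_roundLaw (hP : BatchModel f D L Lσ V b b') {p : ℝ} (h0 : 0 ≤ p) (h1 : p ≤ 1)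
    (hA : A ≤ M) {φ : RoundSeed M b b' K Ξ → ℝ≥0∞} (hφ : Measurable φ) :
    ∫⁻ r, φ r ∂roundLaw D A p b b' K
      = ∫⁻ s, ∫⁻ B, ∫⁻ B', φ (s.1, s.2, B, B')
          ∂(Measure.pi fun i : Fin M => Measure.pi fun _ : Fin K => (D i).batchLaw b')
          ∂(Measure.pi fun i : Fin M => (D i).batchLaw b)
          ∂((uniformOn {S : Finset (Fin M) | S.card = A}).prod
            (Measure.pi fun _ : Fin M => coinLaw p)) := by
  have := isProbabilityMeasure_coinLaw h0 h1
  have := isProbabilityMeasure_participants hA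
  have := hP.prob_large
  have := hP.prob_small
  have hφ1 : ∀ S, Measurable fun r : (Fin M → Bool) × (Fin M → Fin b → Ξ) ×
      (Fin M → Fin K → Fin b' → Ξ) => φ (S, r) := fun S => hφ.comp measurable_prodMk_left
  have hφ2 : ∀ S c, Measurable fun r : (Fin M → Fin b → Ξ) × (Fin M → Fin K → Fin b' → Ξ) =>
      φ (S, c, r) := fun S c => (hφ1 S).comp measurable_prodMk_left
  rw [roundLaw, lintegral_prod _ hφ.aemeasurable,
    lintegral_prod _ (Measurable.of_discrete).aemeasurable]
  refine lintegral_congr fun S => ?_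
  rw [lintegral_prod _ (hφ1 S).aemeasurable]
  refine lintegral_congr fun c => ?_
  rw [lintegral_prod _ (hφ2 S c).aemeasurable]

theorem isProbabilityMeasure_roundLaw (hP : BatchModel f D L Lσ V b b') {p : ℝ} (h0 : 0 ≤ p)
    (h1 : p ≤ 1) (hA : A ≤ M) : IsProbabilityMeasure (roundLaw D A p b b' K) := by
  have := isProbabilityMeasure_coinLaw h0 h1
  have := isProbabilityMeasure_participants hA
  have := hP.prob_large
  have := hP.prob_small
  unfold roundLaw
  infer_instance

/-- Averaging over participants and coins. -/
theorem lintegral_selection {p : ℝ} (h0 : 0 ≤ p) (h1 : p ≤ 1) (hA : A ≤ M) {W a : ℝ}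
    (hW : 0 ≤ W) (ha : 0 ≤ a) {c : Fin M → ℝ} (hc : ∀ m, 0 ≤ c m) :
    ∫⁻ s, ((if (s.1.filter fun i => s.2 i = false).Nonempty then ENNReal.ofReal W
        else ENNReal.ofReal a)
      + ∑ m, if m ∈ s.1.filter (fun i => s.2 i = true) then 0 else ENNReal.ofReal (c m))
        ∂((uniformOn {S : Finset (Fin M) | S.card = A}).prod
            (Measure.pi fun _ : Fin M => coinLaw p))
      = ENNReal.ofReal ((1 - p ^ A) * W + p ^ A * a + (1 - p * A / M) * ∑ m, c m) := by
  have := isProbabilityMeasure_coinLaw h0 h1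
  have := isProbabilityMeasure_participants hA
  set ν := (uniformOn {S : Finset (Fin M) | S.card = A}).prod
    (Measure.pi fun _ : Fin M => coinLaw p)
  have hpA0 : 0 ≤ p ^ A := by positivity
  have hpA1 : p ^ A ≤ 1 := pow_le_one₀ h0 h1
  rw [lintegral_add_left Measurable.of_discrete, lintegral_finsetSum _ fun m _ =>
    Measurable.of_discrete]
  set E : Set (Finset (Fin M) × (Fin M → Bool)) := {q | ∀ i ∈ q.1, q.2 i = true} with hE
  -- Existence of a miner and a client's anchor status are dependent events. Since the bound is a
  -- sum of indicators, only their separate probabilities matter.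
  have e1 : (fun s : Finset (Fin M) × (Fin M → Bool) =>
      if (s.1.filter fun i => s.2 i = false).Nonempty then ENNReal.ofReal W else ENNReal.ofReal a)
      = fun s => Eᶜ.indicator (fun _ => ENNReal.ofReal W) s
        + E.indicator (fun _ => ENNReal.ofReal a) s := by
    ext1 s
    by_cases hs : s ∈ E
    · have hn : ¬ (s.1.filter fun i => s.2 i = false).Nonempty := by
        rintro ⟨i, hi⟩
        rw [Finset.mem_filter] at hi
        have := hs i hi.1
        rw [hi.2] at this
        exact Bool.false_ne_true this
      simp [hn, hs]
    · have hn : (s.1.filter fun i => s.2 i = false).Nonempty := by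
        simp only [hE, Set.mem_ofPred_eq, not_forall] at hs
        obtain ⟨i, hi, hi'⟩ := hs
        exact ⟨i, Finset.mem_filter.2 ⟨hi, by simpa using hi'⟩⟩
      simp [hn, hs]
  have e2 : ∀ m, ∫⁻ s, (if m ∈ s.1.filter (fun i => s.2 i = true) then 0
      else ENNReal.ofReal (c m)) ∂ν = ENNReal.ofReal ((1 - p * A / M) * c m) := by
    intro m
    have hA' : (A : ℝ) / M ≤ 1 := div_le_one_of_le₀ (by exact_mod_cast hA) (by positivity)
    have hρ0 : 0 ≤ p * A / M := by positivity
    have hρ1 : p * A / M ≤ 1 := by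
      rw [mul_div_assoc]
      exact mul_le_one₀ h1 (by positivity) hA'
    have e : ∀ s : Finset (Fin M) × (Fin M → Bool),
        (if m ∈ s.1.filter (fun i => s.2 i = true) then 0 else ENNReal.ofReal (c m))
        = {q : Finset (Fin M) × (Fin M → Bool) | m ∈ q.1 ∧ q.2 m = true}ᶜ.indicator
          (fun _ => ENNReal.ofReal (c m)) s := by
      intro s
      simp only [Finset.mem_filter, Set.indicator_apply, Set.mem_compl_iff, Set.mem_ofPred_eq]
      by_cases h : m ∈ s.1 ∧ s.2 m = true <;> simp [h]
    simp only [e]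
    rw [lintegral_indicator_const MeasurableSet.of_discrete,
      prob_compl_eq_one_sub MeasurableSet.of_discrete, selection_anchor h0 h1 hA,
      ← ENNReal.ofReal_one, ← ENNReal.ofReal_sub _ hρ0, ← ENNReal.ofReal_mul (hc m), mul_comm]
  simp only [e2]
  rw [e1, lintegral_add_left Measurable.of_discrete,
    lintegral_indicator_const MeasurableSet.of_discrete,
    lintegral_indicator_const MeasurableSet.of_discrete,
    prob_compl_eq_one_sub MeasurableSet.of_discrete, selection_no_miner h0 h1 hA,
    ← ENNReal.ofReal_one, ← ENNReal.ofReal_sub _ hpA0, ← ENNReal.ofReal_mul hW,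
    ← ENNReal.ofReal_mul ha]
  have hρ : ∀ m : Fin M, 0 ≤ (1 - p * A / M) * c m := by
    intro m
    have hA' : (A : ℝ) / M ≤ 1 := div_le_one_of_le₀ (by exact_mod_cast hA) (by positivity)
    have hρ1 : p * A / M ≤ 1 := by
      rw [mul_div_assoc]
      exact mul_le_one₀ h1 (by positivity) hA'
    exact mul_nonneg (by linarith) (hc m)
  rw [← ENNReal.ofReal_sum_of_nonneg fun m _ => hρ m,
    ← ENNReal.ofReal_add (mul_nonneg hW (by linarith)) (mul_nonneg ha hpA0),
    ← ENNReal.ofReal_add (add_nonneg (mul_nonneg hW (by linarith)) (mul_nonneg ha hpA0))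
      (Finset.sum_nonneg fun m _ => hρ m), Finset.mul_sum]
  congr 1
  ring


/-! ### Expected contraction in one round. -/

variable {d M A b b' K : ℕ} {Ξ : Type*} [MeasurableSpace Ξ] {f : Fin M → Model d → Ξ → ℝ}
  {D : Fin M → Dataset Ξ} {L Lσ V : ℝ}

/-- Expected Lyapunov function after the minibatches of the miners have been drawn. -/
theorem lintegral_lyapunov_minibatches_le (hP : BatchModel f D L Lσ V b b') (hM : 0 < M)
    (hL : 0 < L) {ηl ηs Fstar lam β : ℝ} (hη : 0 < ηl) (hηs : 0 ≤ ηs)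
    (hK : 24 * (K * L * ηl) ^ 2 = 1) (hKσ : 2 * Lσ ^ 2 ≤ K * L ^ 2)
    (hF : ∀ x, Fstar ≤ globalLoss f D x) (hlam : 0 ≤ lam) (hβ : 0 < β) (z : Tracked d M)
    {u g : Model d} (hu : u = gradient (globalLoss f D) z.1.1)
    (hg : g = (M : ℝ)⁻¹ • ∑ i, z.1.2 i) {W : ℝ}
    (hW : W = globalLoss f D z.1.1 - Fstar - ηs * (K * ηl) * inner ℝ u g
      + ηs * (K * ηl) * (‖u‖ * (‖g‖ / 3))
      + (L / 2 + lam * (1 + β⁻¹)) * ((ηs * (K * ηl)) ^ 2 * (8 / 3 * ‖g‖ ^ 2))) :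
    0 ≤ W ∧ ∀ (s : Finset (Fin M) × (Fin M → Bool)) (B : Fin M → Fin b → Ξ),
    ∫⁻ B', ENNReal.ofReal (lyapunov f D Fstar lam (trackedStep f ηl ηs z (s.1, s.2, B, B')))
        ∂(Measure.pi fun i : Fin M => Measure.pi fun _ : Fin K => (D i).batchLaw b')
      ≤ (if (s.1.filter fun i => s.2 i = false).Nonempty then ENNReal.ofReal W
        else ENNReal.ofReal (globalLoss f D z.1.1 - Fstar))
      + ∑ m, if m ∈ s.1.filter (fun i => s.2 i = true) then 0
        else ENNReal.ofReal (lam * (1 + β) * (M : ℝ)⁻¹ * ‖z.2 m - z.1.1‖ ^ 2) := by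
  have := hP.prob_small
  -- The quadratic upper bound at the moved point dominates F there, hence F_*. Nonnegativity for
  -- every y keeps `ENNReal.ofReal` from truncating.
  have hnn : ∀ y : Model d, 0 ≤ globalLoss f D z.1.1 - Fstar - ηs * inner ℝ u y
      + (L / 2 + lam * (1 + β⁻¹)) * (ηs ^ 2 * ‖y‖ ^ 2) := by
    intro y
    have h := le_quadratic_of_lipschitz_gradient (differentiable_globalLoss hP.lsmooth)
      (globalLoss_lipschitz hM hP.lsmooth) z.1.1 (z.1.1 - ηs • y)
    rw [sub_sub_cancel_left, inner_neg_right, norm_neg, ← hu, inner_smul_right, norm_smul,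
      Real.norm_of_nonneg hηs, mul_pow] at h
    have h2 := hF (z.1.1 - ηs • y)
    have h3 : 0 ≤ lam * (1 + β⁻¹) * (ηs ^ 2 * ‖y‖ ^ 2) := by positivity
    linarith
  have hκ : 0 ≤ L / 2 + lam * (1 + β⁻¹) := by positivity
  have hminer := fun i => lintegral_miner_le hP hL hη hηs hK hKσ i z.1.1 g u
    (globalLoss f D z.1.1 - Fstar) (L / 2 + lam * (1 + β⁻¹)) hκ hnn
  simp only [← hW] at hminer
  refine ⟨(hminer ⟨0, hM⟩).1, fun s B => ?_⟩
  have hc : ∀ m, 0 ≤ lam * (1 + β) * (M : ℝ)⁻¹ * ‖z.2 m - z.1.1‖ ^ 2 := fun m => by positivity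
  by_cases hs : (s.1.filter fun i => s.2 i = false).Nonempty
  · rw [if_pos hs]
    set m := s.1.filter fun i => s.2 i = false with hm
    have hmpos : (0 : ℝ) < m.card := by exact_mod_cast hs.card_pos
    let ψ : Fin M → (Fin K → Fin b' → Ξ) → ℝ≥0∞ := fun i B' => ENNReal.ofReal
      (globalLoss f D z.1.1 - Fstar - ηs * inner ℝ u (localChange (f i) ηl B' z.1.1 g)
        + (L / 2 + lam * (1 + β⁻¹)) * (ηs ^ 2 * ‖localChange (f i) ηl B' z.1.1 g‖ ^ 2))
    have hψ : ∀ i, Measurable (ψ i) := by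
      intro i
      have h : Measurable fun B' : Fin K → Fin b' → Ξ => localChange (f i) ηl B' z.1.1 g :=
        (measurable_localChange (hP.unbiased_small i).measurable).comp
          (measurable_prodMk_right (y := (z.1.1, g)))
      exact ((measurable_const.sub ((h.const_inner (c := u)).const_mul ηs)).add
        (((h.norm.pow_const 2).const_mul _).const_mul _)).ennreal_ofReal
    have hψi : ∀ i, Measurable fun B' : Fin M → Fin K → Fin b' → Ξ =>
        ENNReal.ofReal ((m.card : ℝ)⁻¹) * ψ i (B' i) := fun i =>
      ((hψ i).comp (measurable_pi_apply i)).const_mul _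
    calc ∫⁻ B', ENNReal.ofReal (lyapunov f D Fstar lam (trackedStep f ηl ηs z (s.1, s.2, B, B')))
        ∂(Measure.pi fun i : Fin M => Measure.pi fun _ : Fin K => (D i).batchLaw b')
        ≤ ∫⁻ B', (∑ i ∈ m, ENNReal.ofReal ((m.card : ℝ)⁻¹) * ψ i (B' i)
          + ∑ m, if m ∈ s.1.filter (fun i => s.2 i = true) then 0
            else ENNReal.ofReal (lam * (1 + β) * (M : ℝ)⁻¹ * ‖z.2 m - z.1.1‖ ^ 2))
          ∂(Measure.pi fun i : Fin M => Measure.pi fun _ : Fin K => (D i).batchLaw b') := by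
          refine lintegral_mono fun B' => ?_
          have h := lyapunov_step_le (ηl := ηl) (ηs := ηs) (Fstar := Fstar) hM hL.le hP.lsmooth
            hlam hβ z (s.1, s.2, B, B') hs
          refine (ENNReal.ofReal_le_ofReal h).trans (ENNReal.ofReal_add_le.trans ?_)
          refine add_le_add ?_ ?_
          · rw [← Finset.mul_sum, ENNReal.ofReal_mul (by positivity)]
            refine mul_le_mul' le_rfl ?_
            rw [← hu, ← hg, ENNReal.ofReal_sum_of_nonneg fun i _ => hnn _]
            exact le_rfl
          · rw [ENNReal.ofReal_sum_of_nonneg fun i _ => by split_ifs; exacts [le_rfl, hc i]]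
            refine Finset.sum_le_sum fun i _ => le_of_eq ?_
            rw [apply_ite ENNReal.ofReal, ENNReal.ofReal_zero]
            rfl
      _ ≤ _ := by
          rw [lintegral_add_right _ measurable_const, lintegral_const, measure_univ, mul_one,
            lintegral_finsetSum _ fun i _ => hψi i]
          refine add_le_add ?_ le_rfl
          have h1 : ∀ i ∈ m, ∫⁻ B' : Fin M → Fin K → Fin b' → Ξ,
              ENNReal.ofReal ((m.card : ℝ)⁻¹) * ψ i (B' i)
              ∂(Measure.pi fun i : Fin M => Measure.pi fun _ : Fin K => (D i).batchLaw b')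
              ≤ ENNReal.ofReal ((m.card : ℝ)⁻¹) * ENNReal.ofReal W := by
            intro i _
            rw [lintegral_const_mul' _ _ ENNReal.ofReal_ne_top, lintegral_pi_eval
              (fun i : Fin M => Measure.pi fun _ : Fin K => (D i).batchLaw b') i (hψ i)]
            exact mul_le_mul' le_rfl (hminer i).2
          refine (Finset.sum_le_sum h1).trans_eq ?_
          rw [Finset.sum_const, nsmul_eq_mul, ← mul_assoc, ← ENNReal.ofReal_natCast,
            ← ENNReal.ofReal_mul hmpos.le, mul_inv_cancel₀ hmpos.ne', ENNReal.ofReal_one, one_mul]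
  -- The factor 1 + β is superfluous when nothing moves; it is granted so that both cases share one
  -- staleness term.
  · rw [if_neg hs]
    have hstep : ∀ B' : Fin M → Fin K → Fin b' → Ξ, ENNReal.ofReal
        (lyapunov f D Fstar lam (trackedStep f ηl ηs z (s.1, s.2, B, B')))
        ≤ ENNReal.ofReal (globalLoss f D z.1.1 - Fstar)
      + ∑ m, if m ∈ s.1.filter (fun i => s.2 i = true) then 0
        else ENNReal.ofReal (lam * (1 + β) * (M : ℝ)⁻¹ * ‖z.2 m - z.1.1‖ ^ 2) := by
      intro B'
      rw [lyapunov_step_eq_of_no_miner z ((s.1, s.2, B, B') : RoundSeed M b b' K Ξ) hs]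
      refine ENNReal.ofReal_add_le.trans (add_le_add le_rfl ?_)
      rw [ENNReal.ofReal_sum_of_nonneg fun i _ => by split_ifs; exacts [le_rfl, by positivity]]
      refine Finset.sum_le_sum fun i _ => ?_
      rw [apply_ite ENNReal.ofReal, ENNReal.ofReal_zero]
      change (if i ∈ s.1.filter (fun i => s.2 i = true) then _ else _) ≤ _
      split_ifs
      · exact le_rfl
      · refine ENNReal.ofReal_le_ofReal ?_
        gcongr
        have : 0 ≤ lam * β := by positivity
        linarith
    refine (lintegral_mono hstep).trans_eq ?_
    simp

theorem measurable_lyapunov (h : LSmooth f D L) (Fstar lam : ℝ) :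
    Measurable (lyapunov f D Fstar lam) := by
  have hx : Measurable fun z : Tracked d M => z.1.1 := measurable_fst.fst
  have hy : ∀ i, Measurable fun z : Tracked d M => z.2 i :=
    fun i => (measurable_pi_apply i).comp measurable_snd
  have hFm := (differentiable_globalLoss h).continuous.measurable
  have hs : Measurable fun z : Tracked d M => ∑ i, ‖z.2 i - z.1.1‖ ^ 2 :=
    Finset.measurable_sum _ fun i _ => ((hy i).sub hx).norm.pow_const 2
  exact ((hFm.comp hx).sub_const _).add ((hs.const_mul _).const_mul _)

/-- One round contracts the Lyapunov function in expectation, up to the sampling error of the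
caching gradients. -/
theorem lintegral_lyapunov_step_le (hP : BatchModel f D L Lσ V b b') (hA1 : 1 ≤ A) (hA : A ≤ M)
    (hL : 0 < L) {ηl ηs Fstar μ η p : ℝ} (hηl : 0 < ηl) (hηs : 0 < ηs)
    (hK : 24 * (K * L * ηl) ^ 2 = 1) (hKσ : 2 * Lσ ^ 2 ≤ K * L ^ 2) (hη : η = ηs * (K * ηl))
    (hη0 : 0 < η) (hF : ∀ x, Fstar ≤ globalLoss f D x) (hμ : 0 < μ)
    (hPL : PL (globalLoss f D) Fstar μ) (hp : 0 < p) (hp1 : p ≤ 1) (hLη : L * η ≤ 1 / 33)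
    (hLρ : L * η ≤ p * A / M / 16) (hμρ : μ * η ≤ p * A / M / 16) (z : Tracked d M) :
    ∫⁻ r, ENNReal.ofReal (lyapunov f D Fstar (6 * η * (1 - p ^ A) * L ^ 2 / (p * A / M))
        (trackedStep f ηl ηs z r)) ∂roundLaw D A p b b' K
      ≤ ENNReal.ofReal ((1 - 3 / 4 * η * (1 - p ^ A) * μ)
          * lyapunov f D Fstar (6 * η * (1 - p ^ A) * L ^ 2 / (p * A / M)) z
        + 5 / 8 * η * (1 - p ^ A) * ‖(M : ℝ)⁻¹ • ∑ i, cacheNoise f D z i‖ ^ 2) := by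
  have hM : 0 < M := hA1.trans hA
  have hM' : (0 : ℝ) < M := by exact_mod_cast hM
  have hA' : (0 : ℝ) < A := by exact_mod_cast hA1
  have hAM : (A : ℝ) / M ≤ 1 := div_le_one_of_le₀ (by exact_mod_cast hA) hM'.le
  have := hP.prob_large
  have := hP.prob_small
  set ρ := p * A / M with hρ
  have hρ0 : 0 < ρ := by positivity
  have hρ1 : ρ ≤ 1 := by
    rw [hρ, mul_div_assoc]; exact mul_le_one₀ hp1 (by positivity) hAM
  set q := 1 - p ^ A with hq
  have hq0 : 0 ≤ q := sub_nonneg.2 (pow_le_one₀ hp.le hp1)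
  have hq1 : q ≤ 1 := by rw [hq]; have : 0 ≤ p ^ A := by positivity
                         linarith
  set lam := 6 * η * q * L ^ 2 / ρ with hlam
  have hlam0 : 0 ≤ lam := by positivity
  -- Taking β = ρ/2 makes the staleness growth cost half of the gain from resetting with probability
  -- ρ.
  obtain ⟨hW0, hmini⟩ := lintegral_lyapunov_minibatches_le hP hM hL hηl hηs.le hK hKσ hF hlam0
    (half_pos hρ0) z rfl rfl rfl
  rw [← hη] at hW0 hmini
  have hmeas : Measurable fun r : RoundSeed M b b' K Ξ =>
      ENNReal.ofReal (lyapunov f D Fstar lam (trackedStep f ηl ηs z r)) := by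
    have hs := (measurable_trackedStep (fun i => (hP.unbiased_large i).measurable)
      (fun i => (hP.unbiased_small i).measurable) ηl ηs (K := K)).comp
      (measurable_prodMk_left (x := z))
    exact ((measurable_lyapunov hP.lsmooth Fstar lam).comp hs).ennreal_ofReal
  rw [lintegral_roundLaw hP hp.le hp1 hA hmeas]
  refine (lintegral_mono fun s => (lintegral_mono fun B => hmini s B).trans_eq
    (by rw [lintegral_const, measure_univ, mul_one])).trans ?_
  rw [lintegral_selection hp.le hp1 hA hW0 (sub_nonneg.2 (hF _)) (fun m => by positivity)]
  refine ENNReal.ofReal_le_ofReal ?_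
  -- The miners' guide is the true gradient, plus the sampling error of the cache, plus the drift
  -- from anchoring at old points.
  have hDsum : (M : ℝ)⁻¹ • ∑ i, z.1.2 i = gradient (globalLoss f D) z.1.1
      + ((M : ℝ)⁻¹ • ∑ i, cacheNoise f D z i + (M : ℝ)⁻¹ • ∑ i,
        (gradient (localLoss (f i) (D i)) (z.2 i) - gradient (localLoss (f i) (D i)) z.1.1)) := by
    rw [gradient_globalLoss hP.lsmooth, ← smul_add, ← smul_add, ← Finset.sum_add_distrib,
      ← Finset.sum_add_distrib]
    congr 1
    refine Finset.sum_congr rfl fun i _ => ?_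
    rw [cacheNoise]; abel
  have hD : ‖(M : ℝ)⁻¹ • ∑ i,
      (gradient (localLoss (f i) (D i)) (z.2 i) - gradient (localLoss (f i) (D i)) z.1.1)‖ ^ 2
      ≤ L ^ 2 * ((M : ℝ)⁻¹ * ∑ i, ‖z.2 i - z.1.1‖ ^ 2) := by
    have h := norm_avg_sq_le (Finset.univ : Finset (Fin M)) fun i =>
      gradient (localLoss (f i) (D i)) (z.2 i) - gradient (localLoss (f i) (D i)) z.1.1
    rw [Finset.card_univ, Fintype.card_fin] at h
    refine h.trans ?_
    rw [mul_left_comm]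
    refine mul_le_mul_of_nonneg_left ?_ (by positivity)
    rw [Finset.mul_sum]
    refine Finset.sum_le_sum fun i _ => ?_
    rw [← mul_pow]
    gcongr
    exact (hP.lsmooth i).2 _ _
  have hmain := lyapunov_contraction (E := Model d) hL hμ hη0 hρ0 hρ1 hq0 hq1 hLη hLρ hμρ
    (hPL z.1.1) (Y := (M : ℝ)⁻¹ * ∑ i, ‖z.2 i - z.1.1‖ ^ 2) (by positivity) hDsum hD
  refine le_trans (le_of_eq ?_) hmain
  have e : p ^ A = 1 - q := by rw [hq]; ring
  rw [e]
  simp only [← Finset.mul_sum]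
  ring


/-! ### Sampling error of the cache and the whole trajectory. -/

variable {d M A b b' K : ℕ} {Ξ : Type*} [MeasurableSpace Ξ] {f : Fin M → Model d → Ξ → ℝ}
  {D : Fin M → Dataset Ξ} {L Lσ V : ℝ}

theorem IsUnbiased.measurable_apply {Ω : Type*} [MeasurableSpace Ω] {Q : Measure Ω}
    {G : Ω → Model d → Model d} {g : Model d → Model d} (h : IsUnbiased Q G g) (v : Model d) :
    Measurable fun ω => G ω v :=
  h.measurable.comp (measurable_prodMk_right (y := v))

theorem measurable_cacheNoise (h : LSmooth f D L) (hL : 0 < L) (i : Fin M) :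
    Measurable fun z : Tracked d M => cacheNoise f D z i := by
  have hv : Measurable fun z : Tracked d M => z.1.2 i :=
    (measurable_pi_apply i).comp measurable_fst.snd
  have hy : Measurable fun z : Tracked d M => z.2 i := (measurable_pi_apply i).comp measurable_snd
  exact hv.sub ((continuous_gradient_localLoss h hL i).measurable.comp hy)

/-- A client that is no anchor keeps both its cached gradient and its anchoring point, so its error
is carried over unchanged; an anchor's error is entirely fresh. -/
theorem sum_cacheNoise_trackedStep {ηl ηs : ℝ} (z : Tracked d M) (r : RoundSeed M b b' K Ξ)
    (S : Finset (Fin M)) :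
    ∑ i ∈ S, cacheNoise f D (trackedStep f ηl ηs z r) i
      = ∑ i ∈ S with i ∉ anchors r, cacheNoise f D z i
        + ∑ i ∈ S with i ∈ anchors r, (batchGrad (f i) (r.2.2.1 i) z.1.1
          - gradient (localLoss (f i) (D i)) z.1.1) := by
  rw [← Finset.sum_filter_add_sum_filter_not S (fun i => i ∈ anchors r), add_comm]
  congr 1
  · refine Finset.sum_congr rfl fun i hi => ?_
    have hi' := (Finset.mem_filter.1 hi).2
    simp only [cacheNoise, trackedStep, roundStep, if_neg hi']
  · refine Finset.sum_congr rfl fun i hi => ?_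
    have hi' := (Finset.mem_filter.1 hi).2
    simp only [cacheNoise, trackedStep, roundStep, if_pos hi']

/-- The total sampling error of fresh caching gradients adds at most `V` per client. -/
theorem lintegral_fresh_noise_le (hP : BatchModel f D L Lσ V b b') (x c : Model d)
    (S : Finset (Fin M)) :
    ∫⁻ B, ENNReal.ofReal (‖c + ∑ i ∈ S, (batchGrad (f i) (B i) x
        - gradient (localLoss (f i) (D i)) x)‖ ^ 2) ∂(Measure.pi fun i => (D i).batchLaw b)
      ≤ ENNReal.ofReal (‖c‖ ^ 2) + S.card * ENNReal.ofReal V := by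
  have := hP.prob_large
  have hm : ∀ i, Measurable fun B : Fin b → Ξ => batchGrad (f i) B x := fun i =>
    (hP.unbiased_large i).measurable_apply x
  refine (lintegral_pi_norm_add_sum_sq_le (fun i => (D i).batchLaw b)
    (ξ := fun i B => batchGrad (f i) B x - gradient (localLoss (f i) (D i)) x)
    (fun i => (hm i).sub_const _)
    (fun i => ((hP.unbiased_large i).integrable x).sub (integrable_const _)) (fun i => ?_)
    (V := fun _ => ENNReal.ofReal V) (fun i => hP.noise i x) c S).trans_eq ?_
  · rw [integral_sub ((hP.unbiased_large i).integrable x) (integrable_const _),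
      (hP.unbiased_large i).integral_eq]
    simp
  · rw [Finset.sum_const, nsmul_eq_mul]

section Trajectory

variable {p ηl ηs : ℝ} {x₀ : Model d}

theorem measurable_trackedRun_init (hP : BatchModel f D L Lσ V b b') (ηl ηs : ℝ) (x₀ : Model d)
    (t : ℕ) : Measurable fun ω : Seed M b b' K Ξ =>
      trackedRun f ηl ηs (trackedInit f x₀ ω.1) ω.2 t := by
  have hinit : Measurable fun B : Fin M → Fin b → Ξ => trackedInit f x₀ B := by
    have h : ∀ i, Measurable fun B : Fin M → Fin b → Ξ => batchGrad (f i) (B i) x₀ := fun i =>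
      Measurable.comp (g := fun q : (Fin b → Ξ) × Model d => batchGrad (f i) q.1 q.2)
        (f := fun B : Fin M → Fin b → Ξ => (B i, x₀)) (hP.unbiased_large i).measurable
        ((measurable_pi_apply i).prodMk measurable_const)
    exact (measurable_const.prodMk (measurable_pi_lambda _ h)).prodMk measurable_const
  exact (measurable_trackedRun (fun i => (hP.unbiased_large i).measurable)
    (fun i => (hP.unbiased_small i).measurable) ηl ηs t).comp
    ((hinit.comp measurable_fst).prodMk measurable_snd)

set_option maxHeartbeats 800000 in
/-- Markov property of the tracked run. -/
theorem lintegral_trackedRun_succ (hP : BatchModel f D L Lσ V b b') (h0 : 0 ≤ p) (h1 : p ≤ 1)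
    (hA : A ≤ M) {φ : Tracked d M → ℝ≥0∞} (hφ : Measurable φ) (t : ℕ) :
    ∫⁻ ω, φ (trackedRun f ηl ηs (trackedInit f x₀ ω.1) ω.2 (t + 1)) ∂seedLaw D A p b b' K
      = ∫⁻ ω, ∫⁻ r, φ (trackedStep f ηl ηs (trackedRun f ηl ηs (trackedInit f x₀ ω.1) ω.2 t) r)
          ∂roundLaw D A p b b' K ∂seedLaw D A p b b' K := by
  have := isProbabilityMeasure_roundLaw (K := K) hP h0 h1 hA
  have := hP.prob_large
  have hrun := measurable_trackedRun_init (K := K) hP ηl ηs x₀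
  have hstep := measurable_trackedStep (K := K) (fun i => (hP.unbiased_large i).measurable)
    (fun i => (hP.unbiased_small i).measurable) ηl ηs
  have hm1 : Measurable fun ω : Seed M b b' K Ξ =>
      φ (trackedRun f ηl ηs (trackedInit f x₀ ω.1) ω.2 (t + 1)) := hφ.comp (hrun (t + 1))
  have hm2 : Measurable fun q : Seed M b b' K Ξ × RoundSeed M b b' K Ξ =>
      φ (trackedStep f ηl ηs (trackedRun f ηl ηs (trackedInit f x₀ q.1.1) q.1.2 t) q.2) :=
    hφ.comp (hstep.comp (((hrun t).comp measurable_fst).prodMk measurable_snd))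
  rw [seedLaw, lintegral_prod _ hm1.aemeasurable,
    lintegral_prod _ hm2.lintegral_prod_right'.aemeasurable]
  refine lintegral_congr fun B => ?_
  have hm3 : Measurable fun ρ : ℕ → RoundSeed M b b' K Ξ =>
      φ (trackedRun f ηl ηs (trackedInit f x₀ B) ρ (t + 1)) :=
    Measurable.comp (g := fun ω : Seed M b b' K Ξ =>
      φ (trackedRun f ηl ηs (trackedInit f x₀ ω.1) ω.2 (t + 1)))
      (f := fun ρ => (B, ρ)) hm1 measurable_prodMk_left
  -- Seed t is resampled: the state before round t ignores it, and round t uses nothing else.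
  rw [lintegral_infinitePi_resample (fun _ : ℕ => roundLaw D A p b b' K) t hm3]
  refine lintegral_congr fun ρ => lintegral_congr fun r => ?_
  simp only [trackedRun, Function.update_self]
  rw [trackedRun_update _ _ _ _ _ le_rfl]

theorem isProbabilityMeasure_seedLaw (hP : BatchModel f D L Lσ V b b') (h0 : 0 ≤ p) (h1 : p ≤ 1)
    (hA : A ≤ M) : IsProbabilityMeasure (seedLaw D A p b b' K) := by
  have := isProbabilityMeasure_roundLaw (K := K) hP h0 h1 hA
  have := hP.prob_large
  unfold seedLaw
  infer_instance

/-- Sampling errors of the caching gradients of different clients never build up correlations. -/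
theorem lintegral_cacheNoise_le (hP : BatchModel f D L Lσ V b b') (hL : 0 < L) (h0 : 0 ≤ p)
    (h1 : p ≤ 1) (hA : A ≤ M) (t : ℕ) (S : Finset (Fin M)) :
    ∫⁻ ω, ENNReal.ofReal (‖∑ i ∈ S, cacheNoise f D
        (trackedRun f ηl ηs (trackedInit f x₀ ω.1) ω.2 t) i‖ ^ 2) ∂seedLaw D A p b b' K
      ≤ S.card * ENNReal.ofReal V := by
  have := isProbabilityMeasure_roundLaw (K := K) hP h0 h1 hA
  have := isProbabilityMeasure_seedLaw (K := K) hP h0 h1 hA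
  have := isProbabilityMeasure_coinLaw h0 h1
  have := isProbabilityMeasure_participants hA
  have := hP.prob_large
  have := hP.prob_small
  have hrun := measurable_trackedRun_init (K := K) hP ηl ηs x₀
  have hnoise : ∀ S : Finset (Fin M), Measurable fun z : Tracked d M =>
      ENNReal.ofReal (‖∑ i ∈ S, cacheNoise f D z i‖ ^ 2) := fun S =>
    ((Finset.measurable_sum _ fun i _ => measurable_cacheNoise hP.lsmooth hL i).norm.pow_const
      2).ennreal_ofReal
  -- All subsets are treated at once, because after conditioning on the anchors the hypothesis is
  -- needed for the clients of S that kept their caches.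
  induction t generalizing S with
  | zero =>
    have hm : Measurable fun ω : Seed M b b' K Ξ => ENNReal.ofReal (‖∑ i ∈ S, cacheNoise f D
        (trackedRun f ηl ηs (trackedInit f x₀ ω.1) ω.2 0) i‖ ^ 2) := (hnoise S).comp (hrun 0)
    rw [seedLaw, lintegral_prod _ hm.aemeasurable]
    simp only [trackedRun, trackedInit, cacheNoise, lintegral_const, measure_univ, mul_one]
    simpa using lintegral_fresh_noise_le hP x₀ 0 S
  | succ t ih =>
    rw [lintegral_trackedRun_succ hP h0 h1 hA (hnoise S)]
    set ν := (uniformOn {S : Finset (Fin M) | S.card = A}).prod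
      (Measure.pi fun _ : Fin M => coinLaw p)
    have hstep := measurable_trackedStep (K := K) (fun i => (hP.unbiased_large i).measurable)
      (fun i => (hP.unbiased_small i).measurable) ηl ηs
    have hz : ∀ z : Tracked d M, ∫⁻ r, ENNReal.ofReal (‖∑ i ∈ S, cacheNoise f D
        (trackedStep f ηl ηs z r) i‖ ^ 2) ∂roundLaw D A p b b' K
        ≤ ∫⁻ s, (ENNReal.ofReal (‖∑ i ∈ S with i ∉ s.1.filter (fun i => s.2 i = true),
            cacheNoise f D z i‖ ^ 2)
          + (S.filter fun i => i ∈ s.1.filter (fun i => s.2 i = true)).card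
            * ENNReal.ofReal V) ∂ν := by
      intro z
      have hm : Measurable fun r : RoundSeed M b b' K Ξ => ENNReal.ofReal
          (‖∑ i ∈ S, cacheNoise f D (trackedStep f ηl ηs z r) i‖ ^ 2) :=
        (hnoise S).comp (hstep.comp (measurable_prodMk_left (x := z)))
      rw [lintegral_roundLaw hP h0 h1 hA hm]
      refine lintegral_mono fun s => ?_
      refine le_trans (le_of_eq ?_) (lintegral_fresh_noise_le hP z.1.1
        (∑ i ∈ S with i ∉ s.1.filter (fun i => s.2 i = true), cacheNoise f D z i)
        (S.filter fun i => i ∈ s.1.filter (fun i => s.2 i = true)))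
      refine lintegral_congr fun B => ?_
      have hB' : ∀ B' : Fin M → Fin K → Fin b' → Ξ, ENNReal.ofReal
          (‖∑ i ∈ S, cacheNoise f D (trackedStep f ηl ηs z (s.1, s.2, B, B')) i‖ ^ 2)
          = ENNReal.ofReal (‖∑ i ∈ S with i ∉ s.1.filter (fun i => s.2 i = true),
              cacheNoise f D z i
            + ∑ i ∈ S with i ∈ s.1.filter (fun i => s.2 i = true), (batchGrad (f i) (B i) z.1.1
              - gradient (localLoss (f i) (D i)) z.1.1)‖ ^ 2) := by
        intro B'
        rw [sum_cacheNoise_trackedStep]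
        rfl
      simp only [hB', lintegral_const, measure_univ, mul_one]
    refine (lintegral_mono fun ω => hz _).trans ?_
    -- The selection is independent of the past, so it may be frozen while the past is averaged:
    -- kept clients contribute V each by induction, refreshed ones V each by independence.
    rw [lintegral_lintegral_swap]
    · have hs : ∀ s : Finset (Fin M) × (Fin M → Bool), ∫⁻ ω, (ENNReal.ofReal
            (‖∑ i ∈ S with i ∉ s.1.filter (fun i => s.2 i = true), cacheNoise f D
              (trackedRun f ηl ηs (trackedInit f x₀ ω.1) ω.2 t) i‖ ^ 2)
          + (S.filter fun i => i ∈ s.1.filter (fun i => s.2 i = true)).card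
            * ENNReal.ofReal V) ∂seedLaw D A p b b' K ≤ S.card * ENNReal.ofReal V := by
        intro s
        have hm : Measurable fun ω : Seed M b b' K Ξ => ENNReal.ofReal
            (‖∑ i ∈ S with i ∉ s.1.filter (fun i => s.2 i = true), cacheNoise f D
              (trackedRun f ηl ηs (trackedInit f x₀ ω.1) ω.2 t) i‖ ^ 2) :=
          (hnoise _).comp (hrun t)
        rw [lintegral_add_left hm, lintegral_const, measure_univ, mul_one]
        refine (add_le_add (ih _) le_rfl).trans_eq ?_
        rw [← add_mul, ← Nat.cast_add, add_comm, Finset.card_filter_add_card_filter_not]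
      refine (lintegral_mono hs).trans_eq ?_
      rw [lintegral_const, measure_univ, mul_one]
    · refine Measurable.aemeasurable ?_
      refine measurable_from_prod_countable_left fun s => ?_
      have hm : Measurable fun ω : Seed M b b' K Ξ => ENNReal.ofReal
          (‖∑ i ∈ S with i ∉ s.1.filter (fun i => s.2 i = true), cacheNoise f D
            (trackedRun f ηl ηs (trackedInit f x₀ ω.1) ω.2 t) i‖ ^ 2) :=
        (hnoise _).comp (hrun t)
      simp only [Function.uncurry_apply_pair]
      exact hm.add_const _

omit [MeasurableSpace Ξ] in
-- Nonnegativity lets the factor serve as a weight in the recursion and be raised to powers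
-- monotonically.
theorem contraction_factor_nonneg (hA : A ≤ M) {μ η : ℝ} (hp : 0 ≤ p) (hp1 : p ≤ 1) (hη0 : 0 ≤ η)
    (hμ : 0 ≤ μ) (hμρ : μ * η ≤ p * A / M / 16) : 0 ≤ 1 - 3 / 4 * η * (1 - p ^ A) * μ := by
  have hAM : (A : ℝ) / M ≤ 1 := div_le_one_of_le₀ (by exact_mod_cast hA) (by positivity)
  have hρ1 : p * A / M ≤ 1 := by
    rw [mul_div_assoc]; exact mul_le_one₀ hp1 (by positivity) hAM
  have hpA : 0 ≤ p ^ A := by positivity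
  have hpA1 := pow_le_one₀ (n := A) hp hp1
  have : (1 - p ^ A) * (μ * η) ≤ 1 * (1 / 16) :=
    mul_le_mul (by linarith) (by linarith) (by positivity) zero_le_one
  linarith

/-- Convergence of the algorithm, with explicit constants. -/
theorem lintegral_lyapunov_le (hP : BatchModel f D L Lσ V b b') (hV : 0 ≤ V) (hA1 : 1 ≤ A)
    (hA : A ≤ M) (hL : 0 < L) {Fstar μ η : ℝ} (hηl : 0 < ηl) (hηs : 0 < ηs)
    (hK : 24 * (K * L * ηl) ^ 2 = 1) (hKσ : 2 * Lσ ^ 2 ≤ K * L ^ 2) (hη : η = ηs * (K * ηl))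
    (hη0 : 0 < η) (hF : ∀ x, Fstar ≤ globalLoss f D x) (hμ : 0 < μ)
    (hPL : PL (globalLoss f D) Fstar μ) (hp : 0 < p) (hp1 : p ≤ 1) (hLη : L * η ≤ 1 / 33)
    (hLρ : L * η ≤ p * A / M / 16) (hμρ : μ * η ≤ p * A / M / 16) (t : ℕ) :
    ∫⁻ ω, ENNReal.ofReal (lyapunov f D Fstar (6 * η * (1 - p ^ A) * L ^ 2 / (p * A / M))
        (trackedRun f ηl ηs (trackedInit f x₀ ω.1) ω.2 t)) ∂seedLaw D A p b b' K
      ≤ ENNReal.ofReal ((1 - 3 / 4 * η * (1 - p ^ A) * μ) ^ t * (globalLoss f D x₀ - Fstar)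
        + 5 / 6 * (V / (M * μ))) := by
  have := isProbabilityMeasure_seedLaw (K := K) hP hp.le hp1 hA
  have hM' : (0 : ℝ) < M := by exact_mod_cast hA1.trans hA
  have hγ := contraction_factor_nonneg hA hp.le hp1 hη0.le hμ.le hμρ
  set q := 1 - p ^ A with hq
  have hq0 : 0 ≤ q := sub_nonneg.2 (pow_le_one₀ hp.le hp1)
  have ha : 0 ≤ globalLoss f D x₀ - Fstar := sub_nonneg.2 (hF _)
  have hlmeas := measurable_lyapunov hP.lsmooth Fstar (6 * η * q * L ^ 2 / (p * A / M))
  have hrun := measurable_trackedRun_init (K := K) hP ηl ηs x₀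
  induction t with
  -- All caches start anchored at x₀, so the initial staleness is zero.
  | zero =>
    have h : ∀ ω : Seed M b b' K Ξ, lyapunov f D Fstar (6 * η * q * L ^ 2 / (p * A / M))
        (trackedRun f ηl ηs (trackedInit f x₀ ω.1) ω.2 0) = globalLoss f D x₀ - Fstar := by
      intro ω
      simp [lyapunov, trackedRun, trackedInit]
    simp only [h, lintegral_const, measure_univ, mul_one, pow_zero, one_mul]
    refine ENNReal.ofReal_le_ofReal ?_
    have : 0 ≤ 5 / 6 * (V / (M * μ)) := by positivity
    linarith
  | succ t ih =>
    rw [lintegral_trackedRun_succ hP hp.le hp1 hA hlmeas.ennreal_ofReal]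
    refine (lintegral_mono fun ω => lintegral_lyapunov_step_le hP hA1 hA hL hηl hηs hK hKσ hη hη0
      hF hμ hPL hp hp1 hLη hLρ hμρ _).trans ?_
    have hN : ∫⁻ ω, ENNReal.ofReal (‖(M : ℝ)⁻¹ • ∑ i, cacheNoise f D
        (trackedRun f ηl ηs (trackedInit f x₀ ω.1) ω.2 t) i‖ ^ 2) ∂seedLaw D A p b b' K
        ≤ ENNReal.ofReal (V / M) := by
      have h := lintegral_cacheNoise_le (K := K) (ηl := ηl) (ηs := ηs) (x₀ := x₀) hP hL hp.le hp1
        hA t Finset.univ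
      rw [Finset.card_univ, Fintype.card_fin, ← ENNReal.ofReal_natCast,
        ← ENNReal.ofReal_mul (by positivity)] at h
      simp only [norm_smul, mul_pow, ENNReal.ofReal_mul (sq_nonneg ‖(M : ℝ)⁻¹‖)]
      rw [lintegral_const_mul' _ _ ENNReal.ofReal_ne_top]
      refine (mul_le_mul' le_rfl h).trans_eq ?_
      rw [← ENNReal.ofReal_mul (sq_nonneg _), Real.norm_of_nonneg (by positivity)]
      congr 1
      field_simp
    -- The constant 5/6 = (5/8)/(3/4) makes the noise floor a fixed point of the recursion.
    refine (lintegral_ofReal_le_combination (w₁ := 1 - 3 / 4 * η * q * μ) (w₂ := 5 / 8 * η * q)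
      hγ (by positivity) (fun ω => le_rfl) (hlmeas.comp (hrun t)) ?_ (by positivity) ih hN).trans
      (ENNReal.ofReal_le_ofReal (le_of_eq ?_))
    · positivity
    · field_simp
      ring

/-- The staleness term is nonnegative, so Φ dominates the suboptimality; finiteness of its
expectation also gives integrability of the loss. -/
theorem expected_suboptimality_le (hP : BatchModel f D L Lσ V b b') (hV : 0 ≤ V) (hA1 : 1 ≤ A)
    (hA : A ≤ M) (hL : 0 < L) {Fstar μ η : ℝ} (hηl : 0 < ηl) (hηs : 0 < ηs)
    (hK : 24 * (K * L * ηl) ^ 2 = 1) (hKσ : 2 * Lσ ^ 2 ≤ K * L ^ 2) (hη : η = ηs * (K * ηl))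
    (hη0 : 0 < η) (hF : ∀ x, Fstar ≤ globalLoss f D x) (hμ : 0 < μ)
    (hPL : PL (globalLoss f D) Fstar μ) (hp : 0 < p) (hp1 : p ≤ 1) (hLη : L * η ≤ 1 / 33)
    (hLρ : L * η ≤ p * A / M / 16) (hμρ : μ * η ≤ p * A / M / 16) (t : ℕ) :
    Integrable (fun ω => globalLoss f D (run f ηl ηs x₀ ω t).1) (seedLaw D A p b b' K) ∧
    ∫ ω, globalLoss f D (run f ηl ηs x₀ ω t).1 ∂seedLaw D A p b b' K - Fstar
      ≤ (1 - 3 / 4 * η * (1 - p ^ A) * μ) ^ t * (globalLoss f D x₀ - Fstar)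
        + 5 / 6 * (V / (M * μ)) := by
  have := isProbabilityMeasure_seedLaw (K := K) hP hp.le hp1 hA
  have hlyap := lintegral_lyapunov_le (K := K) (x₀ := x₀) hP hV hA1 hA hL hηl hηs hK hKσ hη hη0 hF
    hμ hPL hp hp1 hLη hLρ hμρ t
  set c := (1 - 3 / 4 * η * (1 - p ^ A) * μ) ^ t * (globalLoss f D x₀ - Fstar)
        + 5 / 6 * (V / (M * μ)) with hc
  have hq0 : 0 ≤ 1 - p ^ A := sub_nonneg.2 (pow_le_one₀ hp.le hp1)
  have hle : ∫⁻ ω, ENNReal.ofReal (globalLoss f D (run f ηl ηs x₀ ω t).1 - Fstar)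
      ∂seedLaw D A p b b' K ≤ ENNReal.ofReal c := by
    refine le_trans (lintegral_mono fun ω => ENNReal.ofReal_le_ofReal ?_) hlyap
    rw [lyapunov, trackedRun_fst]
    refine le_add_of_nonneg_right ?_
    positivity
  have hm : Measurable fun ω : Seed M b b' K Ξ =>
      globalLoss f D (run f ηl ηs x₀ ω t).1 - Fstar := by
    have hx : Measurable fun ω : Seed M b b' K Ξ => (run f ηl ηs x₀ ω t).1 := by
      simp only [← trackedRun_fst]
      exact (measurable_trackedRun_init (K := K) hP ηl ηs x₀ t).fst.fst
    exact ((differentiable_globalLoss hP.lsmooth).continuous.measurable.comp hx).sub_const _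
  have hnn : ∀ ω : Seed M b b' K Ξ, 0 ≤ globalLoss f D (run f ηl ηs x₀ ω t).1 - Fstar :=
    fun ω => sub_nonneg.2 (hF _)
  have hi : Integrable (fun ω => globalLoss f D (run f ηl ηs x₀ ω t).1 - Fstar)
      (seedLaw D A p b b' K) := by
    refine ⟨hm.aestronglyMeasurable, ?_⟩
    rw [hasFiniteIntegral_iff_ofReal (Filter.Eventually.of_forall hnn)]
    exact hle.trans_lt ENNReal.ofReal_lt_top
  have hi' : Integrable (fun ω => globalLoss f D (run f ηl ηs x₀ ω t).1)
      (seedLaw D A p b b' K) := by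
    have := Integrable.add hi (integrable_const Fstar)
    refine this.congr (Filter.Eventually.of_forall fun ω => ?_)
    simp
  refine ⟨hi', ?_⟩
  have hval : ∫ ω, (globalLoss f D (run f ηl ηs x₀ ω t).1 - Fstar) ∂seedLaw D A p b b' K
      = ∫ ω, globalLoss f D (run f ηl ηs x₀ ω t).1 ∂seedLaw D A p b b' K - Fstar := by
    rw [integral_sub hi' (integrable_const _)]
    simp
  rw [← hval]
  have hc0 : 0 ≤ c := by
    have hγ := contraction_factor_nonneg hA hp.le hp1 hη0.le hμ.le hμρ
    have ha : 0 ≤ globalLoss f D x₀ - Fstar := sub_nonneg.2 (hF _)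
    positivity
  rw [← ofReal_integral_eq_lintegral_ofReal hi (Filter.Eventually.of_forall hnn),
    ENNReal.ofReal_le_ofReal_iff hc0] at hle
  exact hle

end Trajectory


/-! ### Bounds on the anchor probability. -/

section AnchorProb

variable {A : ℕ} {μ c : ℝ}

/-- The `A`-th power of `c` times the anchor probability. -/
theorem anchorProb_base_bounds (hA : 1 ≤ A) (hμ : 0 < μ) :
    1 / ((A : ℝ) + 1) ≤ (1 + (A + 1) / (2 * μ ^ 2))
        - Real.sqrt (((A + 1) / (2 * μ ^ 2)) ^ 2 + A / μ ^ 2) ∧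
      (1 + (A + 1) / (2 * μ ^ 2)) - Real.sqrt (((A + 1) / (2 * μ ^ 2)) ^ 2 + A / μ ^ 2)
        ≤ 1 - 1 / (2 + μ ^ 2) := by
  have hA' : (1 : ℝ) ≤ A := by exact_mod_cast hA
  constructor
  -- One minus the base is the positive root w of w² + w(A + 1)/μ² = A/μ². Dropping w² gives w ≤
  -- A/(A + 1).
  · have h : Real.sqrt (((A + 1) / (2 * μ ^ 2)) ^ 2 + A / μ ^ 2)
        ≤ (A + 1) / (2 * μ ^ 2) + A / (A + 1) := by
      rw [Real.sqrt_le_left (by positivity)]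
      have e : ((A + 1) / (2 * μ ^ 2) + A / (A + 1)) ^ 2
          = ((A : ℝ) + 1) ^ 2 / (2 * μ ^ 2) ^ 2 + A / μ ^ 2 + (A / (A + 1)) ^ 2 := by
        field_simp; ring
      rw [e, div_pow]
      have : 0 ≤ ((A : ℝ) / (A + 1)) ^ 2 := by positivity
      linarith
    have e : (A : ℝ) / (A + 1) = 1 - 1 / (A + 1) := by field_simp; ring
    linarith
  · have hw : 1 / (2 + μ ^ 2) ≤ A / (A + 1 + μ ^ 2) := by
      rw [div_le_div_iff₀ (by positivity) (by positivity)]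
      nlinarith [sq_nonneg μ]
    have hw1 : A / (A + 1 + μ ^ 2) ≤ 1 := by
      rw [div_le_one (by positivity)]; nlinarith [sq_nonneg μ]
    -- Here w denotes the lower bound A/(A + 1 + μ²) for that root, obtained by replacing w² with
    -- the larger w.
    have h : (A + 1) / (2 * μ ^ 2) + A / (A + 1 + μ ^ 2)
        ≤ Real.sqrt (((A + 1) / (2 * μ ^ 2)) ^ 2 + A / μ ^ 2) := by
      refine Real.le_sqrt_of_sq_le ?_
      set w := (A : ℝ) / (A + 1 + μ ^ 2) with hwdef
      have hw0 : 0 ≤ w := by positivity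
      have e : w * ((A + 1) / μ ^ 2 + 1) = A / μ ^ 2 := by
        rw [hwdef]; field_simp
      have : w * w ≤ w * 1 := by gcongr
      have e2 : ((A + 1) / (2 * μ ^ 2) + w) ^ 2
          = ((A + 1) / (2 * μ ^ 2)) ^ 2 + w * ((A + 1) / μ ^ 2) + w * w := by
        field_simp; ring
      rw [e2]
      nlinarith
    linarith

/-- The base is at least 1/(A + 1) ≥ 2^(-A), so its A-th root is at least 1/2; dividing by c ≥ 1
only lowers the chance that there is no miner. -/
theorem anchorProb_bounds (hA : 1 ≤ A) (hμ : 0 < μ) (hc : 1 ≤ c) :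
    1 / (2 * c) ≤ anchorProb A μ c ∧ anchorProb A μ c ≤ 1 ∧
      1 / (2 + μ ^ 2) ≤ 1 - anchorProb A μ c ^ A := by
  obtain ⟨h1, h2⟩ := anchorProb_base_bounds hA hμ
  rw [anchorProb]
  set s := (1 + ((A : ℝ) + 1) / (2 * μ ^ 2))
    - Real.sqrt (((A + 1) / (2 * μ ^ 2)) ^ 2 + A / μ ^ 2)
  have hA0 : (A : ℝ) ≠ 0 := by positivity
  have hs0 : 0 < s := lt_of_lt_of_le (by positivity) h1
  have hs1 : s ≤ 1 := h2.trans (by have : 0 < 1 / (2 + μ ^ 2) := by positivity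
                                   linarith)
  have hq0 : 0 ≤ s ^ (1 / (A : ℝ)) := Real.rpow_nonneg hs0.le _
  have hq1 : s ^ (1 / (A : ℝ)) ≤ 1 := Real.rpow_le_one hs0.le hs1 (by positivity)
  have hc1 : 1 / c ≤ 1 := by rw [div_le_one (by positivity)]; exact hc
  have hc0 : 0 ≤ 1 / c := by positivity
  have hpow : (s ^ (1 / (A : ℝ))) ^ A = s := by
    rw [← Real.rpow_natCast, ← Real.rpow_mul hs0.le, one_div_mul_cancel hA0, Real.rpow_one]
  refine ⟨?_, mul_le_one₀ hc1 hq0 hq1, ?_⟩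
  · have hhalf : 1 / 2 ≤ s ^ (1 / (A : ℝ)) := by
      by_contra hlt
      push Not at hlt
      have h3 : (s ^ (1 / (A : ℝ))) ^ A < (1 / 2) ^ A := pow_lt_pow_left₀ hlt hq0 (by omega)
      rw [hpow] at h3
      have h4 : (A : ℝ) + 1 ≤ 2 ^ A := by exact_mod_cast Nat.lt_two_pow_self
      have h5 : (1 / 2 : ℝ) ^ A ≤ 1 / (A + 1) := by
        rw [one_div_pow]
        exact one_div_le_one_div_of_le (by positivity) h4
      linarith
    calc 1 / (2 * c) = 1 / c * (1 / 2) := by field_simp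
      _ ≤ _ := by gcongr
  · have : (1 / c * s ^ (1 / (A : ℝ))) ^ A ≤ s := by
      rw [mul_pow, hpow]
      exact mul_le_of_le_one_left hs0.le (pow_le_one₀ hc0 hc1)
    linarith

end AnchorProb

/-! ### Size of the large batch. -/

section LargeBatch

variable {M : ℕ} {n : ℕ∞} {μ σ ε : ℝ}

theorem coe_largeBatch (M : ℕ) (n : ℕ∞) (μ σ ε : ℝ) :
    (largeBatch M n μ σ ε : ℕ∞) = min ((max 1 ⌈σ ^ 2 / (M * μ * ε)⌉₊ : ℕ) : ℕ∞) n :=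
  ENat.natCast_toNat (ne_top_of_le_ne_top (ENat.natCast_ne_top _) (min_le_left _ _))

theorem largeBatch_le_size : (largeBatch M n μ σ ε : ℕ∞) ≤ n := by
  rw [coe_largeBatch]; exact min_le_right _ _

theorem one_le_largeBatch (hn : 1 ≤ n) : 1 ≤ largeBatch M n μ σ ε := by
  have h : (1 : ℕ∞) ≤ largeBatch M n μ σ ε := by
    rw [coe_largeBatch]
    exact le_min (by exact_mod_cast le_max_left _ _) hn
  exact_mod_cast h

theorem largeBatch_le (h : 0 ≤ σ ^ 2 / (M * μ * ε)) :
    (largeBatch M n μ σ ε : ℝ) ≤ σ ^ 2 / (M * μ * ε) + 1 := by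
  have h1 : largeBatch M n μ σ ε ≤ max 1 ⌈σ ^ 2 / (M * μ * ε)⌉₊ := by
    have : (largeBatch M n μ σ ε : ℕ∞) ≤ ((max 1 ⌈σ ^ 2 / (M * μ * ε)⌉₊ : ℕ) : ℕ∞) := by
      rw [coe_largeBatch]; exact min_le_left _ _
    exact_mod_cast this
  have h2 : (largeBatch M n μ σ ε : ℝ) ≤ max 1 (⌈σ ^ 2 / (M * μ * ε)⌉₊ : ℝ) := by
    exact_mod_cast h1
  refine h2.trans (max_le (by linarith) (Nat.ceil_lt_add_one h).le)

/-- Either alternative controls the noise: the full training set has none, and otherwise the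
variance σ²/b is at most Mμε. -/
theorem largeBatch_eq_size_or_le :
    (largeBatch M n μ σ ε : ℕ∞) = n ∨ σ ^ 2 / (M * μ * ε) ≤ largeBatch M n μ σ ε := by
  rcases le_total n ((max 1 ⌈σ ^ 2 / (M * μ * ε)⌉₊ : ℕ) : ℕ∞) with h | h
  · left; rw [coe_largeBatch, min_eq_right h]
  · right
    have e : largeBatch M n μ σ ε = max 1 ⌈σ ^ 2 / (M * μ * ε)⌉₊ := by
      have := coe_largeBatch M n μ σ ε
      rw [min_eq_left h] at this
      exact_mod_cast this
    rw [e]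
    exact (Nat.le_ceil _).trans (by exact_mod_cast le_max_right _ _)

end LargeBatch

/-! ### Learning rates and the contraction rate. -/

section Rates

variable {M A K : ℕ} {L μ c : ℝ}

theorem localRate_pos (hK : 0 < K) (hL : 0 < L) : 0 < localRate K L := by
  have : (0 : ℝ) < K := by exact_mod_cast hK
  rw [localRate]; positivity

theorem localRate_sq (hK : 0 < K) (hL : 0 < L) : 24 * (K * L * localRate K L) ^ 2 = 1 := by
  have hK' : (0 : ℝ) < K := by exact_mod_cast hK
  have e : K * L * localRate K L = 1 / (2 * Real.sqrt 6) := by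
    rw [localRate]; field_simp
  rw [e, div_pow, mul_pow, Real.sq_sqrt (by norm_num)]
  norm_num

/-- The minimum defining the global learning rate is attained by its second term. -/
theorem globalRate_eq (hM : 0 < M) (hA : 0 < A) (hL : 0 < L) (hμ : 0 < μ) (hμL : μ ≤ L)
    (hc : 1 ≤ c) :
    globalRate M A L μ c = 2 * Real.sqrt 6 * (1 + 32 * M * L * c / (μ * A))⁻¹ := by
  have hM' : (0 : ℝ) < M := by exact_mod_cast hM
  have hA' : (0 : ℝ) < A := by exact_mod_cast hA
  have hc' : 0 < c := by linarith
  rw [globalRate]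
  refine min_eq_right ?_
  have h1 : (1 + 32 * M * L * c / (μ * A))⁻¹ ≤ A * L / (2 * (M * μ * c)) := by
    rw [inv_le_comm₀ (by positivity) (by positivity), inv_div]
    have h2 : 2 * (M * μ * c) / (A * L) ≤ 32 * M * L * c / (μ * A) := by
      rw [div_le_div_iff₀ (by positivity) (by positivity)]
      have h3 : μ * μ ≤ L * L := by gcongr
      have h4 : 0 ≤ M * c * A := by positivity
      nlinarith [mul_nonneg h4 (mul_nonneg hL.le hL.le), mul_le_mul_of_nonneg_left h3 h4]
    linarith
  calc 2 * Real.sqrt 6 * (1 + 32 * M * L * c / (μ * A))⁻¹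
      ≤ 2 * Real.sqrt 6 * (A * L / (2 * (M * μ * c))) := by gcongr
    _ = _ := by field_simp

/-- The factors K and 2√6 cancel, so the effective step depends only on L, μ, c and M/A. -/
theorem globalRate_mul_localRate (hM : 0 < M) (hA : 0 < A) (hK : 0 < K) (hL : 0 < L) (hμ : 0 < μ)
    (hμL : μ ≤ L) (hc : 1 ≤ c) :
    globalRate M A L μ c * (K * localRate K L) = (L * (1 + 32 * M * L * c / (μ * A)))⁻¹ := by
  have hK' : (0 : ℝ) < K := by exact_mod_cast hK
  have hA' : (0 : ℝ) < A := by exact_mod_cast hA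
  rw [globalRate_eq hM hA hL hμ hμL hc, localRate]
  have h : 0 < 1 + 32 * M * L * c / (μ * A) := by positivity
  field_simp

/-- The effective step size `η` of the algorithm satisfies the requirements of the analysis. -/
theorem effectiveRate_bounds {η p : ℝ} (hA : 0 < A) (hAM : A ≤ M) (hL : 0 < L) (hμ : 0 < μ)
    (hμL : μ ≤ L) (hc : 1 ≤ c) (hp : 1 / (2 * c) ≤ p)
    (hη : η = (L * (1 + 32 * M * L * c / (μ * A)))⁻¹) :
    L * η ≤ 1 / 33 ∧ L * η ≤ p * A / M / 16 := by
  have hA' : (0 : ℝ) < A := by exact_mod_cast hA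
  have hM' : (0 : ℝ) < M := by exact_mod_cast hA.trans_le hAM
  have hAM' : (A : ℝ) ≤ M := by exact_mod_cast hAM
  have hc0 : 0 < c := by linarith
  have hX0 : 0 < 32 * M * L * c / (μ * A) := by positivity
  -- This uses μ ≤ L, A ≤ M and c ≥ 1; the added 1 then gives the 33.
  have hX32 : 32 ≤ 32 * M * L * c / (μ * A) := by
    rw [le_div_iff₀ (by positivity)]
    have h1 : μ * A ≤ L * M := by gcongr
    have h2 : L * M * 1 ≤ L * M * c := by gcongr
    linarith
  have hLη : L * η = (1 + 32 * M * L * c / (μ * A))⁻¹ := by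
    rw [hη, mul_inv, mul_inv_cancel_left₀ hL.ne']
  rw [hLη]
  constructor
  · rw [inv_le_comm₀ (by positivity) (by norm_num)]
    linarith
  · calc (1 + 32 * M * L * c / (μ * A))⁻¹ ≤ (32 * M * L * c / (μ * A))⁻¹ := by
          gcongr; linarith
      _ = μ / L * (1 / (2 * c)) * A / M / 16 := by field_simp; norm_num
      _ ≤ 1 * p * A / M / 16 := by
          have : μ / L ≤ 1 := (div_le_one hL).2 hμL
          gcongr
      _ = _ := by rw [one_mul]

/-- Lower bound for the contraction rate of the analysis, stated for its inverse. -/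
theorem inv_contractionRate_le {η q : ℝ} (hA : 0 < A) (hM : 0 < M) (hL : 0 < L) (hμ : 0 < μ)
    (hμL : μ ≤ L) (hc : 0 < c) (hq : 1 / (2 + μ ^ 2) ≤ q)
    (hη : η = (L * (1 + 32 * M * L * c / (μ * A)))⁻¹) :
    (3 / 4 * η * q * μ)⁻¹
      ≤ 4 / 3 * (2 + L ^ 2) * (L + 32 * L ^ 2 * c) * (1 / μ + M / (μ ^ 2 * A)) := by
  have hA' : (0 : ℝ) < A := by exact_mod_cast hA
  have hM' : (0 : ℝ) < M := by exact_mod_cast hM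
  have hq0 : 0 < q := lt_of_lt_of_le (by positivity) hq
  -- Since μ ≤ L, the factor 2 + μ² is absorbed into a constant depending on L.
  have h1 : q⁻¹ ≤ 2 + L ^ 2 := by
    rw [inv_le_comm₀ hq0 (by positivity)]
    refine le_trans ?_ hq
    rw [one_div]
    gcongr
  have h2 : (η * μ)⁻¹ ≤ (L + 32 * L ^ 2 * c) * (1 / μ + M / (μ ^ 2 * A)) := by
    have e : (η * μ)⁻¹ = L * (1 / μ) + 32 * L ^ 2 * c * (M / (μ ^ 2 * A)) := by
      rw [hη, mul_inv, inv_inv]; field_simp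
    have t1 : 0 ≤ L * (M / (μ ^ 2 * A)) := by positivity
    have t2 : 0 ≤ 32 * L ^ 2 * c * (1 / μ) := by positivity
    rw [e]
    linarith
  have hη0 : 0 < η := by rw [hη]; positivity
  have e : (3 / 4 * η * q * μ)⁻¹ = 4 / 3 * q⁻¹ * (η * μ)⁻¹ := by
    simp only [mul_inv]; ring
  rw [e, mul_assoc _ (L + 32 * L ^ 2 * c)]
  have : 0 < (η * μ)⁻¹ := by positivity
  gcongr

end Rates

/-! ### Counting rounds and samples. -/

/-- Rounding up and absorbing `log (6 Δ)` into the constant. -/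
theorem rounds_le {γ B y r Δ ε : ℝ} (hγ : 0 < γ) (hB : 0 ≤ B) (hy : 0 ≤ y) (hr : 1 ≤ r)
    (hΔ : 1 ≤ Δ) (hε : 0 < ε) (hε2 : ε ≤ 1 / 2) (h : γ⁻¹ ≤ B * y) :
    (⌈γ⁻¹ * Real.log (6 * Δ / ε)⌉₊ : ℝ)
      ≤ (B * (2 * Real.log (6 * Δ) + 1) + 2) * ((y + r) * Real.log (1 / ε)) := by
  have hℓ : 1 / 2 ≤ Real.log (1 / ε) := by
    have hlog2 : 1 / 2 < Real.log 2 := by linarith [Real.log_two_gt_d9]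
    refine hlog2.le.trans (Real.log_le_log two_pos ?_)
    rw [le_div_iff₀ hε]; linarith
  have hlogΔ : 0 ≤ Real.log (6 * Δ) := Real.log_nonneg (by linarith)
  have hlog0 : 0 ≤ Real.log (6 * Δ / ε) := by
    refine Real.log_nonneg ?_
    rw [le_div_iff₀ hε]; linarith
  have hlogε : Real.log (6 * Δ / ε) ≤ (2 * Real.log (6 * Δ) + 1) * Real.log (1 / ε) := by
    rw [show 6 * Δ / ε = 6 * Δ * (1 / ε) by ring, Real.log_mul (by positivity) (by positivity)]
    have := mul_le_mul_of_nonneg_left hℓ hlogΔ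
    linarith
  generalize Real.log (1 / ε) = ℓ at *
  generalize 2 * Real.log (6 * Δ) + 1 = κ at *
  have hκ0 : 0 ≤ κ := by
    by_contra hκ
    have : κ * ℓ < 0 := mul_neg_of_neg_of_pos (not_le.1 hκ) (by linarith)
    linarith
  have h1 : (⌈γ⁻¹ * Real.log (6 * Δ / ε)⌉₊ : ℝ) ≤ γ⁻¹ * Real.log (6 * Δ / ε) + 1 :=
    (Nat.ceil_lt_add_one (by positivity)).le
  have h2 : γ⁻¹ * Real.log (6 * Δ / ε) ≤ B * y * (κ * ℓ) := by gcongr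
  -- Rounding up costs one round. It is charged to r, used later as M/A ≥ 1, with log(1/ε) ≥ 1/2
  -- because ε ≤ 1/2.
  have h3 : 1 ≤ 2 * (r * ℓ) := by
    have : 1 * (1 / 2) ≤ r * ℓ := by gcongr
    linarith
  have hℓ0 : 0 ≤ ℓ := by linarith
  have t1 : 0 ≤ B * κ * (r * ℓ) := by positivity
  have t2 : 0 ≤ 2 * (y * ℓ) := by positivity
  linarith

/-- The sample count of a run in which every round has `A` participants. -/
theorem samplesCalled_le {M b b' K A : ℕ} {Ξ : Type*} (ω : Seed M b b' K Ξ) (T : ℕ)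
    (h : ∀ t, (ω.2 t).1.card = A) :
    samplesCalled ω T ≤ (M + T * A) * (b + K * b') := by
  have hround : ∀ t, (anchors (ω.2 t)).card * b + (miners (ω.2 t)).card * (K * b')
      ≤ A * (b + K * b') := by
    intro t
    have hsum : (anchors (ω.2 t)).card + (miners (ω.2 t)).card = A := by
      rw [← h t, ← Finset.card_filter_add_card_filter_not (s := (ω.2 t).1)
        (fun i => (ω.2 t).2.1 i = true)]
      simp [anchors, miners]
    rw [← hsum, add_mul]
    exact Nat.add_le_add (Nat.mul_le_mul_left _ (Nat.le_add_right _ _))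
      (Nat.mul_le_mul_left _ (Nat.le_add_left _ _))
  rw [samplesCalled]
  calc M * b + ∑ t ∈ Finset.range T, _ ≤ M * b + ∑ _t ∈ Finset.range T, A * (b + K * b') := by
        gcongr with t _
        exact hround t
    _ ≤ _ := by
        rw [Finset.sum_const, Finset.card_range, smul_eq_mul, add_mul, mul_assoc]
        exact Nat.add_le_add_right (Nat.mul_le_mul_left _ (Nat.le_add_right _ _)) _

/-- The assumptions of the convergence analysis, with the variance of the large batches. -/
theorem exists_batchModel {d M : ℕ} {n : ℕ∞} {Ξ : Type*} [MeasurableSpace Ξ]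
    {f : Fin M → Model d → Ξ → ℝ} {D : Fin M → Dataset Ξ} {L μ σ Lσ ε : ℝ} (hM : 0 < M)
    (hn : ∀ i, (D i).size = n) (hreg : Regular f D) (hs : LSmooth f D L)
    (hσ : BoundedNoise f D σ) (hLσ0 : 0 ≤ Lσ) (hLσ : AverageSmooth f D Lσ) (hμ : 0 < μ)
    (hε : 0 < ε) :
    ∃ V, 0 ≤ V ∧ V ≤ M * μ * ε ∧
      BatchModel f D L Lσ V (largeBatch M n μ σ ε) 1 := by
  have hM' : (0 : ℝ) < M := by exact_mod_cast hM
  have hn1 : 1 ≤ n := by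
    rw [← hn ⟨0, hM⟩]
    cases D ⟨0, hM⟩ with
    | stream P => exact le_top
    | finite n hn data => simpa [Dataset.size, Nat.one_le_iff_ne_zero] using hn.ne'
  have hb1 := one_le_largeBatch (M := M) (μ := μ) (σ := σ) (ε := ε) hn1
  have hbn : ∀ i, (largeBatch M n μ σ ε : ℕ∞) ≤ (D i).size := fun i => by
    rw [hn i]; exact largeBatch_le_size
  have h1n : ∀ i, ((1 : ℕ) : ℕ∞) ≤ (D i).size := fun i => by
    rw [hn i]; exact_mod_cast hn1
  have hunb : ∀ i (s : ℕ), 1 ≤ s → (s : ℕ∞) ≤ (D i).size →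
      IsUnbiased ((D i).batchLaw s) (fun B => batchGrad (f i) B)
        (gradient (localLoss (f i) (D i))) := fun i s hs1 hsn =>
    isUnbiased_batchGrad (D i) (hreg.1 i) (hreg.2.1 i) (hreg.2.2 i) (hs i).1 (hs i).2 hLσ0
      (fun v => by simpa using hσ i 1 le_rfl (h1n i) v)
      (fun v w => by simpa using hLσ i 1 le_rfl (h1n i) v w) hs1 hsn
  have hsmooth : ∀ i v w, ∫⁻ B, ENNReal.ofReal (‖(batchGrad (f i) B v - batchGrad (f i) B w)
      - (gradient (localLoss (f i) (D i)) v - gradient (localLoss (f i) (D i)) w)‖ ^ 2)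
        ∂(D i).batchLaw 1 ≤ ENNReal.ofReal (Lσ ^ 2 * ‖v - w‖ ^ 2) := fun i v w => by
    simpa only [enorm_sq_eq_ofReal, Nat.cast_one, div_one] using hLσ i 1 le_rfl (h1n i) v w
  have hmodel : ∀ V, (∀ i v, ∫⁻ B, ENNReal.ofReal
      (‖batchGrad (f i) B v - gradient (localLoss (f i) (D i)) v‖ ^ 2)
        ∂(D i).batchLaw (largeBatch M n μ σ ε) ≤ ENNReal.ofReal V) →
      BatchModel f D L Lσ V (largeBatch M n μ σ ε) 1 := fun V hV =>
    { prob_large := fun i => (D i).isProbabilityMeasure_batchLaw (hbn i)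
      prob_small := fun i => (D i).isProbabilityMeasure_batchLaw (h1n i)
      unbiased_large := fun i => hunb i _ hb1 (hbn i)
      unbiased_small := fun i => hunb i _ le_rfl (h1n i)
      noise := hV
      smooth := hsmooth
      lsmooth := hs }
  -- V is 0 for a batch that exhausts the data, and σ²/b otherwise.
  rcases largeBatch_eq_size_or_le (M := M) (n := n) (μ := μ) (σ := σ) (ε := ε) with h | h
  · refine ⟨0, le_rfl, by positivity, hmodel 0 fun i v => ?_⟩
    rw [lintegral_noise_batchLaw_size (D i) (hreg.1 i) (hreg.2.1 i) (h.trans (hn i).symm) v]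
    exact zero_le
  · have hb0 : (0 : ℝ) < largeBatch M n μ σ ε := by exact_mod_cast hb1
    refine ⟨σ ^ 2 / largeBatch M n μ σ ε, by positivity, ?_, hmodel _ fun i v => ?_⟩
    · rw [div_le_iff₀ hb0]
      rw [div_le_iff₀ (by positivity)] at h
      linarith
    · simpa only [enorm_sq_eq_ofReal] using hσ i _ hb1 (hbn i) v

/-- After `log (6 Δ / ε) / γ` rounds a contraction by `1 - γ` has reduced `Δ` to `ε / 6`. -/
theorem contraction_pow_mul_le {γ a Δ ε : ℝ} (hγ : 0 < γ) (hγ1 : 0 ≤ 1 - γ) (haΔ : a ≤ Δ)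
    (hΔ : 0 < Δ) (hε : 0 < ε) {T : ℕ} (hT : γ⁻¹ * Real.log (6 * Δ / ε) ≤ T) :
    (1 - γ) ^ T * a ≤ ε / 6 := by
  have h1 : (1 - γ) ^ T ≤ Real.exp (-(γ * T)) := by
    have := pow_le_pow_left₀ hγ1 (Real.one_sub_le_exp_neg γ) T
    rwa [← Real.exp_nat_mul, mul_neg, mul_comm (T : ℝ)] at this
  have h2 : Real.log (6 * Δ / ε) ≤ γ * T := by
    have := mul_le_mul_of_nonneg_left hT hγ.le
    rwa [mul_inv_cancel_left₀ hγ.ne'] at this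
  have h3 : Real.exp (-(γ * T)) ≤ ε / (6 * Δ) := by
    rw [← Real.exp_log (show 0 < ε / (6 * Δ) by positivity), Real.exp_le_exp,
      ← inv_div, Real.log_inv]
    linarith
  calc (1 - γ) ^ T * a ≤ (1 - γ) ^ T * Δ := by gcongr
    _ ≤ ε / (6 * Δ) * Δ := by gcongr; exact h1.trans h3
    _ = ε / 6 := by field_simp

/-- Cumulative gradient complexity in terms of the number of rounds. -/
theorem samples_bound {M A K T b : ℕ} {C μ y ℓ : ℝ} (hA : 0 < A) (hμ : 0 < μ) (hy : 0 ≤ y)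
    (hℓ : 1 / 2 ≤ ℓ) (hK : 1 ≤ (K : ℝ)) (hC : 0 ≤ C) (hb : (b : ℝ) ≤ y + 1)
    (hT : (T : ℝ) ≤ C * ((1 / μ + M / (μ ^ 2 * A) + M / A) * ℓ)) :
    (((M + T * A) * (b + K * 1) : ℕ) : ℝ)
      ≤ 2 * (2 + C) * ((A / μ + M / μ ^ 2 + M) * (y + K) * ℓ) := by
  have hA' : (0 : ℝ) < A := by exact_mod_cast hA
  push_cast
  have h1 : (T : ℝ) * A ≤ C * ((A / μ + M / μ ^ 2 + M) * ℓ) := by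
    calc (T : ℝ) * A ≤ C * ((1 / μ + M / (μ ^ 2 * A) + M / A) * ℓ) * A := by gcongr
      _ = _ := by field_simp
  -- The initialization batches cost M even when T = 0; they are absorbed using log(1/ε) ≥ 1/2.
  have h2 : (M : ℝ) ≤ 2 * ((A / μ + M / μ ^ 2 + M) * ℓ) := by
    have h0 : 0 ≤ A / μ + M / μ ^ 2 := by positivity
    have hM0 : (0 : ℝ) ≤ M := M.cast_nonneg
    calc (M : ℝ) ≤ 2 * (M * (1 / 2)) := by linarith
      _ ≤ 2 * ((A / μ + M / μ ^ 2 + M) * ℓ) := by gcongr; linarith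
  have h3 : (b : ℝ) + K * 1 ≤ 2 * (y + K) := by linarith
  calc ((M : ℝ) + T * A) * (b + K * 1)
      ≤ (2 * ((A / μ + M / μ ^ 2 + M) * ℓ) + C * ((A / μ + M / μ ^ 2 + M) * ℓ)) * (2 * (y + K)) := by
        gcongr
    _ = _ := by ring

end FedAMD

/-! ### Assembly. -/

theorem corollary4 (L Δ c : ℝ) (hL : 0 < L) (hc : 1 ≤ c) :
    ∃ C : ℝ, 0 < C ∧
      ∀ (d M A K : ℕ) (n : ℕ∞) (Ξ : Type*) [MeasurableSpace Ξ]
        (f : Fin M → FedAMD.Model d → Ξ → ℝ) (D : Fin M → FedAMD.Dataset Ξ)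
        (x₀ : FedAMD.Model d) (Fstar μ σ Lσ ε : ℝ),
        1 ≤ A → A ≤ M →
        (∀ i, (D i).size = n) →
        FedAMD.Regular f D →
        FedAMD.LSmooth f D L →
        0 ≤ σ → FedAMD.BoundedNoise f D σ →
        0 ≤ Lσ → FedAMD.AverageSmooth f D Lσ →
        IsGLB (Set.range (FedAMD.globalLoss f D)) Fstar →
        0 < μ → FedAMD.PL (FedAMD.globalLoss f D) Fstar μ →
        FedAMD.globalLoss f D x₀ - Fstar ≤ Δ →
        max 1 (2 * Lσ ^ 2 / L ^ 2) ≤ (K : ℝ) →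
        0 < ε → ε ≤ 1 / 2 →
        let b := FedAMD.largeBatch M n μ σ ε
        let P := FedAMD.seedLaw D A (FedAMD.anchorProb A μ c) b 1 K
        let model : ℕ → FedAMD.Seed M b 1 K Ξ → FedAMD.Model d := fun T ω =>
          (FedAMD.run f (FedAMD.localRate K L) (FedAMD.globalRate M A L μ c) x₀ ω T).1
        ∃ T₀ : ℕ,
          (T₀ : ℝ) ≤ C * ((1 / μ + M / (μ ^ 2 * A) + M / A) * Real.log (1 / ε)) ∧
          (∀ T : ℕ, T₀ ≤ T →
            Integrable (fun ω => FedAMD.globalLoss f D (model T ω)) P ∧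
            ∫ ω, FedAMD.globalLoss f D (model T ω) ∂P - Fstar ≤ ε) ∧
          ∀ ω : FedAMD.Seed M b 1 K Ξ, (∀ t, (ω.2 t).1.card = A) →
            (FedAMD.samplesCalled ω T₀ : ℝ) ≤
              C * ((A / μ + M / μ ^ 2 + M) * (σ ^ 2 / (M * μ * ε) + K) * Real.log (1 / ε)) := by
  have hc0 : 0 < c := by linarith
  -- The bound on the initial gap is raised to at least 1, so that log(6Δ) is nonnegative and can
  -- enter the constant.
  have hΔ0 : 0 < max Δ 1 := by positivity
  have hlogΔ : 0 ≤ Real.log (6 * max Δ 1) :=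
    Real.log_nonneg (by linarith [le_max_right Δ 1])
  have hB0 : 0 ≤ 4 / 3 * (2 + L ^ 2) * (L + 32 * L ^ 2 * c) := by positivity
  obtain ⟨C₁, hC₁⟩ : ∃ C₁, C₁ = 4 / 3 * (2 + L ^ 2) * (L + 32 * L ^ 2 * c) *
    (2 * Real.log (6 * max Δ 1) + 1) + 2 := ⟨_, rfl⟩
  have hC₁0 : 0 ≤ C₁ := by rw [hC₁]; positivity
  have hC₁2 : C₁ ≤ 2 * (2 + C₁) := by linarith
  refine ⟨2 * (2 + C₁), by positivity, ?_⟩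
  intro d M A K n Ξ _ f D x₀ Fstar μ σ Lσ ε hA1 hAM hn hreg hs hσ0 hσ hLσ0 hLσ hF hμ hPL hx₀ hK
    hε hε2
  dsimp only
  have hM : 0 < M := hA1.trans hAM
  have hM' : (0 : ℝ) < M := by exact_mod_cast hM
  have hA' : (0 : ℝ) < A := by exact_mod_cast hA1
  have hAM' : (A : ℝ) ≤ M := by exact_mod_cast hAM
  have hK1 : (1 : ℝ) ≤ K := (le_max_left _ _).trans hK
  have hK0 : 0 < K := by exact_mod_cast zero_lt_one.trans_le hK1
  have hKσ : 2 * Lσ ^ 2 ≤ K * L ^ 2 := by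
    rw [← div_le_iff₀ (by positivity)]; exact (le_max_right _ _).trans hK
  have hFle : ∀ x, Fstar ≤ FedAMD.globalLoss f D x := fun x => hF.1 ⟨x, rfl⟩
  have hℓ : 1 / 2 ≤ Real.log (1 / ε) := by
    have hlog2 : 1 / 2 < Real.log 2 := by linarith [Real.log_two_gt_d9]
    refine hlog2.le.trans (Real.log_le_log two_pos ?_)
    rw [le_div_iff₀ hε]; linarith
  have hy : 0 ≤ σ ^ 2 / (M * μ * ε) := by positivity
  obtain ⟨V, hV0, hVle, hP⟩ := FedAMD.exists_batchModel (σ := σ) (ε := ε) hM hn hreg hs hσ hLσ0 hLσ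
    hμ hε
  obtain ⟨hp2, hp1, hpq⟩ := FedAMD.anchorProb_bounds hA1 hμ hc
  generalize FedAMD.anchorProb A μ c = p at hp2 hp1 hpq ⊢
  have hp0 : 0 < p := lt_of_lt_of_le (by positivity) hp2
  have hsamples : ∀ T₀ : ℕ, (T₀ : ℝ) ≤ C₁ * ((1 / μ + M / (μ ^ 2 * A) + M / A) * Real.log (1 / ε)) →
      ∀ ω : FedAMD.Seed M (FedAMD.largeBatch M n μ σ ε) 1 K Ξ, (∀ t, (ω.2 t).1.card = A) →
        (FedAMD.samplesCalled ω T₀ : ℝ) ≤ 2 * (2 + C₁) *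
          ((A / μ + M / μ ^ 2 + M) * (σ ^ 2 / (M * μ * ε) + K) * Real.log (1 / ε)) := by
    intro T₀ hT₀ ω hω
    refine le_trans (Nat.cast_le.2 (FedAMD.samplesCalled_le ω T₀ hω)) ?_
    exact FedAMD.samples_bound hA1 hμ hy hℓ hK1 hC₁0 (FedAMD.largeBatch_le hy) hT₀
  have hR0 : 0 ≤ (1 / μ + M / (μ ^ 2 * A) + M / A) * Real.log (1 / ε) := by positivity
  -- For μ > L, 2μ(F - F_*) ≤ ‖∇F‖² ≤ 2L(F - F_*) forces F = F_* everywhere, so `T₀ = 0` works. The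
  -- step-size analysis needs μ ≤ L.
  rcases lt_or_ge L μ with hLμ | hμL
  · have hconst : ∀ x, FedAMD.globalLoss f D x = Fstar := by
      intro x
      have h1 := FedAMD.norm_gradient_sq_le hL (FedAMD.differentiable_globalLoss hs)
        (FedAMD.globalLoss_lipschitz hM hs) hFle x
      have h2 := hPL x
      have h3 := hFle x
      nlinarith
    have := FedAMD.isProbabilityMeasure_seedLaw (K := K) hP hp0.le hp1 hAM
    refine ⟨0, by rw [Nat.cast_zero]; positivity, fun T _ => ?_, hsamples 0 (by
      rw [Nat.cast_zero]; positivity)⟩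
    simp only [hconst]
    exact ⟨integrable_const _, by simp [hε.le]⟩
  · obtain ⟨η, hη⟩ : ∃ η, η = FedAMD.globalRate M A L μ c * (K * FedAMD.localRate K L) := ⟨_, rfl⟩
    have hηX : η = (L * (1 + 32 * M * L * c / (μ * A)))⁻¹ :=
      hη.trans (FedAMD.globalRate_mul_localRate hM hA1 hK0 hL hμ hμL hc)
    have hη0 : 0 < η := by rw [hηX]; positivity
    have hηs : 0 < FedAMD.globalRate M A L μ c := by
      rw [FedAMD.globalRate_eq hM hA1 hL hμ hμL hc]; positivity
    obtain ⟨hLη33, hLρ⟩ := FedAMD.effectiveRate_bounds hA1 hAM hL hμ hμL hc hp2 hηX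
    have hμρ : μ * η ≤ p * A / M / 16 := (mul_le_mul_of_nonneg_right hμL hη0.le).trans hLρ
    have hγinv := FedAMD.inv_contractionRate_le hA1 hM hL hμ hμL hc0 hpq hηX
    have hγ0 : 0 < 3 / 4 * η * (1 - p ^ A) * μ := by
      have hq : 0 < 1 - p ^ A := lt_of_lt_of_le (by positivity) hpq
      positivity
    have hγ1 := FedAMD.contraction_factor_nonneg hAM hp0.le hp1 hη0.le hμ.le hμρ
    have hT₀ := FedAMD.rounds_le hγ0 hB0 (by positivity)
      ((one_le_div hA').2 hAM') (le_max_right Δ 1) hε hε2 hγinv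
    rw [← hC₁] at hT₀
    refine ⟨_, hT₀.trans (mul_le_mul_of_nonneg_right hC₁2 hR0), fun T hT => ?_,
      hsamples _ hT₀⟩
    obtain ⟨hint, hle⟩ := FedAMD.expected_suboptimality_le (x₀ := x₀) hP hV0 hA1 hAM hL
      (FedAMD.localRate_pos hK0 hL) hηs (FedAMD.localRate_sq hK0 hL) hKσ hη hη0 hFle hμ hPL hp0
      hp1 hLη33 hLρ hμρ T
    refine ⟨hint, hle.trans ?_⟩
    have h1 := FedAMD.contraction_pow_mul_le hγ0 hγ1 (hx₀.trans (le_max_left Δ 1)) hΔ0 hε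
      ((Nat.le_ceil _).trans (Nat.cast_le.2 hT))
    -- The final accuracy splits as ε/6 from contraction and 5ε/6 from noise.
    have h2 : V / (M * μ) ≤ ε := by
      rw [div_le_iff₀ (by positivity)]; linarith
    linarith
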